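/- **Setting.** Let $\alpha>0$ (path-loss exponent) and $\beta\ge 1$ (SINR threshold) be fixed. An instance consists of $n$ distinct nodes $V$ in an arbitrary metric space $(X,d)$, a link graph $G$ on $V$ (the node pairs that are available as links; any graph), and a noise level $N\ge 0$. A directed link $e=(s_e,r_e)$ has length $\ell_e=d(s_e,r_e)$. A set $S$ of directed links is *feasible* under powers $P$ if for every $v\in S$ we have $P_v>0$ and $$\frac{P_v/\ell_v^{\alpha}}{N+\sum_{u\in S\setminus\{v\}}P_u/d(s_u,r_v)^{\alpha}}\ \ge\ \beta ,$$ where interference at distance $0$ is infinite and a positive number over $0$ is $\infty$. A positive power assignment $P$ on the available links (in both directions) is *monotone* if $\ell_e\le\ell_f$ implies $P_e\le P_f$ and $P_f/\ell_f^{\alpha}\le P_e/\ell_e^{\alpha}$. A *dual* of $P$ is an assignment $P^*_e=\kappa\,\ell_e^{\alpha}/P_e$ with a scaling constant $\kappa>0$. In Connectivity Scheduling one seeks a spanning tree $T$ of $G$ and a coloring of its edges with as few colors (slots) as possible such that every color class is feasible. Algorithms run in time polynomial in $n$ on a real random access machine: unit-cost addition, truncated subtraction and comparison of natural numbers, indexed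 memory access, unit-cost field operations, comparison and $x\mapsto |x|^{\alpha}$ on reals, with natural numbers as the only constants. The input is $n$, the adjacency matrix of $G$, the distance matrix, $\beta$, $N$ and, for fixed powers, the powers of the links. **Theorem.** Connectivity Scheduling in the SINR model on arbitrary metric spaces, with an arbitrary link graph, has polynomial-time $O(\log n)$-approximations, where the implied constants depend only on $\alpha$ and $\beta$: 1. *Fixed monotone powers.* There are a constant $C$ and a polynomial-time algorithm such that the following holds for every instance and every monotone power assignment $P$. Let $\chi$ be the least number of slots in which the edges of some spanning tree of $G$, each directed in some way, can be scheduled in sets feasible under $P$. If $\chi$ exists, the algorithm outputs a spanning tree $T$ of $G$, a direction of each of its edges and a coloring of its edges with $k$ colors, such that each color class is feasible under $P$ in the chosen directions, and each color class with all directions reversed is feasible under one and the same dual of $P$; and $2k\le C\log n\cdot\chi$. (So all tree edges are scheduled in both directions in $2k=O(\log n)\cdot\chi$ slots.) 2. *Global power control.* There are a constant $C$ and a polynomial-time algorithm such that the following holds for every instance. Let $\chi$ be the least number of slots in which the edges of some spanning tree of $G$, each directed in some way, can be scheduled so that each slot is feasible under some powers, which may be chosen separately for each slot. If $\chi$ exists,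 the algorithm outputs a spanning tree $T$ of $G$ and a coloring of its edges with $k\le C\log n\cdot\chi$ colors, such that for every direction of the edges of $T$ each color class is feasible under some powers. If $\chi$ does not exist, the algorithms still halt within the same time bound. -/

import Mathlib

open scoped ENNReal

/-! ### The metric SINR model

A link is an ordered pair `(sender, receiver)` of nodes; `pos` places the nodes in a metric
space, and a power assignment is a function on links. -/

namespace SINR

variable {V X : Type*} [MetricSpace X]

/-- Length of a link. -/
noncomputable def len (pos : V → X) (e : V × V) : ℝ := dist (pos e.1) (pos e.2)

/-- Strength at the receiver of `v` of the signal sent by the sender of `u`. The value is `∞` if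
these two nodes coincide (and the power is positive). -/
noncomputable def received (α : ℝ) (pos : V → X) (P : V × V → ℝ) (u v : V × V) : ℝ≥0∞ :=
  ENNReal.ofReal (P u) / edist (pos u.1) (pos v.2) ^ α

/-- Signal to interference and noise ratio at link `v` when the links of `S` transmit
simultaneously. -/
noncomputable def sinr [DecidableEq V] (α N : ℝ) (pos : V → X) (P : V × V → ℝ)
    (S : Finset (V × V)) (v : V × V) : ℝ≥0∞ :=
  received α pos P v v / (ENNReal.ofReal N + ∑ u ∈ S.erase v, received α pos P u v)

/-- All links of `S` can transmit simultaneously with the powers `P`. -/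
def Feasible [DecidableEq V] (α β N : ℝ) (pos : V → X) (P : V × V → ℝ)
    (S : Finset (V × V)) : Prop :=
  ∀ v ∈ S, 0 < P v ∧ ENNReal.ofReal β ≤ sinr α N pos P S v

/-- `P` is a positive monotone power assignment for the links available in `G`: along
non-decreasing length, powers do not decrease and received signal strengths do not increase. -/
def IsMonotonePower (α : ℝ) (pos : V → X) (G : SimpleGraph V) (P : V × V → ℝ) : Prop :=
  (∀ e : V × V, G.Adj e.1 e.2 → 0 < P e) ∧
  ∀ e f : V × V, G.Adj e.1 e.2 → G.Adj f.1 f.2 → len pos e ≤ len pos f →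
    P e ≤ P f ∧ P f / len pos f ^ α ≤ P e / len pos e ^ α

/-- The dual of the power assignment `P`, with scaling factor `κ`. -/
noncomputable def dualPower (α κ : ℝ) (pos : V → X) (P : V × V → ℝ) : V × V → ℝ :=
  fun e => κ * len pos e ^ α / P e

end SINR

/-! ### Connectivity scheduling -/

namespace ConnSched

variable {V X : Type*} [MetricSpace X]

/-- `T` is a spanning tree of the link graph `G`, and `color` colors its edges with the colors
`0, …, k - 1`. -/
structure IsColoredSpanningTree (G T : SimpleGraph V) (color : Sym2 V → ℕ) (k : ℕ) : Prop where
  le : T ≤ G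
  isTree : T.IsTree
  color_lt : ∀ e ∈ T.edgeSet, color e < k

/-- `D` contains each edge of `T` in exactly one of its two directions, and nothing else. -/
def IsOrientation (T : SimpleGraph V) (D : Finset (V × V)) : Prop :=
  (∀ u v, (u, v) ∈ D → T.Adj u v) ∧ ∀ u v, T.Adj u v → ((u, v) ∈ D ↔ (v, u) ∉ D)

/-- The directed links of color `i`. -/
def slot (D : Finset (V × V)) (color : Sym2 V → ℕ) (i : ℕ) : Finset (V × V) :=
  D.filter fun e => color s(e.1, e.2) = i

/-- The links of `S` with their directions reversed. -/
def reversed [DecidableEq V] (S : Finset (V × V)) : Finset (V × V) := S.image Prod.swap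

/-- With the fixed powers `P`, the links of some spanning tree of `G`, each one directed in some
way, can be scheduled in `k` slots. -/
def FixedSchedulable [DecidableEq V] (α β N : ℝ) (pos : V → X) (G : SimpleGraph V)
    (P : V × V → ℝ) (k : ℕ) : Prop :=
  ∃ (T : SimpleGraph V) (color : Sym2 V → ℕ) (D : Finset (V × V)),
    IsColoredSpanningTree G T color k ∧ IsOrientation T D ∧
      ∀ i < k, SINR.Feasible α β N pos P (slot D color i)

/-- With power control, the links of some spanning tree of `G`, each one directed in some way,
can be scheduled in `k` slots; each slot may use powers of its own. -/
def GlobalSchedulable [DecidableEq V] (α β N : ℝ) (pos : V → X) (G : SimpleGraph V)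
    (k : ℕ) : Prop :=
  ∃ (T : SimpleGraph V) (color : Sym2 V → ℕ) (D : Finset (V × V)),
    IsColoredSpanningTree G T color k ∧ IsOrientation T D ∧
      ∀ i < k, ∃ P : V × V → ℝ, SINR.Feasible α β N pos P (slot D color i)

end ConnSched

/-! ### A real random access machine

Programs work on two-dimensional arrays (numbered by natural numbers) of natural numbers and of
real numbers. Unit-cost operations: addition and truncated subtraction of natural numbers, the
four field operations and `x ↦ |x| ^ α` on reals (`α` is the path-loss exponent), indexed reading
and writing, comparisons. The only constants are natural numbers, and real numbers influence
natural numbers and the flow of control only through comparisons. -/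

namespace RealRAM

structure Memory where
  nat : ℕ → ℕ → ℕ → ℕ
  real : ℕ → ℕ → ℕ → ℝ

inductive NatExpr where
  | lit (k : ℕ)
  | get (A : ℕ) (i j : NatExpr)
  | add (a b : NatExpr)
  | sub (a b : NatExpr)

inductive RealExpr where
  | lit (k : ℕ)
  | get (A : ℕ) (i j : NatExpr)
  | add (x y : RealExpr)
  | sub (x y : RealExpr)
  | mul (x y : RealExpr)
  | div (x y : RealExpr)
  | pow (x : RealExpr)

inductive Cond where
  | natLe (a b : NatExpr)
  | realLe (x y : RealExpr)
  | neg (b : Cond)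
  | conj (b c : Cond)

inductive Program where
  | skip
  | setNat (A : ℕ) (i j e : NatExpr)
  | setReal (A : ℕ) (i j : NatExpr) (e : RealExpr)
  | seq (p q : Program)
  | ite (b : Cond) (p q : Program)
  | loop (b : Cond) (p : Program)

def NatExpr.eval (σ : Memory) : NatExpr → ℕ
  | .lit k => k
  | .get A i j => σ.nat A (i.eval σ) (j.eval σ)
  | .add a b => a.eval σ + b.eval σ
  | .sub a b => a.eval σ - b.eval σ

def NatExpr.cost : NatExpr → ℕ
  | .lit _ => 1
  | .get _ i j => i.cost + j.cost + 1
  | .add a b => a.cost + b.cost + 1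
  | .sub a b => a.cost + b.cost + 1

noncomputable def RealExpr.eval (α : ℝ) (σ : Memory) : RealExpr → ℝ
  | .lit k => k
  | .get A i j => σ.real A (i.eval σ) (j.eval σ)
  | .add x y => x.eval α σ + y.eval α σ
  | .sub x y => x.eval α σ - y.eval α σ
  | .mul x y => x.eval α σ * y.eval α σ
  | .div x y => x.eval α σ / y.eval α σ
  | .pow x => |x.eval α σ| ^ α

def RealExpr.cost : RealExpr → ℕ
  | .lit _ => 1
  | .get _ i j => i.cost + j.cost + 1
  | .add x y => x.cost + y.cost + 1
  | .sub x y => x.cost + y.cost + 1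
  | .mul x y => x.cost + y.cost + 1
  | .div x y => x.cost + y.cost + 1
  | .pow x => x.cost + 1

def Cond.eval (α : ℝ) (σ : Memory) : Cond → Prop
  | .natLe a b => a.eval σ ≤ b.eval σ
  | .realLe x y => x.eval α σ ≤ y.eval α σ
  | .neg b => ¬ b.eval α σ
  | .conj b c => b.eval α σ ∧ c.eval α σ

def Cond.cost : Cond → ℕ
  | .natLe a b => a.cost + b.cost + 1
  | .realLe x y => x.cost + y.cost + 1
  | .neg b => b.cost + 1
  | .conj b c => b.cost + c.cost + 1

def Memory.writeNat (σ : Memory) (A i j a : ℕ) : Memory :=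
  { σ with nat := fun A' i' j' => if A' = A ∧ i' = i ∧ j' = j then a else σ.nat A' i' j' }

noncomputable def Memory.writeReal (σ : Memory) (A i j : ℕ) (x : ℝ) : Memory :=
  { σ with real := fun A' i' j' => if A' = A ∧ i' = i ∧ j' = j then x else σ.real A' i' j' }

/-- `Exec α p σ τ t`: the program `p`, started with memory `σ`, halts after `t` steps with
memory `τ`. -/
inductive Exec (α : ℝ) : Program → Memory → Memory → ℕ → Prop where
  | skip (σ : Memory) : Exec α .skip σ σ 1
  | setNat (A : ℕ) (i j e : NatExpr) (σ : Memory) :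
      Exec α (.setNat A i j e) σ (σ.writeNat A (i.eval σ) (j.eval σ) (e.eval σ))
        (i.cost + j.cost + e.cost + 1)
  | setReal (A : ℕ) (i j : NatExpr) (e : RealExpr) (σ : Memory) :
      Exec α (.setReal A i j e) σ (σ.writeReal A (i.eval σ) (j.eval σ) (e.eval α σ))
        (i.cost + j.cost + e.cost + 1)
  | seq {p q : Program} {σ σ' σ'' : Memory} {s t : ℕ} :
      Exec α p σ σ' s → Exec α q σ' σ'' t → Exec α (.seq p q) σ σ'' (s + t)
  | iteTrue {b : Cond} {p q : Program} {σ σ' : Memory} {t : ℕ} :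
      b.eval α σ → Exec α p σ σ' t → Exec α (.ite b p q) σ σ' (b.cost + t)
  | iteFalse {b : Cond} {p q : Program} {σ σ' : Memory} {t : ℕ} :
      ¬ b.eval α σ → Exec α q σ σ' t → Exec α (.ite b p q) σ σ' (b.cost + t)
  | loopDone {b : Cond} {p : Program} {σ : Memory} :
      ¬ b.eval α σ → Exec α (.loop b p) σ σ b.cost
  | loopStep {b : Cond} {p : Program} {σ σ' σ'' : Memory} {s t : ℕ} :
      b.eval α σ → Exec α p σ σ' s → Exec α (.loop b p) σ' σ'' t →
        Exec α (.loop b p) σ σ'' (b.cost + s + t)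

open Classical in
/-- Initial memory. Natural numbers: cell `(0, 0)` of array `0` holds the number of nodes, array
`1` the adjacency matrix of the link graph. Reals: array `0` holds the distance matrix, array `1`
the powers of the links, array `2` the SINR threshold and the noise. Everything else is `0`. -/
noncomputable def input {n : ℕ} {X : Type*} [MetricSpace X] (β N : ℝ) (pos : Fin n → X)
    (G : SimpleGraph (Fin n)) (P : Fin n × Fin n → ℝ) : Memory where
  nat A i j :=
    if A = 0 ∧ i = 0 ∧ j = 0 then n
    else if A = 1 ∧ ∃ (hi : i < n) (hj : j < n), G.Adj ⟨i, hi⟩ ⟨j, hj⟩ then 1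
    else 0
  real A i j :=
    if h : i < n ∧ j < n ∧ A = 0 then dist (pos ⟨i, h.1⟩) (pos ⟨j, h.2.1⟩)
    else if h : i < n ∧ j < n ∧ A = 1 then P (⟨i, h.1⟩, ⟨j, h.2.1⟩)
    else if A = 2 ∧ i = 0 ∧ j = 0 then β
    else if A = 2 ∧ i = 0 ∧ j = 1 then N
    else 0

/-- The memory holds the tree `T` (adjacency matrix in array `2`), its coloring (array `3`) and
the number `k` of colors (cell `(0, 0)` of array `5`). -/
def OutputsTree {n : ℕ} (τ : Memory) (T : SimpleGraph (Fin n)) (color : Sym2 (Fin n) → ℕ)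
    (k : ℕ) : Prop :=
  (∀ u v : Fin n, T.Adj u v ↔ τ.nat 2 u v = 1) ∧
  (∀ u v : Fin n, T.Adj u v → τ.nat 3 u v = color s(u, v)) ∧
  τ.nat 5 0 0 = k

/-- The memory holds the set `D` of directed links (array `4`). -/
def OutputsLinks {n : ℕ} (τ : Memory) (D : Finset (Fin n × Fin n)) : Prop :=
  ∀ u v : Fin n, (u, v) ∈ D ↔ τ.nat 4 u v = 1

end RealRAM

/-! Both algorithms are one greedy procedure with different symmetric conflict weights `W`. Given
the forest F of links chosen so far, a round grows a set G by repeatedly adding a shortest usable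
link that joins two components of F ∪ G and whose load, its total weight to G, is at most 1/K. The
links whose final load is at most 4/K are kept and form one color. By symmetry the total load is at
most 2|G|/K, so at least half of G is kept (`Rule.Greedy.card_le`).

Progress is measured against an optimal schedule with χ slots. If F has c ≥ 2 components, some slot
contains a set O of at least (c - 1)/χ links that is independent over F in the graphic matroid
(`exists_large_indep`). Feasible sets are sparse: half of O can be chosen so that every usable link
w has total weight at most C to the chosen links that are not shorter than w (`Rule.Coverable`).
Greedy rejects a chosen link v either because its ends are already connected, which by independence
happens at most |G| times, or because links of G not longer than v have total weight above 1/K at v,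
which by double counting happens at most KC|G| times. Hence each round lowers c - 1 by a factor 1 -
1/(4(1 + KC)χ) (`Rule.IsRound.progress`), and O(χ log n) rounds suffice (`Rule.IsTrace.rounds_le`).

Each power regime then needs sparsity of feasible sets and feasibility of kept sets. Sparsity uses
only the triangle inequality: in a sum over links not shorter than w, the link nearest to an end of
w costs at most one, and every other term is compared with the interference between that link and
the nearest one (`sum_le_of_nearest`). For monotone powers the weight is the capped relative
interference in both directions (`fixed_cover`); its incoming half makes a kept set feasible and its
outgoing half makes the reversed set feasible under the dual (`fixed_feasible`). For power control
the weight compares the shorter length with all four endpoint distances. Geometric means eliminate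
the unknown powers (`global_cover`), and suitable powers for a kept set are built from long links to
short ones (`exists_powers`, `global_feasible`).

Finally, a concrete program is verified against the abstract procedure (`run_mainProg`). Every loop
in it runs once per node, so its cost is polynomial on every instance. -/

/-! ### Components of a set of links -/

namespace ConnSched

open Finset

variable {V : Type*}

/-- The undirected graph whose edges are the links of `E`. -/
def linkGraph (E : Finset (V × V)) : SimpleGraph V := SimpleGraph.fromRel fun u v => (u, v) ∈ E

/-- The nodes `x` and `y` lie in the same component of the links of `E`. -/
def Joined (E : Finset (V × V)) (x y : V) : Prop := (linkGraph E).Reachable x y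

/-- Equality of the labels `L` describes the components of the links of `E`. -/
def IsLabel (E : Finset (V × V)) (L : V → ℕ) : Prop := ∀ x y, L x = L y ↔ Joined E x y

/-- The number of components of the links of `E`. -/
noncomputable def numComp (E : Finset (V × V)) : ℕ := Nat.card (linkGraph E).ConnectedComponent

lemma linkGraph_adj {E : Finset (V × V)} {x y : V} :
    (linkGraph E).Adj x y ↔ x ≠ y ∧ ((x, y) ∈ E ∨ (y, x) ∈ E) := by
  simp [linkGraph, SimpleGraph.fromRel_adj]

lemma Joined.refl (E : Finset (V × V)) (x : V) : Joined E x x := SimpleGraph.Reachable.refl x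

lemma Joined.symm {E : Finset (V × V)} {x y : V} (h : Joined E x y) : Joined E y x :=
  SimpleGraph.Reachable.symm h

lemma Joined.trans {E : Finset (V × V)} {x y z : V} (h : Joined E x y) (h' : Joined E y z) :
    Joined E x z := SimpleGraph.Reachable.trans h h'

lemma joined_of_mem {E : Finset (V × V)} {e : V × V} (h : e ∈ E) : Joined E e.1 e.2 := by
  by_cases hne : e.1 = e.2
  · rw [hne]; exact Joined.refl E _
  · exact SimpleGraph.Adj.reachable (linkGraph_adj.2 ⟨hne, Or.inl h⟩)

/-- A walk cannot change a quantity that no link changes. Taking for `f` the component map of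
another set of links gives `Joined.of_forall`, through which nearly all later connectivity arguments
pass. -/
lemma Joined.eq_of_const {E : Finset (V × V)} {γ : Type*} {f : V → γ}
    (hf : ∀ e ∈ E, f e.1 = f e.2) {x y : V} (h : Joined E x y) : f x = f y := by
  obtain ⟨p⟩ := h
  induction p with
  | nil => rfl
  | cons hadj _ ih =>
    refine Eq.trans ?_ ih
    rcases (linkGraph_adj.1 hadj).2 with h | h
    · exact hf _ h
    · exact (hf _ h).symm

lemma Joined.of_forall {E E' : Finset (V × V)} (hE : ∀ e ∈ E, Joined E' e.1 e.2) {x y : V}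
    (h : Joined E x y) : Joined E' x y := by
  have := Joined.eq_of_const (f := fun z => (linkGraph E').connectedComponentMk z)
    (fun e he => SimpleGraph.ConnectedComponent.eq.2 (hE e he)) h
  exact SimpleGraph.ConnectedComponent.eq.1 this

lemma Joined.mono {E E' : Finset (V × V)} (hE : E ⊆ E') {x y : V} (h : Joined E x y) :
    Joined E' x y :=
  h.of_forall fun _ he => joined_of_mem (hE he)

lemma joined_empty {x y : V} : Joined ∅ x y ↔ x = y :=
  ⟨fun h => Joined.eq_of_const (f := id) (by simp) h, fun h => h ▸ Joined.refl _ _⟩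

/-- The relabelling is the one carried out by `mergeProg`. When the two labels differ it destroys
exactly one of them, which yields the count in `numComp_insert_of_not_joined`. -/
lemma IsLabel.insert [DecidableEq V] {E : Finset (V × V)} {L : V → ℕ} (hL : IsLabel E L)
    (e : V × V) :
    IsLabel (insert e E) fun x => if L x = L e.2 then L e.1 else L x := by
  have hsub : E ⊆ Insert.insert e E := Finset.subset_insert _ _
  intro x y
  constructor
  · have key : ∀ z, ∃ z', (if L z = L e.2 then L e.1 else L z) = L z' ∧
        Joined (Insert.insert e E) z z' := by
      intro z
      by_cases hz : L z = L e.2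
      · refine ⟨e.1, by simp [hz], ?_⟩
        exact (((hL _ _).1 hz).mono hsub).trans (joined_of_mem (mem_insert_self _ _)).symm
      · exact ⟨z, by simp [hz], Joined.refl _ _⟩
    intro h
    obtain ⟨x', hx, hx'⟩ := key x
    obtain ⟨y', hy, hy'⟩ := key y
    simp only [hx, hy] at h
    exact hx'.trans ((((hL _ _).1 h).mono hsub).trans hy'.symm)
  · intro h
    refine h.eq_of_const (f := fun x => if L x = L e.2 then L e.1 else L x) fun f hf => ?_
    rcases mem_insert.1 hf with rfl | hf
    · simp
    · simp only [(hL _ _).2 (joined_of_mem hf)]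

variable [Fintype V]

lemma exists_isLabel (E : Finset (V × V)) : ∃ L : V → ℕ, IsLabel E L := by
  classical
  obtain ⟨m, ⟨φ⟩⟩ := Finite.exists_equiv_fin (linkGraph E).ConnectedComponent
  refine ⟨fun x => φ ((linkGraph E).connectedComponentMk x), fun x y => ?_⟩
  rw [← Fin.ext_iff, φ.injective.eq_iff]
  exact SimpleGraph.ConnectedComponent.eq

lemma IsLabel.numComp_eq {E : Finset (V × V)} {L : V → ℕ} (hL : IsLabel E L) :
    numComp E = (univ.image L).card := by
  classical
  let g : (linkGraph E).ConnectedComponent → ℕ :=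
    SimpleGraph.ConnectedComponent.lift L fun v w p _ => (hL v w).2 ⟨p⟩
  have hinj : Function.Injective g := by
    intro c d
    refine SimpleGraph.ConnectedComponent.ind₂ (fun v w h => ?_) c d
    exact SimpleGraph.ConnectedComponent.eq.2 ((hL v w).1 h)
  have hr : Set.range g = (univ.image L : Finset ℕ) := by
    ext m
    simp only [Set.mem_range, coe_image, coe_univ, Set.image_univ]
    constructor
    · rintro ⟨c, rfl⟩
      refine SimpleGraph.ConnectedComponent.ind (fun v => ?_) c
      exact ⟨v, rfl⟩
    · rintro ⟨v, rfl⟩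
      exact ⟨(linkGraph E).connectedComponentMk v, rfl⟩
  rw [numComp, ← Nat.card_range_of_injective hinj, hr, Nat.card_coe_set_eq, Set.ncard_coe_finset]

lemma numComp_empty : numComp (∅ : Finset (V × V)) = Fintype.card V := by
  classical
  obtain ⟨L, hL⟩ := exists_isLabel (∅ : Finset (V × V))
  rw [hL.numComp_eq, card_image_of_injective _ fun x y h => joined_empty.1 ((hL x y).1 h), card_univ]

lemma numComp_le_of_forall {E E' : Finset (V × V)} (hE : ∀ e ∈ E, Joined E' e.1 e.2) :
    numComp E' ≤ numComp E := by
  classical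
  refine Nat.card_le_card_of_surjective
    (SimpleGraph.ConnectedComponent.lift (fun x => (linkGraph E').connectedComponentMk x)
      fun v w p _ => SimpleGraph.ConnectedComponent.eq.2 (Joined.of_forall hE ⟨p⟩)) ?_
  intro c
  refine SimpleGraph.ConnectedComponent.ind (fun v => ?_) c
  exact ⟨(linkGraph E).connectedComponentMk v, rfl⟩

lemma one_le_numComp [Nonempty V] (E : Finset (V × V)) : 1 ≤ numComp E := by
  have : Nonempty (linkGraph E).ConnectedComponent :=
    ⟨(linkGraph E).connectedComponentMk (Classical.arbitrary V)⟩
  exact Nat.card_pos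

lemma linkGraph_connected [Nonempty V] {E : Finset (V × V)} (h : numComp E ≤ 1) :
    (linkGraph E).Connected := by
  have hs : Subsingleton (linkGraph E).ConnectedComponent :=
    Finite.card_le_one_iff_subsingleton.1 h
  refine SimpleGraph.connected_iff _ |>.2 ⟨fun x y => ?_, inferInstance⟩
  exact SimpleGraph.ConnectedComponent.eq.1 (Subsingleton.elim _ _)

lemma numComp_le_one {E : Finset (V × V)} (h : ∀ x y, Joined E x y) : numComp E ≤ 1 := by
  refine Finite.card_le_one_iff_subsingleton.2 ⟨fun c d => ?_⟩
  exact SimpleGraph.ConnectedComponent.ind₂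
    (fun v w => SimpleGraph.ConnectedComponent.eq.2 (h v w)) c d

variable [DecidableEq V]

lemma numComp_insert_of_not_joined {E : Finset (V × V)} {e : V × V}
    (h : ¬ Joined E e.1 e.2) : numComp (insert e E) + 1 = numComp E := by
  obtain ⟨L, hL⟩ := exists_isLabel E
  have hne : L e.1 ≠ L e.2 := fun h' => h ((hL _ _).1 h')
  rw [(hL.insert e).numComp_eq, hL.numComp_eq,
    ← card_erase_add_one (mem_image_of_mem L (mem_univ e.2))]
  congr 2
  ext m
  simp only [mem_image, mem_univ, true_and, mem_erase]
  constructor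
  · rintro ⟨x, rfl⟩
    by_cases hx : L x = L e.2
    · simp only [hx, if_true]; exact ⟨hne, e.1, rfl⟩
    · simp only [hx, if_false]; exact ⟨hx, x, rfl⟩
  · rintro ⟨hm, x, rfl⟩
    exact ⟨x, by simp [hm]⟩

lemma numComp_insert_of_joined {E : Finset (V × V)} {e : V × V}
    (h : Joined E e.1 e.2) : numComp (insert e E) = numComp E := by
  apply le_antisymm
  · exact numComp_le_of_forall fun f hf => joined_of_mem (mem_insert_of_mem hf)
  · refine numComp_le_of_forall fun f hf => ?_
    rcases mem_insert.1 hf with rfl | hf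
    · exact h
    · exact joined_of_mem hf

lemma numComp_le_insert (E : Finset (V × V)) (e : V × V) :
    numComp E ≤ numComp (insert e E) + 1 := by
  by_cases h : Joined E e.1 e.2
  · rw [numComp_insert_of_joined h]; omega
  · exact (numComp_insert_of_not_joined h).ge

lemma numComp_le_union (E B : Finset (V × V)) : numComp E ≤ numComp (E ∪ B) + B.card := by
  induction B using Finset.induction_on with
  | empty => simp
  | insert e B he ih =>
    rw [union_insert, card_insert_of_notMem he]
    have := numComp_le_insert (E ∪ B) e
    omega

/-- The equation expresses independence of `O` over `F` in the graphic matroid. One link lowers the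
number of components by at most one, so if all of `O` together attain this maximum, every part of
`O` attains it too. -/
lemma indep_subset {F O O' : Finset (V × V)} (hO : numComp (F ∪ O) + O.card = numComp F)
    (h : O' ⊆ O) : numComp (F ∪ O') + O'.card = numComp F := by
  have h1 := numComp_le_union F O'
  have h2 := numComp_le_union (F ∪ O') (O \ O')
  rw [union_assoc, union_sdiff_of_subset h, card_sdiff_of_subset h] at h2
  have := card_le_card h
  omega

/-- Every set of links contains a forest over `F` which spans it. -/
lemma exists_indep_subset (F A : Finset (V × V)) :
    ∃ O ⊆ A, numComp (F ∪ O) + O.card = numComp F ∧ ∀ e ∈ A, Joined (F ∪ O) e.1 e.2 := by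
  induction A using Finset.induction_on with
  | empty => exact ⟨∅, by simp, by simp, by simp⟩
  | insert e A he ih =>
    obtain ⟨O, hOA, hO, hj⟩ := ih
    by_cases h : Joined (F ∪ O) e.1 e.2
    · refine ⟨O, hOA.trans (subset_insert _ _), hO, fun f hf => ?_⟩
      rcases mem_insert.1 hf with rfl | hf
      · exact h
      · exact hj f hf
    · refine ⟨insert e O, insert_subset_insert _ hOA, ?_, fun f hf => ?_⟩
      · rw [union_insert, card_insert_of_notMem (fun h' => he (hOA h'))]
        have := numComp_insert_of_not_joined h
        omega
      · rcases mem_insert.1 hf with rfl | hf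
        · exact joined_of_mem (by simp)
        · exact (hj f hf).mono (union_subset_union_right (subset_insert _ _))

/-- If the links of the sets `A i` connect all nodes, then one of these sets contains a forest
over `F` which has at least an average share of the links that are needed to connect the
components of `F`. -/
lemma exists_large_indep (F : Finset (V × V)) {χ : ℕ} {A : ℕ → Finset (V × V)}
    (hA : ∀ x y, Joined ((range χ).biUnion A) x y) (hF : 2 ≤ numComp F) :
    ∃ i < χ, ∃ O ⊆ A i, numComp (F ∪ O) + O.card = numComp F ∧ numComp F - 1 ≤ χ * O.card := by
  choose O hOA hO hj using fun i => exists_indep_subset F (A i)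
  -- Each forest spans its own set over `F`, so the union of the forests still connects everything.
  have hc : numComp (F ∪ (range χ).biUnion O) ≤ 1 := by
    refine numComp_le_one fun x y => (hA x y).of_forall fun e he => ?_
    obtain ⟨i, hi, he⟩ := mem_biUnion.1 he
    exact (hj i e he).mono (union_subset_union_right (subset_biUnion_of_mem O hi))
  have h1 := numComp_le_union F ((range χ).biUnion O)
  have h2 : ((range χ).biUnion O).card ≤ ∑ i ∈ range χ, (O i).card := card_biUnion_le
  -- Hence `numComp F` is at most one plus the total size of the forests. If all forests were too
  -- small, each would satisfy χ · |O i| ≤ `numComp F` - 2, and summing over the χ sets would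
  -- contradict this.
  by_contra hcon
  push Not at hcon
  have h3 : ∀ i ∈ range χ, χ * (O i).card ≤ numComp F - 2 := fun i hi => by
    have := hcon i (mem_range.1 hi) (O i) (hOA i) (hO i)
    omega
  have h4 := sum_le_sum h3
  rw [← mul_sum, sum_const, card_range, smul_eq_mul] at h4
  have hχ : 0 < χ := by
    rcases Nat.eq_zero_or_pos χ with rfl | h
    · simp at h2; simp only [range_zero, biUnion_empty, union_empty] at hc; omega
    · exact h
  have := Nat.le_of_mul_le_mul_left h4 hχ
  omega

/-- The counting equation leaves at most n - 1 edges, and a connected graph with so few edges is a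
tree. -/
lemma linkGraph_isTree [Nonempty V] {E : Finset (V × V)} (hc : numComp E ≤ 1)
    (hE : numComp E + E.card = Fintype.card V) : (linkGraph E).IsTree := by
  classical
  have hconn := linkGraph_connected hc
  refine SimpleGraph.isTree_iff_connected_and_card.2 ⟨hconn, ?_⟩
  have h1 := hconn.card_vert_le_card_edgeSet_add_one
  have h2 : Nat.card (linkGraph E).edgeSet ≤ E.card := by
    have hsub : (linkGraph E).edgeSet ⊆ ((E.image fun e => s(e.1, e.2) : Finset (Sym2 V)) : Set _) := by
      intro e
      refine Sym2.ind (fun x y h => ?_) e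
      rw [SimpleGraph.mem_edgeSet, linkGraph_adj] at h
      rw [mem_coe, mem_image]
      rcases h.2 with h | h
      · exact ⟨_, h, rfl⟩
      · exact ⟨_, h, Sym2.eq_swap⟩
    rw [Nat.card_coe_set_eq]
    refine (Set.ncard_le_ncard hsub).trans ?_
    rw [Set.ncard_coe_finset]
    exact card_image_le
  have h3 := one_le_numComp E
  have h4 : Nat.card V = Fintype.card V := Nat.card_eq_fintype_card
  omega

/-- A link whose reverse is present is redundant: deleting it keeps the number of components, and
the remaining links would then be too few to have lowered it so far. -/
lemma not_both_mem {E : Finset (V × V)} (hE : numComp E + E.card = Fintype.card V) {u v : V}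
    (huv : u ≠ v) (h : (u, v) ∈ E) : (v, u) ∉ E := by
  intro h'
  have hj : Joined (E.erase (v, u)) v u :=
    (joined_of_mem (e := (u, v)) (mem_erase.2 ⟨by simp [huv], h⟩)).symm
  have h1 := numComp_insert_of_joined (e := (v, u)) hj
  rw [insert_erase h'] at h1
  have h2 := numComp_le_union ∅ (E.erase (v, u))
  rw [numComp_empty, empty_union, card_erase_of_mem h'] at h2
  have := card_pos.2 ⟨_, h⟩
  omega

lemma linkGraph_isOrientation {E : Finset (V × V)} (hE : numComp E + E.card = Fintype.card V)
    (hne : ∀ e ∈ E, e.1 ≠ e.2) : IsOrientation (linkGraph E) E := by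
  refine ⟨fun u v h => linkGraph_adj.2 ⟨hne _ h, Or.inl h⟩, fun u v h => ?_⟩
  rw [linkGraph_adj] at h
  constructor
  · exact not_both_mem hE h.1
  · intro h'; exact h.2.resolve_right h'

end ConnSched

/-! ### Greedy selection of links and its analysis -/

namespace ConnSched

open Finset

/-- The data which govern the greedy selection: the links that may be used at all, their lengths,
a weight measuring the conflict between two links, and the reciprocal of the threshold for the
total weight. -/
structure Rule (V : Type*) where
  ok : V × V → Prop
  len : V × V → ℝ
  W : V × V → V × V → ℝ
  K : ℕ

namespace Rule

variable {V : Type*} [DecidableEq V] (R : Rule V)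

/-- Total weight of the conflicts of `v` with the other links of `G`. -/
def load (G : Finset (V × V)) (v : V × V) : ℝ := ∑ u ∈ G.erase v, R.W u v

/-- Having `F` from earlier rounds and `G` from the current one, `v` may be added. -/
def Acceptable (F G : Finset (V × V)) (v : V × V) : Prop :=
  R.ok v ∧ ¬ Joined (F ∪ G) v.1 v.2 ∧ R.K * R.load G v ≤ 1

/-- `G` arises by successively adding shortest acceptable links. -/
inductive Greedy (F : Finset (V × V)) : Finset (V × V) → Prop
  | empty : Greedy F ∅
  | step {G : Finset (V × V)} {w : V × V} : Greedy F G → R.Acceptable F G w →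
      (∀ v, R.Acceptable F G v → R.len w ≤ R.len v) → Greedy F (insert w G)

open Classical in
/-- The links of a greedy set whose load is small. -/
noncomputable def light (G : Finset (V × V)) : Finset (V × V) :=
  G.filter fun v => R.K * R.load G v ≤ 4

/-- `X` is the result of a round which starts with the links `F`. -/
def IsRound (F X : Finset (V × V)) : Prop :=
  ∃ G, R.Greedy F G ∧ (∀ v, ¬ R.Acceptable F G v) ∧ X = R.light G

/-- The links selected in the first `r` rounds. -/
def acc (Xs : ℕ → Finset (V × V)) (r : ℕ) : Finset (V × V) := (range r).biUnion Xs

/-- `Xs 0, …, Xs (r - 1)` are the results of consecutive rounds. -/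
def IsTrace (Xs : ℕ → Finset (V × V)) (r : ℕ) : Prop :=
  ∀ q < r, R.IsRound (acc Xs q) (Xs q)

/-- Symmetry lets a new link add only twice its own load to the total. Nonnegativity is asked only
for usable links because the weight for fixed powers involves the slack, which can be negative for
other links. -/
structure Valid : Prop where
  nonneg : ∀ u v, R.ok u → R.ok v → 0 ≤ R.W u v
  symm : ∀ u v, R.W u v = R.W v u
  pos : 0 < R.K

variable {R}

lemma Acceptable.notMem {F G : Finset (V × V)} {v : V × V} (h : R.Acceptable F G v) : v ∉ G :=
  fun hv => h.2.1 (joined_of_mem (mem_union_right _ hv))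

lemma Greedy.ok {F G : Finset (V × V)} (h : R.Greedy F G) : ∀ v ∈ G, R.ok v := by
  induction h with
  | empty => simp
  | step _ hw _ ih =>
    intro v hv
    rcases mem_insert.1 hv with rfl | hv
    · exact hw.1
    · exact ih v hv

lemma Greedy.not_joined {F G : Finset (V × V)} (h : R.Greedy F G) :
    ∀ v ∈ G, ¬ Joined F v.1 v.2 := by
  induction h with
  | empty => simp
  | step _ hw _ ih =>
    intro v hv
    rcases mem_insert.1 hv with rfl | hv
    · exact fun h => hw.2.1 (h.mono subset_union_left)
    · exact ih v hv

/-- Adding w raises the total load by twice the load of w at that moment: once for w itself and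
once, by symmetry, for the links already present. -/
lemma Greedy.total_load (hR : R.Valid) {F G : Finset (V × V)} (h : R.Greedy F G) :
    R.K * ∑ v ∈ G, R.load G v ≤ 2 * G.card := by
  induction h with
  | empty => simp
  | @step G w hG hw hmin ih =>
    have hwG := hw.notMem
    have h1 : R.load (insert w G) w = R.load G w := by
      simp [load, erase_insert hwG, erase_eq_of_notMem hwG]
    have h2 : ∀ v ∈ G, R.load (insert w G) v = R.load G v + R.W v w := by
      intro v hv
      have hne : w ≠ v := fun h => hwG (h ▸ hv)
      rw [load, erase_insert_of_ne hne, sum_insert (fun h => hwG (mem_of_mem_erase h)), load,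
        hR.symm w v, add_comm]
    have h3 : ∑ v ∈ G, R.W v w = R.load G w := by rw [load, erase_eq_of_notMem hwG]
    rw [sum_insert hwG, h1, sum_congr rfl h2, sum_add_distrib, h3, card_insert_of_notMem hwG]
    have := hw.2.2
    push_cast
    nlinarith

/-- Markov's inequality: by `Greedy.total_load` the average of K times the load is at most 2, so at
most half of the links can exceed 4. -/
lemma Greedy.card_le (hR : R.Valid) {F G : Finset (V × V)} (h : R.Greedy F G) :
    G.card ≤ 2 * (R.light G).card := by
  classical
  have h1 := h.total_load hR
  have h2 : ∑ v ∈ G \ R.light G, (4 : ℝ) ≤ ∑ v ∈ G \ R.light G, R.K * R.load G v := by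
    refine sum_le_sum fun v hv => ?_
    rw [mem_sdiff, light, mem_filter] at hv
    have := hv.2
    push Not at this
    exact (this hv.1).le
  have h3 : ∑ v ∈ G \ R.light G, R.K * R.load G v ≤ ∑ v ∈ G, R.K * R.load G v := by
    refine sum_le_sum_of_subset_of_nonneg sdiff_subset fun v hv _ => ?_
    exact mul_nonneg (Nat.cast_nonneg _) (sum_nonneg fun u hu =>
      hR.nonneg _ _ (h.ok u (mem_of_mem_erase hu)) (h.ok v hv))
  have hsub : R.light G ⊆ G := filter_subset _ _
  rw [sum_const, nsmul_eq_mul, card_sdiff_of_subset hsub] at h2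
  rw [mul_sum] at h1
  have h4 := card_le_card hsub
  rw [Nat.cast_sub h4] at h2
  have : (G.card : ℝ) ≤ 2 * (R.light G).card := by linarith
  exact_mod_cast this

/-- As long as v stays acceptable, it competes for being shortest, so everything added is at most as
long as v. At the moment v is lost to its load, the whole current set therefore lies in the filtered
sum; later additions only enlarge that sum. -/
lemma Greedy.blame (hR : R.Valid) {F G : Finset (V × V)} (h : R.Greedy F G) {v : V × V}
    (hv : R.ok v) : (R.Acceptable F G v ∧ ∀ w ∈ G, R.len w ≤ R.len v) ∨
      Joined (F ∪ G) v.1 v.2 ∨ 1 < R.K * ∑ w ∈ G with R.len w ≤ R.len v, R.W w v := by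
  classical
  induction h with
  | empty =>
    by_cases hj : Joined (F ∪ ∅) v.1 v.2
    · exact Or.inr (Or.inl hj)
    · exact Or.inl ⟨⟨hv, hj, by simp [load]⟩, by simp⟩
  | @step G w hG hw hmin ih =>
    rcases ih with ⟨hacc, hle⟩ | hj | hlt
    · have hall : ∀ u ∈ insert w G, R.len u ≤ R.len v := by
        intro u hu
        rcases mem_insert.1 hu with rfl | hu
        · exact hmin v hacc
        · exact hle u hu
      by_cases hj : Joined (F ∪ insert w G) v.1 v.2
      · exact Or.inr (Or.inl hj)
      by_cases hl : R.K * R.load (insert w G) v ≤ 1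
      · exact Or.inl ⟨⟨hv, hj, hl⟩, hall⟩
      · refine Or.inr (Or.inr (lt_of_lt_of_le (not_le.1 hl) ?_))
        refine mul_le_mul_of_nonneg_left ?_ (Nat.cast_nonneg _)
        rw [filter_true_of_mem hall]
        exact sum_le_sum_of_subset_of_nonneg (erase_subset _ _) fun u hu _ =>
          hR.nonneg _ _ ((hG.step hw hmin).ok u hu) hv
    · exact Or.inr (Or.inl (hj.mono (union_subset_union_right (subset_insert _ _))))
    · refine Or.inr (Or.inr (hlt.trans_le (mul_le_mul_of_nonneg_left ?_ (Nat.cast_nonneg _))))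
      refine sum_le_sum_of_subset_of_nonneg (filter_subset_filter _ (subset_insert _ _))
        fun u hu _ => hR.nonneg _ _ ((hG.step hw hmin).ok u (mem_of_mem_filter u hu)) hv

lemma acc_succ (Xs : ℕ → Finset (V × V)) (r : ℕ) : acc Xs (r + 1) = acc Xs r ∪ Xs r := by
  rw [acc, range_add_one, biUnion_insert, union_comm, acc]

/-! ### Progress of one round and the number of rounds -/

variable [Fintype V]

lemma Greedy.indep {F G : Finset (V × V)} (h : R.Greedy F G) :
    numComp (F ∪ G) + G.card = numComp F := by
  induction h with
  | empty => simp
  | @step G w hG hw hmin ih =>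
    rw [union_insert, card_insert_of_notMem hw.notMem]
    have := numComp_insert_of_not_joined hw.2.1
    omega

variable (R) in
/-- The nodes can be connected by `χ` sets of links each subset of which contains a large part
where the links of at least the length of any usable link `w` have a bounded conflict with `w`. -/
def Coverable (C : ℝ) (χ : ℕ) : Prop :=
  ∃ A : ℕ → Finset (V × V), (∀ x y, Joined ((range χ).biUnion A) x y) ∧
    ∀ i < χ, ∀ O ⊆ A i, ∃ O' ⊆ O, O.card ≤ 2 * O'.card ∧ (∀ v ∈ O', R.ok v) ∧
      ∀ w, R.ok w → ∑ v ∈ O' with R.len w ≤ R.len v, R.W w v ≤ C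

lemma IsRound.progress (hR : R.Valid) {C : ℝ} {χ : ℕ} (hcov : R.Coverable C χ)
    {F X : Finset (V × V)} (h : R.IsRound F X) (hF : 2 ≤ numComp F) :
    (numComp F : ℝ) - 1 ≤ 4 * (1 + R.K * C) * χ * X.card := by
  classical
  obtain ⟨A, hconn, hA⟩ := hcov
  obtain ⟨G, hG, hmax, rfl⟩ := h
  obtain ⟨i, hi, O, hOA, hO, hcard⟩ := exists_large_indep F hconn hF
  obtain ⟨O', hO'O, hhalf, hok, hW⟩ := hA i hi O hOA
  set J := O'.filter fun v => Joined (F ∪ G) v.1 v.2 with hJ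
  set Q := O'.filter fun v => ¬ Joined (F ∪ G) v.1 v.2 with hQ
  have hJQ : J.card + Q.card = O'.card := card_filter_add_card_filter_not _
  -- `J` is independent over `F` and lies in the span of `F ∪ G`, so a rank comparison applies.
  have hJG : J.card ≤ G.card := by
    have hJO : J ⊆ O := (filter_subset _ _).trans hO'O
    have h1 := indep_subset hO hJO
    have h2 := hG.indep
    have h3 : numComp (F ∪ G) ≤ numComp (F ∪ J) := by
      refine numComp_le_of_forall fun e he => ?_
      rcases mem_union.1 he with he | he
      · exact joined_of_mem (mem_union_left _ he)
      · exact (mem_filter.1 he).2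
    omega
  -- Double counting: each link of `Q` charges more than one unit to shorter or equally long links
  -- of `G`, and by coverability each link of `G` receives at most K · C.
  have hQG : (Q.card : ℝ) ≤ R.K * C * G.card := by
    have h1 : ∀ v ∈ Q, (1 : ℝ) ≤ R.K * ∑ w ∈ G with R.len w ≤ R.len v, R.W w v := by
      intro v hv
      obtain ⟨hv, hnj⟩ := mem_filter.1 hv
      rcases hG.blame hR (hok v hv) with h | h | h
      · exact absurd h.1 (hmax v)
      · exact absurd h hnj
      · exact h.le
    calc (Q.card : ℝ) = ∑ v ∈ Q, (1 : ℝ) := by simp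
      _ ≤ ∑ v ∈ Q, R.K * ∑ w ∈ G with R.len w ≤ R.len v, R.W w v := sum_le_sum h1
      _ = R.K * ∑ w ∈ G, ∑ v ∈ Q with R.len w ≤ R.len v, R.W w v := by
        rw [← mul_sum]
        congr 1
        simp_rw [sum_filter]
        exact sum_comm
      _ ≤ R.K * ∑ w ∈ G, C := by
        refine mul_le_mul_of_nonneg_left (sum_le_sum fun w hw => ?_) (Nat.cast_nonneg _)
        refine le_trans ?_ (hW w (hG.ok w hw))
        refine sum_le_sum_of_subset_of_nonneg (filter_subset_filter _ (filter_subset _ _)) ?_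
        exact fun v hv _ => hR.nonneg _ _ (hG.ok w hw) (hok v (mem_of_mem_filter v hv))
      _ = R.K * C * G.card := by rw [sum_const, nsmul_eq_mul]; ring
  have h1 : (O'.card : ℝ) ≤ (1 + R.K * C) * G.card := by
    rw [← hJQ]; push_cast
    have : (J.card : ℝ) ≤ G.card := by exact_mod_cast hJG
    linarith
  have h2 : (numComp F : ℝ) - 1 ≤ χ * O.card := by
    have : numComp F ≤ χ * O.card + 1 := by omega
    have : (numComp F : ℝ) ≤ χ * O.card + 1 := by exact_mod_cast this
    linarith
  have h3 : (O.card : ℝ) ≤ 2 * O'.card := by exact_mod_cast hhalf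
  have h4 : (G.card : ℝ) ≤ 2 * (R.light G).card := by exact_mod_cast hG.card_le hR
  have hχ : (0 : ℝ) ≤ χ := Nat.cast_nonneg _
  -- The sign of `C` is not assumed. A negative factor is possible only when `G` and `O'` are empty,
  -- and then the left side is at most zero as well.
  rcases le_or_gt 0 (1 + R.K * C) with hp | hp
  · calc (numComp F : ℝ) - 1 ≤ χ * (2 * ((1 + R.K * C) * (2 * (R.light G).card))) := by
          refine h2.trans (mul_le_mul_of_nonneg_left (h3.trans ?_) hχ)
          refine mul_le_mul_of_nonneg_left (h1.trans ?_) (by norm_num)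
          exact mul_le_mul_of_nonneg_left h4 hp
      _ = _ := by ring
  · have h5 : (G.card : ℝ) = 0 := by
      have h6 : (0 : ℝ) ≤ O'.card := Nat.cast_nonneg _
      have h7 : (0 : ℝ) ≤ G.card := Nat.cast_nonneg _
      nlinarith
    have h6 : (R.light G).card = 0 := by
      have hsub : R.light G ⊆ G := filter_subset _ _
      have := card_le_card hsub
      have : G.card = 0 := by exact_mod_cast h5
      omega
    have h7 : (O'.card : ℝ) ≤ 0 := by rw [h5] at h1; simpa using h1
    rw [h6, Nat.cast_zero, mul_zero]
    refine h2.trans ?_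
    nlinarith

lemma IsRound.indep {F X : Finset (V × V)} (h : R.IsRound F X) :
    numComp (F ∪ X) + X.card = numComp F := by
  classical
  obtain ⟨G, hG, -, rfl⟩ := h
  exact indep_subset hG.indep (filter_subset _ _)

lemma IsTrace.indep {Xs : ℕ → Finset (V × V)} {r : ℕ} (h : R.IsTrace Xs r) :
    numComp (acc Xs r) + (acc Xs r).card = Fintype.card V := by
  induction r with
  | zero => simp [acc, numComp_empty]
  | succ r ih =>
    have h1 := ih fun q hq => h q (hq.trans (Nat.lt_succ_self r))
    have h2 := (h r (Nat.lt_succ_self r)).indep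
    have h3 := numComp_le_union ∅ (acc Xs (r + 1))
    rw [numComp_empty, empty_union] at h3
    rw [acc_succ] at h3 ⊢
    have h4 := card_union_le (acc Xs r) (Xs r)
    omega

lemma IsTrace.succ_numComp {Xs : ℕ → Finset (V × V)} {m r : ℕ} (h : R.IsTrace Xs m) (hr : r < m) :
    numComp (acc Xs (r + 1)) + (Xs r).card = numComp (acc Xs r) := by
  rw [acc_succ]; exact (h r hr).indep

/-- `IsRound.progress` excludes an empty round while two components remain. Each such round
therefore commits a link, and n rounds are more than enough. -/
lemma IsTrace.connected (hR : R.Valid) {C : ℝ} {χ : ℕ} (hcov : R.Coverable C χ)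
    {Xs : ℕ → Finset (V × V)} {m : ℕ} (h : R.IsTrace Xs m) (hm : Fintype.card V ≤ m) :
    numComp (acc Xs m) ≤ 1 := by
  have key : ∀ r ≤ m, numComp (acc Xs r) ≤ max 1 (Fintype.card V - r) := by
    intro r
    induction r with
    | zero => intro _; simp [acc, numComp_empty]
    | succ r ih =>
      intro hr
      have h1 := ih (by omega)
      have h2 := h.succ_numComp (r := r) (by omega)
      by_cases h3 : 2 ≤ numComp (acc Xs r)
      · have h4 := (h r (by omega)).progress hR hcov h3
        have h5 : (Xs r).card ≠ 0 := by
          intro h0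
          rw [h0, Nat.cast_zero, mul_zero] at h4
          have : (2 : ℝ) ≤ numComp (acc Xs r) := by exact_mod_cast h3
          linarith
        omega
      · omega
  have := key m le_rfl
  omega

lemma IsTrace.rounds_le (hR : R.Valid) {C : ℝ} {χ : ℕ} (hcov : R.Coverable C χ) (hC : 0 ≤ C)
    [Nonempty V] {Xs : ℕ → Finset (V × V)} {m k : ℕ} (h : R.IsTrace Xs m) (hk : k ≤ m)
    (hlast : k ≠ 0 → (Xs (k - 1)).Nonempty) :
    (k : ℝ) ≤ (4 * (1 + R.K * C) + 2) * Real.log (Fintype.card V) * χ := by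
  set B := 4 * (1 + R.K * C) with hB
  have hB4 : 4 ≤ B := by
    have : 0 ≤ R.K * C := mul_nonneg (Nat.cast_nonneg _) hC
    linarith
  rcases Nat.eq_zero_or_pos k with rfl | hkpos
  · have : 0 ≤ Real.log (Fintype.card V) := Real.log_natCast_nonneg _
    rw [Nat.cast_zero]
    positivity
  obtain ⟨j, rfl⟩ : ∃ j, k = j + 1 := ⟨k - 1, by omega⟩
  -- The last counted round is nonempty, so two components were left before it, and the progress
  -- estimate applies to all earlier rounds.
  have hX : 0 < (Xs j).card := card_pos.2 (by simpa using hlast (by omega))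
  have hj : 2 ≤ numComp (acc Xs j) := by
    have h1 := h.succ_numComp (r := j) (by omega)
    have h2 := one_le_numComp (acc Xs (j + 1))
    omega
  have hanti : ∀ r ≤ j, 2 ≤ numComp (acc Xs r) := by
    intro r hr
    refine Nat.decreasingInduction' (P := fun r => 2 ≤ numComp (acc Xs r)) (fun q hq _ ih => ?_) hr hj
    have := h.succ_numComp (r := q) (by omega)
    omega
  have hn2 : 2 ≤ Fintype.card V := by
    have := hanti 0 (Nat.zero_le _)
    simpa [acc, numComp_empty] using this
  have hχ : 1 ≤ χ := by
    rcases Nat.eq_zero_or_pos χ with rfl | h0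
    · have h4 := (h j (by omega)).progress hR hcov hj
      have : (2 : ℝ) ≤ numComp (acc Xs j) := by exact_mod_cast hj
      simp at h4
      linarith
    · exact h0
  have hχ' : (1 : ℝ) ≤ χ := by exact_mod_cast hχ
  have hBχ : 0 < B * χ := by positivity
  -- Geometric decay with ratio 1 - 1/(Bχ) ≤ exp(-1/(Bχ)). Since the excess over one component is
  -- still at least 1 at time j, it follows that j ≤ Bχ log n.
  have hdecay : ∀ r ≤ j, (numComp (acc Xs r) : ℝ) - 1 ≤
      Fintype.card V * Real.exp (-(r : ℝ) / (B * χ)) := by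
    intro r
    induction r with
    | zero => intro _; simp [acc, numComp_empty]
    | succ r ih =>
      intro hr
      have h1 := ih (by omega)
      have h2 := h.succ_numComp (r := r) (by omega)
      have h3 := (h r (by omega)).progress hR hcov (hanti r (by omega))
      have h2' : (numComp (acc Xs (r + 1)) : ℝ) + (Xs r).card = numComp (acc Xs r) := by
        exact_mod_cast h2
      have h4 : 1 - 1 / (B * χ) ≤ Real.exp (-(1 / (B * χ))) := by
        have := Real.add_one_le_exp (-(1 / (B * χ)))
        linarith
      have h5 : ((numComp (acc Xs r) : ℝ) - 1) / (B * χ) ≤ (Xs r).card := by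
        rw [div_le_iff₀ hBχ]; linarith
      have h6 : (0 : ℝ) ≤ numComp (acc Xs r) - 1 := by
        have : (2 : ℝ) ≤ numComp (acc Xs r) := by exact_mod_cast hanti r (by omega)
        linarith
      calc (numComp (acc Xs (r + 1)) : ℝ) - 1
          ≤ (numComp (acc Xs r) - 1) * (1 - 1 / (B * χ)) := by
            have : ((numComp (acc Xs r) : ℝ) - 1) * (1 - 1 / (B * χ)) =
              (numComp (acc Xs r) - 1) - ((numComp (acc Xs r) : ℝ) - 1) / (B * χ) := by ring
            linarith
        _ ≤ (Fintype.card V * Real.exp (-(r : ℝ) / (B * χ))) * Real.exp (-(1 / (B * χ))) :=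
            (mul_le_mul_of_nonneg_left h4 h6).trans
              (mul_le_mul_of_nonneg_right h1 (Real.exp_nonneg _))
        _ = Fintype.card V * Real.exp (-((r + 1 : ℕ) : ℝ) / (B * χ)) := by
            rw [mul_assoc, ← Real.exp_add]
            congr 2
            push_cast
            ring
  have h1 := hdecay j le_rfl
  have h2 : (1 : ℝ) ≤ numComp (acc Xs j) - 1 := by
    have : (2 : ℝ) ≤ numComp (acc Xs j) := by exact_mod_cast hj
    linarith
  have hn2' : (2 : ℝ) ≤ Fintype.card V := by exact_mod_cast hn2
  have h3 : (j : ℝ) / (B * χ) ≤ Real.log (Fintype.card V) := by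
    have h4 := Real.log_le_log one_pos (h2.trans h1)
    rw [Real.log_one, Real.log_mul (by positivity) (Real.exp_ne_zero _), Real.log_exp] at h4
    have : -(j : ℝ) / (B * χ) = -((j : ℝ) / (B * χ)) := by ring
    linarith
  rw [div_le_iff₀ hBχ] at h3
  -- The final round, which turns j into j + 1, is paid for by 2 log n · χ ≥ 1. This is the summand
  -- 2 in the constant.
  have hlog : (1 : ℝ) / 2 ≤ Real.log (Fintype.card V) := by
    have h4 := Real.log_le_log two_pos hn2'
    have := Real.log_two_gt_d9
    linarith
  have h5 : (1 : ℝ) ≤ 2 * Real.log (Fintype.card V) * χ := by nlinarith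
  push_cast
  linarith

end Rule

end ConnSched

/-! ### Feasibility in terms of real numbers -/

namespace SINR

open Finset

variable {V X : Type*} [MetricSpace X]

/-- Attenuation of the signal of the sender of `u` at the receiver of `v`. -/
noncomputable def att (α : ℝ) (pos : V → X) (u v : V × V) : ℝ := dist (pos u.1) (pos v.2) ^ α

lemma att_self (α : ℝ) (pos : V → X) (v : V × V) : att α pos v v = len pos v ^ α := rfl

lemma att_nonneg (α : ℝ) (pos : V → X) (u v : V × V) : 0 ≤ att α pos u v :=
  Real.rpow_nonneg dist_nonneg _

lemma received_of_ne {α : ℝ} {pos : V → X} {P : V × V → ℝ} {u v : V × V}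
    (h : pos u.1 ≠ pos v.2) :
    received α pos P u v = ENNReal.ofReal (P u / att α pos u v) := by
  have hd : 0 < dist (pos u.1) (pos v.2) := dist_pos.2 h
  rw [received, edist_dist, ENNReal.ofReal_rpow_of_pos hd, att,
    ENNReal.ofReal_div_of_pos (Real.rpow_pos_of_pos hd _)]

lemma received_of_eq {α : ℝ} (hα : 0 < α) {pos : V → X} {P : V × V → ℝ} {u v : V × V}
    (hP : 0 < P u) (h : pos u.1 = pos v.2) : received α pos P u v = ∞ := by
  rw [received, h, edist_self, ENNReal.zero_rpow_of_pos hα]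
  exact ENNReal.div_zero (by simpa using hP)

lemma att_pos {α : ℝ} {pos : V → X} {u v : V × V} (h : pos u.1 ≠ pos v.2) : 0 < att α pos u v :=
  Real.rpow_pos_of_pos (dist_pos.2 h) _

lemma ne_of_att_ne_zero {α : ℝ} (hα : 0 < α) {pos : V → X} {u v : V × V}
    (h : att α pos u v ≠ 0) : pos u.1 ≠ pos v.2 := by
  intro h'
  rw [att, h', dist_self, Real.zero_rpow hα.ne'] at h
  exact h rfl

section Feasibility

variable [DecidableEq V]

lemma interference_eq {α N : ℝ} (hN : 0 ≤ N) {pos : V → X} {P : V × V → ℝ} {S : Finset (V × V)}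
    {v : V × V} (hP : ∀ u ∈ S, 0 < P u) (h : ∀ u ∈ S.erase v, pos u.1 ≠ pos v.2) :
    ENNReal.ofReal N + ∑ u ∈ S.erase v, received α pos P u v =
      ENNReal.ofReal (N + ∑ u ∈ S.erase v, P u / att α pos u v) := by
  have hnn : ∀ u ∈ S.erase v, 0 ≤ P u / att α pos u v := fun u hu =>
    div_nonneg (hP u (mem_of_mem_erase hu)).le (att_nonneg _ _ _ _)
  rw [ENNReal.ofReal_add hN (sum_nonneg hnn), ENNReal.ofReal_sum_of_nonneg hnn]
  congr 1
  exact sum_congr rfl fun u hu => received_of_ne (h u hu)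

/-- A foreign sender located at the receiver of v would cause infinite interference and hence ratio
zero, below the positive threshold. -/
lemma Feasible.ne {α β N : ℝ} (hα : 0 < α) (hβ : 0 < β) {pos : V → X} {P : V × V → ℝ}
    {S : Finset (V × V)} (h : Feasible α β N pos P S) {u v : V × V} (hu : u ∈ S) (hv : v ∈ S)
    (huv : u ≠ v) : pos u.1 ≠ pos v.2 := by
  intro heq
  have h1 := (h v hv).2
  have h2 : ENNReal.ofReal N + ∑ u ∈ S.erase v, received α pos P u v = ∞ := by
    have : received α pos P u v ≤ ∑ u ∈ S.erase v, received α pos P u v :=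
      single_le_sum (f := fun u => received α pos P u v) (fun _ _ => bot_le)
        (mem_erase.2 ⟨huv, hu⟩)
    rw [received_of_eq hα (h u hu).1 heq, top_le_iff] at this
    rw [this, add_top]
  rw [sinr, h2, ENNReal.div_top, nonpos_iff_eq_zero, ENNReal.ofReal_eq_zero] at h1
  linarith

lemma Feasible.real {α β N : ℝ} (hα : 0 < α) (hβ : 0 < β) (hN : 0 ≤ N) {pos : V → X}
    {P : V × V → ℝ} {S : Finset (V × V)} (h : Feasible α β N pos P S) {v : V × V} (hv : v ∈ S)
    (hne : pos v.1 ≠ pos v.2) :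
    β * (N + ∑ u ∈ S.erase v, P u / att α pos u v) ≤ P v / att α pos v v := by
  have h1 := (h v hv).2
  have hd : ∀ u ∈ S.erase v, pos u.1 ≠ pos v.2 := fun u hu =>
    h.ne hα hβ (mem_of_mem_erase hu) hv (ne_of_mem_erase hu)
  have hsig : 0 < P v / att α pos v v := div_pos (h v hv).1 (att_pos hne)
  rw [sinr, interference_eq hN (fun u hu => (h u hu).1) hd, received_of_ne hne,
    ENNReal.le_div_iff_mul_le (Or.inr (by simpa using hsig)) (Or.inl ENNReal.ofReal_ne_top),
    ← ENNReal.ofReal_mul hβ.le, ENNReal.ofReal_le_ofReal_iff hsig.le] at h1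
  exact h1

lemma feasible_of_real {α β N : ℝ} (hβ : 0 < β) (hN : 0 ≤ N) {pos : V → X}
    {P : V × V → ℝ} {S : Finset (V × V)} (hP : ∀ v ∈ S, 0 < P v)
    (hne : ∀ u ∈ S, ∀ v ∈ S, pos u.1 ≠ pos v.2)
    (h : ∀ v ∈ S, β * (N + ∑ u ∈ S.erase v, P u / att α pos u v) ≤ P v / att α pos v v) :
    Feasible α β N pos P S := by
  intro v hv
  refine ⟨hP v hv, ?_⟩
  have hsig : 0 < P v / att α pos v v := div_pos (hP v hv) (att_pos (hne v hv v hv))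
  rw [sinr, interference_eq hN hP fun u hu => hne u (mem_of_mem_erase hu) v hv,
    received_of_ne (hne v hv v hv),
    ENNReal.le_div_iff_mul_le (Or.inr (by simpa using hsig)) (Or.inl ENNReal.ofReal_ne_top),
    ← ENNReal.ofReal_mul hβ.le, ENNReal.ofReal_le_ofReal_iff hsig.le]
  exact h v hv

end Feasibility

/-! ### Averaging and comparison with a nearest link -/

/-- Markov's inequality. It selects the half of a feasible set whose conflicts are at most twice the
average. -/
lemma card_le_two_mul_card_filter {ι : Type*} {O : Finset ι} {g : ι → ℝ} (h0 : ∀ v ∈ O, 0 ≤ g v)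
    (h : ∑ v ∈ O, g v ≤ O.card) : O.card ≤ 2 * (O.filter fun v => g v ≤ 2).card := by
  classical
  have h1 : ∑ v ∈ O with ¬ g v ≤ 2, (2 : ℝ) ≤ ∑ v ∈ O with ¬ g v ≤ 2, g v :=
    sum_le_sum fun v hv => (not_le.1 (mem_filter.1 hv).2).le
  have h2 : ∑ v ∈ O with ¬ g v ≤ 2, g v ≤ ∑ v ∈ O, g v :=
    sum_le_sum_of_subset_of_nonneg (filter_subset _ _) fun v hv _ => h0 v hv
  have h3 := card_filter_add_card_filter_not (s := O) (fun v => g v ≤ 2)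
  rw [sum_const, nsmul_eq_mul] at h1
  have h4 : ((O.filter fun v => ¬ g v ≤ 2).card : ℝ) * 2 ≤ O.card := by linarith
  have h5 : (O.filter fun v => ¬ g v ≤ 2).card * 2 ≤ O.card := by exact_mod_cast h4
  omega

/-- The nearest link `v₀` is paid for by the cap at one. Every other link is at least as far away,
so a detour through `v₀` bounds its term by the conflict between the two links. -/
lemma sum_le_of_nearest {ι : Type*} [DecidableEq ι] {S : Finset ι} {D φ : ι → ℝ} {B : ℝ}
    (hB : 0 ≤ B) (hφ : ∀ v ∈ S, φ v ≤ 1)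
    (h : ∀ v₀ ∈ S, (∀ v ∈ S, D v₀ ≤ D v) → ∑ v ∈ S.erase v₀, φ v ≤ B) :
    ∑ v ∈ S, φ v ≤ 1 + B := by
  rcases S.eq_empty_or_nonempty with rfl | hS
  · simp; linarith
  · obtain ⟨v₀, hv₀, hmin⟩ := exists_min_image S D hS
    rw [← add_sum_erase S φ hv₀]
    exact add_le_add (hφ v₀ hv₀) (h v₀ hv₀ hmin)

/-- The path of three steps, two of which are at most `D`. -/
lemma rpow_le_of_le_add {α x ℓ D : ℝ} (hα : 0 < α) (hx : 0 ≤ x) (hℓ : 0 ≤ ℓ) (hD : 0 ≤ D)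
    (h : x ≤ ℓ + 2 * D) : x ^ α ≤ 3 ^ α * max (ℓ ^ α) (D ^ α) := by
  have h1 : x ≤ 3 * max ℓ D := by
    have := le_max_left ℓ D
    have := le_max_right ℓ D
    linarith
  calc x ^ α ≤ (3 * max ℓ D) ^ α := Real.rpow_le_rpow hx h1 hα.le
    _ = 3 ^ α * max ℓ D ^ α := Real.mul_rpow (by norm_num) (le_max_of_le_left hℓ)
    _ = _ := by
      rcases le_total ℓ D with h' | h'
      · rw [max_eq_right h', max_eq_right (Real.rpow_le_rpow hℓ h' hα.le)]
      · rw [max_eq_left h', max_eq_left (Real.rpow_le_rpow hD h' hα.le)]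

variable {α : ℝ} {pos : V → X}

/-- The detour leads from one link's sender to its own receiver, then to x, then to the other
receiver. Both legs at x are at most the distance from x to the farther receiver, that of v. -/
lemma att_le_of_near_receiver (hα : 0 < α) {x : X} {u v : V × V}
    (h : dist x (pos u.2) ≤ dist x (pos v.2)) :
    att α pos u v ≤ 3 ^ α * max (len pos u ^ α) (dist x (pos v.2) ^ α) ∧
    att α pos v u ≤ 3 ^ α * max (len pos v ^ α) (dist x (pos v.2) ^ α) := by
  constructor
  · refine rpow_le_of_le_add hα dist_nonneg dist_nonneg dist_nonneg ?_
    have h1 := dist_triangle4 (pos u.1) (pos u.2) x (pos v.2)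
    rw [dist_comm (pos u.2) x] at h1
    rw [len]; linarith
  · refine rpow_le_of_le_add hα dist_nonneg dist_nonneg dist_nonneg ?_
    have h1 := dist_triangle4 (pos v.1) (pos v.2) x (pos u.2)
    rw [dist_comm (pos v.2) x] at h1
    rw [len]; linarith

lemma att_le_of_near_sender (hα : 0 < α) {x : X} {u v : V × V}
    (h : dist (pos u.1) x ≤ dist (pos v.1) x) :
    att α pos v u ≤ 3 ^ α * max (len pos u ^ α) (dist (pos v.1) x ^ α) ∧
    att α pos u v ≤ 3 ^ α * max (len pos v ^ α) (dist (pos v.1) x ^ α) := by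
  constructor
  · refine rpow_le_of_le_add hα dist_nonneg dist_nonneg dist_nonneg ?_
    have h1 := dist_triangle4 (pos v.1) x (pos u.1) (pos u.2)
    rw [dist_comm x (pos u.1)] at h1
    rw [len]; linarith
  · refine rpow_le_of_le_add hα dist_nonneg dist_nonneg dist_nonneg ?_
    have h1 := dist_triangle4 (pos u.1) x (pos v.1) (pos v.2)
    rw [dist_comm x (pos v.1)] at h1
    rw [len]; linarith

end SINR

/-! ### Fixed monotone powers -/

namespace SINR

open Finset ConnSched

/-- Indices: w is the short link, 0 the link with nearest receiver, v another link; p, L and s are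
power, attenuation along the link and slack. D is the attenuation from w to v, E1 that from 0 to v,
E2 that from v to 0. If D dominates the length in one of the two detours, the uncapped bound with
the larger power or smaller slack suffices. Otherwise monotonicity makes one of the two terms at
least one, and the cap takes over. -/
lemma capped_out_le {t β pw p0 pv L0 Lv D s0 sv E1 E2 : ℝ} (ht : 0 < t) (hβ : 1 ≤ β)
    (hpw : 0 < pw) (hp0 : 0 < p0) (hpv : 0 < pv) (hL0 : 0 < L0) (hLv : 0 < Lv) (hD : 0 ≤ D)
    (hs0 : 0 < s0) (hsv : 0 < sv) (hE1 : 0 < E1) (hE2 : 0 < E2)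
    (hE1' : E1 ≤ t * max L0 D) (hE2' : E2 ≤ t * max Lv D)
    (hw0 : pw ≤ p0) (hwv : pw ≤ pv) (hs0' : s0 ≤ p0 / L0) (hsv' : sv ≤ pv / Lv)
    (h0v : L0 ≤ Lv → pv / Lv ≤ p0 / L0) (hv0 : Lv ≤ L0 → p0 / L0 ≤ pv / Lv ∧ s0 ≤ sv) :
    β * pw / (β * pw + D * sv) ≤ t * (β * p0 / (E1 * sv) + β * pv / (E2 * s0)) := by
  have hβ0 : 0 < β := by linarith
  have hA : 0 ≤ t * (β * p0 / (E1 * sv)) := by positivity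
  have hB : 0 ≤ t * (β * pv / (E2 * s0)) := by positivity
  have hone : β * pw / (β * pw + D * sv) ≤ 1 :=
    div_le_one_of_le₀ (le_add_of_nonneg_right (by positivity)) (by positivity)
  have hcap : 0 < D → β * pw / (β * pw + D * sv) ≤ β * pw / (D * sv) := fun hD =>
    div_le_div_of_nonneg_left (by positivity) (by positivity) (by linarith [mul_pos hβ0 hpw])
  have hdivA : ∀ M, 0 < M → E1 ≤ t * M → β * p0 / (M * sv) ≤ t * (β * p0 / (E1 * sv)) := by
    intro M hM h
    rw [← mul_div_assoc, div_le_div_iff₀ (by positivity) (by positivity)]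
    have : 0 ≤ β * p0 * sv * (t * M - E1) := mul_nonneg (by positivity) (by linarith)
    linarith
  have hdivB : ∀ M, 0 < M → E2 ≤ t * M → β * pv / (M * s0) ≤ t * (β * pv / (E2 * s0)) := by
    intro M hM h
    rw [← mul_div_assoc, div_le_div_iff₀ (by positivity) (by positivity)]
    have : 0 ≤ β * pv * s0 * (t * M - E2) := mul_nonneg (by positivity) (by linarith)
    linarith
  rw [mul_add]
  rcases le_or_gt L0 D with h | h
  · have hDp : 0 < D := hL0.trans_le h
    rw [max_eq_right h] at hE1'
    have h1 := hdivA D hDp hE1'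
    have h2 : β * pw / (D * sv) ≤ β * p0 / (D * sv) := by gcongr
    linarith [hcap hDp]
  rw [max_eq_left h.le] at hE1'
  rcases le_or_gt L0 Lv with h' | h'
  · have h1 := hdivA L0 hL0 hE1'
    have h2 : 1 ≤ β * p0 / (L0 * sv) := by
      rw [le_div_iff₀ (by positivity), one_mul]
      have h3 : sv ≤ p0 / L0 := hsv'.trans (h0v h')
      rw [le_div_iff₀ hL0] at h3
      nlinarith
    linarith
  rcases le_or_gt D Lv with h'' | h''
  · rw [max_eq_left h''] at hE2'
    have h1 := hdivB Lv hLv hE2'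
    have h2 : 1 ≤ β * pv / (Lv * s0) := by
      rw [le_div_iff₀ (by positivity), one_mul]
      have h3 : s0 ≤ pv / Lv := hs0'.trans (hv0 h'.le).1
      rw [le_div_iff₀ hLv] at h3
      nlinarith
    linarith
  · have hDp : 0 < D := hLv.trans h''
    rw [max_eq_right h''.le] at hE2'
    have h1 := hdivB D hDp hE2'
    have h2 : β * pw / (D * sv) ≤ β * pv / (D * s0) := by
      have := (hv0 h'.le).2
      gcongr
    linarith [hcap hDp]

/-- The mirror image of `capped_out_le` for interference arriving at w, with 0 the link of nearest
sender. The short link w now has the largest slack, and the links 0 and v are compared by powers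
growing with length. -/
lemma capped_in_le {t β p0 pv L0 Lv D s0 sv sw E1 E2 : ℝ} (ht : 0 < t) (hβ : 1 ≤ β)
    (hp0 : 0 < p0) (hpv : 0 < pv) (hL0 : 0 < L0) (hLv : 0 < Lv) (hD : 0 ≤ D)
    (hs0 : 0 < s0) (hsv : 0 < sv) (hE1 : 0 < E1) (hE2 : 0 < E2)
    (hE2' : E2 ≤ t * max L0 D) (hE1' : E1 ≤ t * max Lv D)
    (hw0 : s0 ≤ sw) (hwv : sv ≤ sw) (hs0' : s0 ≤ p0 / L0) (hsv' : sv ≤ pv / Lv)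
    (h0v : L0 ≤ Lv → p0 ≤ pv) (hv0 : Lv ≤ L0 → pv ≤ p0) :
    β * pv / (β * pv + D * sw) ≤ t * (β * p0 / (E1 * sv) + β * pv / (E2 * s0)) := by
  have hβ0 : 0 < β := by linarith
  have hsw : 0 < sw := hs0.trans_le hw0
  have hA : 0 ≤ t * (β * p0 / (E1 * sv)) := by positivity
  have hB : 0 ≤ t * (β * pv / (E2 * s0)) := by positivity
  have hone : β * pv / (β * pv + D * sw) ≤ 1 :=
    div_le_one_of_le₀ (le_add_of_nonneg_right (by positivity)) (by positivity)
  have hcap : 0 < D → β * pv / (β * pv + D * sw) ≤ β * pv / (D * sw) := fun hD =>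
    div_le_div_of_nonneg_left (by positivity) (by positivity) (by linarith [mul_pos hβ0 hpv])
  have hdivA : ∀ M, 0 < M → E1 ≤ t * M → β * p0 / (M * sv) ≤ t * (β * p0 / (E1 * sv)) := by
    intro M hM h
    rw [← mul_div_assoc, div_le_div_iff₀ (by positivity) (by positivity)]
    have : 0 ≤ β * p0 * sv * (t * M - E1) := mul_nonneg (by positivity) (by linarith)
    linarith
  have hdivB : ∀ M, 0 < M → E2 ≤ t * M → β * pv / (M * s0) ≤ t * (β * pv / (E2 * s0)) := by
    intro M hM h
    rw [← mul_div_assoc, div_le_div_iff₀ (by positivity) (by positivity)]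
    have : 0 ≤ β * pv * s0 * (t * M - E2) := mul_nonneg (by positivity) (by linarith)
    linarith
  rw [mul_add]
  rcases le_or_gt L0 D with h | h
  · have hDp : 0 < D := hL0.trans_le h
    rw [max_eq_right h] at hE2'
    have h1 := hdivB D hDp hE2'
    have h2 : β * pv / (D * sw) ≤ β * pv / (D * s0) := by gcongr
    linarith [hcap hDp]
  rw [max_eq_left h.le] at hE2'
  rcases le_or_gt L0 Lv with h' | h'
  · have h1 := hdivB L0 hL0 hE2'
    have h2 : 1 ≤ β * pv / (L0 * s0) := by
      rw [le_div_iff₀ (by positivity), one_mul]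
      rw [le_div_iff₀ hL0] at hs0'
      nlinarith [h0v h']
    linarith
  rcases le_or_gt D Lv with h'' | h''
  · rw [max_eq_left h''] at hE1'
    have h1 := hdivA Lv hLv hE1'
    have h2 : 1 ≤ β * p0 / (Lv * sv) := by
      rw [le_div_iff₀ (by positivity), one_mul]
      rw [le_div_iff₀ hLv] at hsv'
      nlinarith [hv0 h'.le]
    linarith
  · have hDp : 0 < D := hLv.trans h''
    rw [max_eq_right h''.le] at hE1'
    have h1 := hdivA D hDp hE1'
    have h2 : β * pv / (D * sw) ≤ β * p0 / (D * sv) := by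
      have := hv0 h'.le
      gcongr
    linarith [hcap hDp]

variable {V X : Type*} [MetricSpace X]

/-- The part of the signal strength which noise leaves for interference. -/
noncomputable def slack (α β N : ℝ) (pos : V → X) (P : V × V → ℝ) (v : V × V) : ℝ :=
  P v / len pos v ^ α - β * N

/-- Relative interference of `u` at `v`, capped at one. -/
noncomputable def aff (α β N : ℝ) (pos : V → X) (P : V × V → ℝ) (u v : V × V) : ℝ :=
  β * P u / (β * P u + att α pos u v * slack α β N pos P v)

/-- The selection rule for the fixed powers `P`. -/
noncomputable def fixedRule (α β N : ℝ) (pos : V → X) (G : SimpleGraph V) (P : V × V → ℝ) :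
    Rule V where
  ok v := G.Adj v.1 v.2 ∧ β * N * len pos v ^ α ≤ P v
  len := len pos
  W u v := aff α β N pos P u v + aff α β N pos P v u
  K := 16

section Fixed

variable {α β N : ℝ} {pos : V → X} {G : SimpleGraph V} {P : V × V → ℝ}

lemma len_pos_of_adj (hpos : Function.Injective pos) {v : V × V} (h : G.Adj v.1 v.2) :
    0 < len pos v := dist_pos.2 fun h' => h.ne (hpos h')

lemma slack_nonneg (hpos : Function.Injective pos) {v : V × V}
    (h : (fixedRule α β N pos G P).ok v) : 0 ≤ slack α β N pos P v := by
  have hL := Real.rpow_pos_of_pos (len_pos_of_adj hpos h.1) α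
  rw [slack, sub_nonneg, le_div_iff₀ hL]
  exact h.2

lemma slack_le (hβ : 0 ≤ β) (hN : 0 ≤ N) (v : V × V) :
    slack α β N pos P v ≤ P v / len pos v ^ α := by
  rw [slack]; linarith [mul_nonneg hβ hN]

lemma aff_nonneg (hβ : 0 ≤ β) {u v : V × V} (hP : 0 ≤ P u) (hs : 0 ≤ slack α β N pos P v) :
    0 ≤ aff α β N pos P u v :=
  div_nonneg (mul_nonneg hβ hP)
    (add_nonneg (mul_nonneg hβ hP) (mul_nonneg (att_nonneg _ _ _ _) hs))

lemma aff_le_one (hβ : 0 ≤ β) {u v : V × V} (hP : 0 ≤ P u) (hs : 0 ≤ slack α β N pos P v) :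
    aff α β N pos P u v ≤ 1 :=
  div_le_one_of_le₀ (le_add_of_nonneg_right (mul_nonneg (att_nonneg _ _ _ _) hs))
    (add_nonneg (mul_nonneg hβ hP) (mul_nonneg (att_nonneg _ _ _ _) hs))

lemma fixedRule_valid (hβ : 0 ≤ β) (hpos : Function.Injective pos)
    (hP : IsMonotonePower α pos G P) : (fixedRule α β N pos G P).Valid where
  nonneg u v hu hv := add_nonneg
    (aff_nonneg hβ (hP.1 u hu.1).le (slack_nonneg hpos hv))
    (aff_nonneg hβ (hP.1 v hv.1).le (slack_nonneg hpos hu))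
  symm u v := add_comm _ _
  pos := by norm_num [fixedRule]

/-- With a the uncapped relative interference, `aff` is a/(1 + a). A value of at most 1/4 thus gives
a ≤ 4/3 · `aff`; zero distance or zero slack would make `aff` equal to 1. -/
lemma of_aff_le (hα : 0 < α) (hβ : 0 < β) {u v : V × V} (hPu : 0 < P u)
    (hs : 0 ≤ slack α β N pos P v) (h : aff α β N pos P u v ≤ 1 / 4) :
    pos u.1 ≠ pos v.2 ∧ 0 < slack α β N pos P v ∧
      β * (P u / att α pos u v) ≤ 4 / 3 * aff α β N pos P u v * slack α β N pos P v := by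
  have hb : 0 < β * P u := mul_pos hβ hPu
  have hds : 0 ≤ att α pos u v * slack α β N pos P v := mul_nonneg (att_nonneg _ _ _ _) hs
  have h' := h
  rw [aff, div_le_iff₀ (by linarith)] at h'
  have hds' : 0 < att α pos u v * slack α β N pos P v := by linarith
  have hs' : 0 < slack α β N pos P v := pos_of_mul_pos_right hds' (att_nonneg _ _ _ _)
  have ha' : 0 < att α pos u v := pos_of_mul_pos_left hds' hs'.le
  refine ⟨ne_of_att_ne_zero hα ha'.ne', hs', ?_⟩
  rw [aff, ← mul_div_assoc, mul_div_assoc', div_mul_eq_mul_div,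
    div_le_div_iff₀ ha' (by linarith)]
  nlinarith

variable [DecidableEq V]

/-- Feasibility bounds every incoming sum of uncapped relative interference by 1. The outgoing sums
have the same average, so half of the links also have outgoing sum at most 2; comparison with a
nearest link transfers both bounds to any usable w not longer than the links summed over. -/
lemma fixed_cover (hα : 0 < α) (hβ : 1 ≤ β) (hN : 0 ≤ N) (hpos : Function.Injective pos)
    (hP : IsMonotonePower α pos G P) {O : Finset (V × V)} (hO : ∀ v ∈ O, G.Adj v.1 v.2)
    (hfeas : Feasible α β N pos P O) :
    ∃ O' ⊆ O, O.card ≤ 2 * O'.card ∧ (∀ v ∈ O', (fixedRule α β N pos G P).ok v) ∧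
      ∀ w, (fixedRule α β N pos G P).ok w →
        ∑ v ∈ O' with (fixedRule α β N pos G P).len w ≤ (fixedRule α β N pos G P).len v,
          (fixedRule α β N pos G P).W w v ≤ 2 * (1 + 3 * 3 ^ α) := by
  have hβ0 : 0 < β := by linarith
  have ht : (0 : ℝ) < 3 ^ α := by positivity
  have hL : ∀ v : V × V, G.Adj v.1 v.2 → 0 < len pos v ^ α := fun v hv =>
    Real.rpow_pos_of_pos (len_pos_of_adj hpos hv) α
  have hreal : ∀ v ∈ O, β * ∑ u ∈ O.erase v, P u / att α pos u v ≤ slack α β N pos P v := by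
    intro v hv
    have := hfeas.real hα hβ0 hN hv fun h => (hO v hv).ne (hpos h)
    rw [att_self] at this
    rw [slack]; linarith
  have hatt : ∀ u ∈ O, ∀ v ∈ O, u ≠ v → 0 < att α pos u v := fun u hu v hv huv =>
    att_pos (hfeas.ne hα hβ0 hu hv huv)
  have hterm : ∀ v ∈ O, ∀ u ∈ O.erase v, 0 ≤ P u / att α pos u v := fun v _ u hu =>
    div_nonneg (hfeas u (mem_of_mem_erase hu)).1.le (att_nonneg _ _ _ _)
  have hslack : ∀ v ∈ O, 0 ≤ slack α β N pos P v := fun v hv =>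
    (mul_nonneg hβ0.le (sum_nonneg (hterm v hv))).trans (hreal v hv)
  have hslackpos : ∀ u ∈ O, ∀ v ∈ O, u ≠ v → 0 < slack α β N pos P v := by
    intro u hu v hv huv
    refine lt_of_lt_of_le (mul_pos hβ0 ?_) (hreal v hv)
    exact sum_pos' (hterm v hv) ⟨u, mem_erase.2 ⟨huv, hu⟩,
      div_pos (hfeas u hu).1 (hatt u hu v hv huv)⟩
  have hok : ∀ v ∈ O, (fixedRule α β N pos G P).ok v := by
    intro v hv
    refine ⟨hO v hv, ?_⟩
    have := hslack v hv
    rwa [slack, sub_nonneg, le_div_iff₀ (hL v (hO v hv))] at this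
  -- relative interference without a cap
  set a : V × V → V × V → ℝ := fun u v => β * P u / (att α pos u v * slack α β N pos P v) with ha
  have ha0 : ∀ u ∈ O, ∀ v ∈ O, 0 ≤ a u v := fun u hu v hv =>
    div_nonneg (mul_nonneg hβ0.le (hfeas u hu).1.le)
      (mul_nonneg (att_nonneg _ _ _ _) (hslack v hv))
  have hin : ∀ v ∈ O, ∑ u ∈ O.erase v, a u v ≤ 1 := by
    intro v hv
    rcases (O.erase v).eq_empty_or_nonempty with he | ⟨u, hu⟩
    · rw [he]; simp
    · have hs := hslackpos u (mem_of_mem_erase hu) v hv (ne_of_mem_erase hu)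
      have h1 : ∑ u ∈ O.erase v, a u v =
          (β * ∑ u ∈ O.erase v, P u / att α pos u v) / slack α β N pos P v := by
        rw [mul_sum, sum_div]
        refine sum_congr rfl fun u _ => ?_
        rw [ha]; ring
      rw [h1]
      exact div_le_one_of_le₀ (hreal v hv) hs.le
  set O' := O.filter fun u => ∑ v ∈ O.erase u, a u v ≤ 2 with hO'
  have hO'O : O' ⊆ O := filter_subset _ _
  have hhalf : O.card ≤ 2 * O'.card := by
    refine card_le_two_mul_card_filter (fun u hu => sum_nonneg fun v hv =>
      ha0 u hu v (mem_of_mem_erase hv)) ?_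
    calc ∑ u ∈ O, ∑ v ∈ O.erase u, a u v = ∑ v ∈ O, ∑ u ∈ O.erase v, a u v := by
          refine sum_comm' fun x y => ?_
          simp only [mem_erase, ne_eq]
          exact ⟨fun ⟨h1, h2, h3⟩ => ⟨⟨fun h => h2 h.symm, h1⟩, h3⟩,
            fun ⟨⟨h1, h2⟩, h3⟩ => ⟨h2, fun h => h1 h.symm, h3⟩⟩
      _ ≤ ∑ v ∈ O, 1 := sum_le_sum hin
      _ = O.card := by simp
  refine ⟨O', hO'O, hhalf, fun v hv => hok v (hO'O hv), fun w hw => ?_⟩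
  set S := O'.filter fun v => (fixedRule α β N pos G P).len w ≤ (fixedRule α β N pos G P).len v
    with hS
  have hSO : S ⊆ O := (filter_subset _ _).trans hO'O
  have hSO' : ∀ v ∈ S, v ∈ O' := fun v hv => mem_of_mem_filter v hv
  have hlen : ∀ v ∈ S, len pos w ≤ len pos v := fun v hv => (mem_filter.1 hv).2
  have hpw := hP.1 w hw.1
  have hsw := slack_nonneg hpos hw
  -- The 3 is the outgoing bound 2 plus the incoming bound 1 at `v₀`; the factor 3 ^ α is the loss
  -- of the three-step detour.
  have hsum : ∀ v₀ ∈ S, ∑ v ∈ S.erase v₀, 3 ^ α * (a v₀ v + a v v₀) ≤ 3 * 3 ^ α := by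
    intro v₀ hv₀
    rw [← mul_sum, sum_add_distrib]
    have h1 : ∑ v ∈ S.erase v₀, a v₀ v ≤ 2 :=
      (sum_le_sum_of_subset_of_nonneg (erase_subset_erase _ hSO) fun v hv _ =>
        ha0 v₀ (hSO hv₀) v (mem_of_mem_erase hv)).trans (mem_filter.1 (hSO' v₀ hv₀)).2
    have h2 : ∑ v ∈ S.erase v₀, a v v₀ ≤ 1 :=
      (sum_le_sum_of_subset_of_nonneg (erase_subset_erase _ hSO) fun v hv _ =>
        ha0 v (mem_of_mem_erase hv) v₀ (hSO hv₀)).trans (hin v₀ (hSO hv₀))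
    nlinarith
  have hmonoL : ∀ u v : V × V, G.Adj u.1 u.2 → G.Adj v.1 v.2 → len pos u ^ α ≤ len pos v ^ α →
      len pos u ≤ len pos v := fun u v hu hv h =>
    (Real.rpow_le_rpow_iff (len_pos_of_adj hpos hu).le (len_pos_of_adj hpos hv).le hα).1 h
  have hmonoS : ∀ u v : V × V, G.Adj u.1 u.2 → G.Adj v.1 v.2 → len pos u ≤ len pos v →
      slack α β N pos P v ≤ slack α β N pos P u := fun u v hu hv h =>
    sub_le_sub_right (hP.2 u v hu hv h).2 _
  have hout : ∑ v ∈ S, aff α β N pos P w v ≤ 1 + 3 * 3 ^ α := by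
    refine sum_le_of_nearest (D := fun v => dist (pos w.1) (pos v.2)) (by positivity)
      (fun v hv => aff_le_one hβ0.le hpw.le (hslack v (hSO hv))) fun v₀ hv₀ hmin => ?_
    refine le_trans (sum_le_sum fun v hv => ?_) (hsum v₀ hv₀)
    obtain ⟨hne, hv⟩ := mem_erase.1 hv
    have hvO := hSO hv
    have h0O := hSO hv₀
    have hnear := att_le_of_near_receiver (pos := pos) hα (hmin v hv)
    exact capped_out_le ht hβ hpw (hfeas _ h0O).1 (hfeas _ hvO).1 (hL _ (hO _ h0O)) (hL _ (hO _ hvO))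
      (att_nonneg α pos w v) (hslackpos v hvO v₀ h0O hne) (hslackpos v₀ h0O v hvO hne.symm)
      (hatt _ h0O _ hvO hne.symm) (hatt _ hvO _ h0O hne) hnear.1 hnear.2
      (hP.2 w v₀ hw.1 (hO _ h0O) (hlen _ hv₀)).1 (hP.2 w v hw.1 (hO _ hvO) (hlen _ hv)).1
      (slack_le hβ0.le hN _) (slack_le hβ0.le hN _)
      (fun h => (hP.2 _ _ (hO _ h0O) (hO _ hvO) (hmonoL _ _ (hO _ h0O) (hO _ hvO) h)).2)
      (fun h => ⟨(hP.2 _ _ (hO _ hvO) (hO _ h0O) (hmonoL _ _ (hO _ hvO) (hO _ h0O) h)).2,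
        hmonoS _ _ (hO _ hvO) (hO _ h0O) (hmonoL _ _ (hO _ hvO) (hO _ h0O) h)⟩)
  have hinc : ∑ v ∈ S, aff α β N pos P v w ≤ 1 + 3 * 3 ^ α := by
    refine sum_le_of_nearest (D := fun v => dist (pos v.1) (pos w.2)) (by positivity)
      (fun v hv => aff_le_one hβ0.le (hfeas _ (hSO hv)).1.le hsw) fun v₀ hv₀ hmin => ?_
    refine le_trans (sum_le_sum fun v hv => ?_) (hsum v₀ hv₀)
    obtain ⟨hne, hv⟩ := mem_erase.1 hv
    have hvO := hSO hv
    have h0O := hSO hv₀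
    have hnear := att_le_of_near_sender (pos := pos) hα (hmin v hv)
    exact capped_in_le ht hβ (hfeas _ h0O).1 (hfeas _ hvO).1 (hL _ (hO _ h0O)) (hL _ (hO _ hvO))
      (att_nonneg α pos v w) (hslackpos v hvO v₀ h0O hne) (hslackpos v₀ h0O v hvO hne.symm)
      (hatt _ h0O _ hvO hne.symm) (hatt _ hvO _ h0O hne) hnear.1 hnear.2
      (hmonoS _ _ hw.1 (hO _ h0O) (hlen _ hv₀)) (hmonoS _ _ hw.1 (hO _ hvO) (hlen _ hv))
      (slack_le hβ0.le hN _) (slack_le hβ0.le hN _)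
      (fun h => (hP.2 _ _ (hO _ h0O) (hO _ hvO) (hmonoL _ _ (hO _ h0O) (hO _ hvO) h)).1)
      (fun h => (hP.2 _ _ (hO _ hvO) (hO _ h0O) (hmonoL _ _ (hO _ hvO) (hO _ h0O) h)).1)
  calc ∑ v ∈ S, (fixedRule α β N pos G P).W w v
      = ∑ v ∈ S, aff α β N pos P w v + ∑ v ∈ S, aff α β N pos P v w := sum_add_distrib
    _ ≤ _ := by linarith

/-- The links of small load can transmit simultaneously. -/
lemma fixed_feasible (hα : 0 < α) (hβ : 0 < β) (hN : 0 ≤ N) (hpos : Function.Injective pos)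
    (hP : IsMonotonePower α pos G P) {S : Finset (V × V)}
    (hok : ∀ v ∈ S, (fixedRule α β N pos G P).ok v)
    (hload : ∀ v ∈ S, (fixedRule α β N pos G P).load S v ≤ 1 / 4) :
    Feasible α β N pos P S ∧ ∀ κ : ℝ, 0 < κ → (∀ v ∈ S, 2 * β * N * P v ≤ κ) →
      Feasible α β N pos (dualPower α κ pos P) (reversed S) := by
  have hPp : ∀ v ∈ S, 0 < P v := fun v hv => hP.1 v (hok v hv).1
  have hs : ∀ v ∈ S, 0 ≤ slack α β N pos P v := fun v hv => slack_nonneg hpos (hok v hv)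
  have hL : ∀ v ∈ S, 0 < len pos v ^ α := fun v hv =>
    Real.rpow_pos_of_pos (len_pos_of_adj hpos (hok v hv).1) α
  have hnn : ∀ u ∈ S, ∀ v ∈ S, 0 ≤ aff α β N pos P u v := fun u hu v hv =>
    aff_nonneg hβ.le (hPp u hu).le (hs v hv)
  have hsum : ∀ v ∈ S, ∑ u ∈ S.erase v, aff α β N pos P u v ≤ 1 / 4 ∧
      ∑ u ∈ S.erase v, aff α β N pos P v u ≤ 1 / 4 := by
    intro v hv
    have h1 := hload v hv
    have h2 : (fixedRule α β N pos G P).load S v = ∑ u ∈ S.erase v, aff α β N pos P u v +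
        ∑ u ∈ S.erase v, aff α β N pos P v u := sum_add_distrib
    have h3 : 0 ≤ ∑ u ∈ S.erase v, aff α β N pos P u v :=
      sum_nonneg fun u hu => hnn u (mem_of_mem_erase hu) v hv
    have h4 : 0 ≤ ∑ u ∈ S.erase v, aff α β N pos P v u :=
      sum_nonneg fun u hu => hnn v hv u (mem_of_mem_erase hu)
    constructor <;> linarith
  have hle : ∀ u ∈ S, ∀ v ∈ S, u ≠ v → aff α β N pos P u v ≤ 1 / 4 := by
    intro u hu v hv huv
    exact (single_le_sum (f := fun u => aff α β N pos P u v)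
      (fun x hx => hnn x (mem_of_mem_erase hx) v hv) (mem_erase.2 ⟨huv, hu⟩)).trans (hsum v hv).1
  have hne : ∀ u ∈ S, ∀ v ∈ S, pos u.1 ≠ pos v.2 := by
    intro u hu v hv
    by_cases huv : u = v
    · subst huv
      exact fun h => (hok u hu).1.ne (hpos h)
    · exact (of_aff_le hα hβ (hPp u hu) (hs v hv) (hle u hu v hv huv)).1
  constructor
  -- Incoming load 1/4 and the factor 4/3 of `of_aff_le` use only a third of the slack.
  · refine feasible_of_real hβ hN hPp hne fun v hv => ?_
    have h1 : β * ∑ u ∈ S.erase v, P u / att α pos u v ≤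
        ∑ u ∈ S.erase v, 4 / 3 * aff α β N pos P u v * slack α β N pos P v := by
      rw [mul_sum]
      refine sum_le_sum fun u hu => ?_
      exact (of_aff_le hα hβ (hPp u (mem_of_mem_erase hu)) (hs v hv)
        (hle u (mem_of_mem_erase hu) v hv (ne_of_mem_erase hu))).2.2
    rw [← sum_mul, ← mul_sum] at h1
    have h2 : 4 / 3 * (∑ u ∈ S.erase v, aff α β N pos P u v) * slack α β N pos P v ≤
        1 * slack α β N pos P v :=
      mul_le_mul_of_nonneg_right (by linarith [(hsum v hv).1]) (hs v hv)
    have h3 : slack α β N pos P v = P v / att α pos v v - β * N := rfl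
    linarith
  · intro κ hκ hκS
    have hmem : ∀ v ∈ reversed S, v.swap ∈ S := by
      intro v hv
      obtain ⟨u, hu, rfl⟩ := mem_image.1 hv
      simpa using hu
    have hlen : ∀ v : V × V, len pos v.swap = len pos v := fun v => dist_comm _ _
    have hPs : ∀ v ∈ S, P v.swap = P v := by
      intro v hv
      -- Both directions of a link have the same length, so monotonicity applied twice forces equal
      -- powers.
      have h1 : G.Adj v.swap.1 v.swap.2 := (hok v hv).1.symm
      exact le_antisymm (hP.2 _ _ h1 (hok v hv).1 (hlen v).le).1
        (hP.2 _ _ (hok v hv).1 h1 (hlen v).ge).1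
    have hdual : ∀ v ∈ S, dualPower α κ pos P v.swap = κ * len pos v ^ α / P v := by
      intro v hv
      rw [dualPower, hlen, hPs v hv]
    refine feasible_of_real hβ hN (fun v hv => ?_) (fun u hu v hv => ?_) fun v' hv' => ?_
    · have := hdual _ (hmem v hv)
      rw [Prod.swap_swap] at this
      rw [this]
      exact div_pos (mul_pos hκ (hL _ (hmem v hv))) (hPp _ (hmem v hv))
    · exact (hne _ (hmem v hv) _ (hmem u hu)).symm
    · obtain ⟨v, hv, rfl⟩ := mem_image.1 hv'
      have herase : (reversed S).erase v.swap = (S.erase v).image Prod.swap := by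
        rw [reversed, image_erase Prod.swap_injective]
      have hatt : ∀ u : V × V, att α pos u.swap v.swap = att α pos v u := fun u => by
        simp only [att, Prod.fst_swap, Prod.snd_swap, dist_comm]
      rw [herase, sum_image Prod.swap_injective.injOn, hatt, att_self, hdual v hv]
      -- After reversal with dual powers, the interference of u at v, relative to the signal κ / P
      -- v, is controlled by the outgoing `aff` from v to u in the original set.
      have h1 : ∀ u ∈ S.erase v, β * (dualPower α κ pos P u.swap / att α pos u.swap v.swap) ≤
          4 / 3 * aff α β N pos P v u * (κ / P v) := by
        intro u hu
        obtain ⟨huv, hu⟩ := mem_erase.1 hu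
        obtain ⟨h2, h3, h4⟩ := of_aff_le hα hβ (hPp v hv) (hs u hu) (hle v hv u hu huv.symm)
        rw [hdual u hu, hatt]
        have h5 : β * (P v / att α pos v u) ≤
            4 / 3 * aff α β N pos P v u * (P u / len pos u ^ α) :=
          h4.trans (mul_le_mul_of_nonneg_left (slack_le hβ.le hN u)
            (mul_nonneg (by norm_num) (hnn v hv u hu)))
        have h6 := mul_le_mul_of_nonneg_right h5
          (div_nonneg (mul_nonneg hκ.le (hL u hu).le) (mul_pos (hPp u hu) (hPp v hv)).le)
        have hLu := (hL u hu).ne'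
        have hPu := (hPp u hu).ne'
        have hPv := (hPp v hv).ne'
        have hau := (att_pos (α := α) h2).ne'
        have hcancel : ∀ p L q : ℝ, p ≠ 0 → L ≠ 0 → q ≠ 0 →
            p / L * (κ * L / (p * q)) = κ / q := fun p L q hp hL hq => by field_simp
        rw [mul_assoc (4 / 3 * _), hcancel _ _ _ hPu hLu hPv] at h6
        refine le_trans (le_of_eq ?_) h6
        field_simp
      have h7 := sum_le_sum h1
      rw [← mul_sum, ← sum_mul, ← mul_sum] at h7
      have h8 : 0 < κ / P v := div_pos hκ (hPp v hv)
      -- The lower bound on κ leaves at most half of the signal to noise; interference takes at most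
      -- a third.
      have h9 : β * N ≤ 1 / 2 * (κ / P v) := by
        rw [mul_div_assoc', le_div_iff₀ (hPp v hv)]
        linarith [hκS v hv]
      have h10 : κ * len pos v ^ α / P v / len pos v ^ α = κ / P v := by
        have := (hL v hv).ne'
        have hPv := (hPp v hv).ne'
        field_simp
      rw [h10]
      have h11 : 4 / 3 * (∑ u ∈ S.erase v, aff α β N pos P v u) * (κ / P v) ≤
          1 / 3 * (κ / P v) :=
        mul_le_mul_of_nonneg_right (by linarith [(hsum v hv).2]) h8.le
      linarith

end Fixed

end SINR

/-! ### Power control -/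

namespace SINR

open Finset ConnSched

/-- Powers can be assigned from the longest link down to the shortest one, if the shorter links
have a small total conflict with each link. Here `κ` orders the links by length, `L` is the
attenuation along a link and `E` the attenuation between links. -/
lemma exists_powers {ι κ : Type*} [Finite ι] [DecidableEq ι] [LinearOrder κ] {key : ι → κ}
    (hkey : Function.Injective key) {S : Finset ι} {L : ι → ℝ} {E : ι → ι → ℝ}
    {β N t η : ℝ} (hβ : 1 ≤ β) (hN : 0 ≤ N) (ht : 1 ≤ t) (hη : 0 ≤ η) (hηβ : 32 * β ^ 2 * t * η ≤ 1)
    (hL : ∀ v, v ∈ S → E v v = L v) (hE : ∀ u ∈ S, ∀ v ∈ S, 0 < E u v)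
    (htri : ∀ u ∈ S, ∀ v ∈ S, ∀ w ∈ S, key w < key u → key w < key v →
      E u v ≤ t * max (E u w) (E w v))
    (hsmall : ∀ v ∈ S, ∑ w ∈ S with key w < key v, (L w / E w v + L w / E v w) ≤ η) :
    ∃ P : ι → ℝ, ∀ v ∈ S, 0 < P v ∧
      β * (N + ∑ u ∈ S.erase v, P u / E u v) ≤ P v / E v v := by
  have hβ0 : 0 < β := by linarith
  have hLpos : ∀ v ∈ S, 0 < L v := fun v hv => hL v hv ▸ hE v hv v hv
  have hwf : WellFounded fun u v : ι => key v < key u := by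
    have : IsTrans ι fun u v => key v < key u := ⟨fun _ _ _ h h' => h'.trans h⟩
    have : Std.Irrefl fun u v : ι => key v < key u := ⟨fun _ => lt_irrefl _⟩
    exact Finite.wellFounded_of_trans_of_irrefl _
  -- Each link answers the noise and the interference of all longer links with a factor of 2β, using
  -- half of its signal for them. The summand 1 keeps powers positive even without noise or longer
  -- links.
  obtain ⟨P, hP⟩ : ∃ P : ι → ℝ, ∀ v, P v =
      2 * β * L v * (N + 1 + ∑ u ∈ S with key v < key u, P u / E u v) := by
    let P : ι → ℝ := hwf.fix fun v rec =>
      2 * β * L v * (N + 1 + ∑ u ∈ S, if h : key v < key u then rec u h / E u v else 0)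
    refine ⟨P, fun v => ?_⟩
    have h1 := hwf.fix_eq (fun v (rec : ∀ u, key v < key u → ℝ) =>
      2 * β * L v * (N + 1 + ∑ u ∈ S, if h : key v < key u then rec u h / E u v else 0)) v
    refine h1.trans ?_
    rw [sum_filter]
    rfl
  have hpos : ∀ v, v ∈ S → 0 < P v := by
    intro v
    induction v using hwf.induction with
    | _ v ih =>
      intro hv
      rw [hP v]
      refine mul_pos (mul_pos (by linarith) (hLpos v hv)) ?_
      have : 0 ≤ ∑ u ∈ S with key v < key u, P u / E u v := by
        refine sum_nonneg fun u hu => ?_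
        obtain ⟨hu, hlt⟩ := mem_filter.1 hu
        exact (div_pos (ih u hlt hu) (hE u hu v hv)).le
      linarith
  refine ⟨P, fun v hv => ⟨hpos v hv, ?_⟩⟩
  set Z := P v / E v v with hZ
  set J := ∑ u ∈ S with key v < key u, P u / E u v with hJ
  set I := ∑ w ∈ S with key w < key v, P w / E w v with hI
  have hnn : ∀ u ∈ S, 0 ≤ P u / E u v := fun u hu => (div_pos (hpos u hu) (hE u hu v hv)).le
  have hZpos : 0 < Z := div_pos (hpos v hv) (hE v hv v hv)
  have hJ0 : 0 ≤ J := sum_nonneg fun u hu => hnn u (mem_of_mem_filter u hu)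
  have hI0 : 0 ≤ I := sum_nonneg fun u hu => hnn u (mem_of_mem_filter u hu)
  have hZJ : Z = 2 * β * (N + 1 + J) := by
    have := (hLpos v hv).ne'
    rw [hZ, hL v hv, hP v, ← hJ]
    field_simp
  have hsplit : ∑ u ∈ S.erase v, P u / E u v = I + J := by
    rw [hI, hJ, ← sum_union]
    · refine sum_congr ?_ fun _ _ => rfl
      ext u
      simp only [mem_erase, mem_union, mem_filter]
      constructor
      · rintro ⟨hne, hu⟩
        rcases lt_or_gt_of_ne (fun h => hne (hkey h)) with h | h
        · exact Or.inl ⟨hu, h⟩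
        · exact Or.inr ⟨hu, h⟩
      · rintro (⟨hu, h⟩ | ⟨hu, h⟩)
        · exact ⟨fun h' => by simp [h'] at h, hu⟩
        · exact ⟨fun h' => by simp [h'] at h, hu⟩
    · refine disjoint_filter.2 fun u _ h h' => lt_asymm h h'
  have htotal : ∑ u ∈ S, P u / E u v = Z + (I + J) := by
    rw [← hsplit, ← add_sum_erase S _ hv]
  -- Expanding the powers of shorter links by their recursion leaves a noise part and a double sum
  -- over w and links u longer than w. The double sum is charged to the signals of u at v, including
  -- the signal of v itself and the quantity I being bounded.
  have hbound : I ≤ 2 * β * η * (N + 1) + 4 * β * t * η * (Z + (I + J)) := by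
    have h1 : I = ∑ w ∈ S with key w < key v, 2 * β * (N + 1) * (L w / E w v) +
        ∑ w ∈ S with key w < key v, ∑ u ∈ S with key w < key u,
          2 * β * (L w / E w v * (P u / E u w)) := by
      rw [← sum_add_distrib]
      refine sum_congr rfl fun w hw => ?_
      rw [hP w, ← mul_sum, ← mul_sum]
      ring
    have h2 : ∑ w ∈ S with key w < key v, 2 * β * (N + 1) * (L w / E w v) ≤
        2 * β * η * (N + 1) := by
      rw [← mul_sum]
      have : ∑ w ∈ S with key w < key v, L w / E w v ≤ η := by
        refine le_trans (sum_le_sum fun w hw => ?_) (hsmall v hv)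
        have hw := mem_of_mem_filter w hw
        exact le_add_of_nonneg_right (div_pos (hLpos w hw) (hE v hv w hw)).le
      calc 2 * β * (N + 1) * ∑ w ∈ S with key w < key v, L w / E w v ≤ 2 * β * (N + 1) * η :=
            mul_le_mul_of_nonneg_left this (by positivity)
        _ = _ := by ring
    -- From E u v ≤ t (E u w + E w v) follows 1/(E u w · E w v) ≤ (t / E u v)(1/E u w + 1/E w v).
    -- For fixed u, summing over w then costs at most 2η by smallness at u and at v.
    have h3 : ∀ w ∈ S, key w < key v → ∀ u ∈ S, key w < key u →
        2 * β * (L w / E w v * (P u / E u w)) ≤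
          2 * β * t * (P u / E u v) * (L w / E u w + L w / E w v) := by
      intro w hw hwv u hu hwu
      have hEuv := hE u hu v hv
      have hEuw := hE u hu w hw
      have hEwv := hE w hw v hv
      have hmax : E u v ≤ t * (E u w + E w v) := (htri u hu v hv w hw hwu hwv).trans
        (mul_le_mul_of_nonneg_left (max_le (by linarith) (by linarith)) (by linarith))
      have hLw := hLpos w hw
      have hPu := hpos u hu
      have h4 : 2 * β * t * (P u / E u v) * (L w / E u w + L w / E w v) =
          2 * β * (L w / E w v * (P u / E u w)) * (t * (E u w + E w v) / E u v) := by
        field_simp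
        ring
      rw [h4]
      refine le_mul_of_one_le_right (by positivity) ?_
      rwa [one_le_div hEuv]
    have h5 : ∑ w ∈ S with key w < key v, ∑ u ∈ S with key w < key u,
          2 * β * (L w / E w v * (P u / E u w)) ≤ 4 * β * t * η * (Z + (I + J)) := by
      calc ∑ w ∈ S with key w < key v, ∑ u ∈ S with key w < key u,
            2 * β * (L w / E w v * (P u / E u w))
          ≤ ∑ w ∈ S with key w < key v, ∑ u ∈ S with key w < key u,
            2 * β * t * (P u / E u v) * (L w / E u w + L w / E w v) := by
            refine sum_le_sum fun w hw => sum_le_sum fun u hu => ?_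
            obtain ⟨hw, hwv⟩ := mem_filter.1 hw
            obtain ⟨hu, hwu⟩ := mem_filter.1 hu
            exact h3 w hw hwv u hu hwu
        _ = ∑ u ∈ S, ∑ w ∈ S with key w < key v ∧ key w < key u,
            2 * β * t * (P u / E u v) * (L w / E u w + L w / E w v) := by
            refine sum_comm' fun w u => ?_
            simp only [mem_filter]
            tauto
        _ ≤ ∑ u ∈ S, 4 * β * t * η * (P u / E u v) := by
            refine sum_le_sum fun u hu => ?_
            rw [← mul_sum, sum_add_distrib]
            have h6 : ∑ w ∈ S with key w < key v ∧ key w < key u, L w / E u w ≤ η := by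
              refine le_trans ?_ (hsmall u hu)
              refine le_trans (sum_le_sum_of_subset_of_nonneg (t := S.filter fun w => key w < key u)
                (fun w hw => ?_) fun w hw _ => ?_) (sum_le_sum fun w hw => ?_)
              · rw [mem_filter] at hw ⊢; exact ⟨hw.1, hw.2.2⟩
              · have hw := mem_of_mem_filter w hw
                exact (div_pos (hLpos w hw) (hE u hu w hw)).le
              · have hw := mem_of_mem_filter w hw
                exact le_add_of_nonneg_left (div_pos (hLpos w hw) (hE w hw u hu)).le
            have h7 : ∑ w ∈ S with key w < key v ∧ key w < key u, L w / E w v ≤ η := by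
              refine le_trans ?_ (hsmall v hv)
              refine le_trans (sum_le_sum_of_subset_of_nonneg (t := S.filter fun w => key w < key v)
                (fun w hw => ?_) fun w hw _ => ?_) (sum_le_sum fun w hw => ?_)
              · rw [mem_filter] at hw ⊢; exact ⟨hw.1, hw.2.1⟩
              · have hw := mem_of_mem_filter w hw
                exact (div_pos (hLpos w hw) (hE w hw v hv)).le
              · have hw := mem_of_mem_filter w hw
                exact le_add_of_nonneg_right (div_pos (hLpos w hw) (hE v hv w hw)).le
            calc _ ≤ 2 * β * t * (P u / E u v) * (η + η) := by
                  refine mul_le_mul_of_nonneg_left (add_le_add h6 h7) ?_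
                  have := hnn u hu
                  positivity
              _ = _ := by ring
        _ = 4 * β * t * η * (Z + (I + J)) := by rw [← mul_sum, htotal]
    linarith
  rw [hsplit]
  -- Since N + 1 + J ≤ Z/2 by the choice of powers, I ≤ ε (3/2 · Z + I) with ε ≤ 1/(8β), so I can be
  -- absorbed. Then β I takes at most one half of the signal and β (N + J) at most the other.
  set ε := 4 * β * t * η with hε
  have hε0 : 0 ≤ ε := by positivity
  have hεβ : 8 * β * ε ≤ 1 := by rw [hε]; linarith
  have hηε : 2 * β * η * (N + 1) ≤ ε * (N + 1) := by
    refine mul_le_mul_of_nonneg_right ?_ (by linarith)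
    rw [hε]
    have : 0 ≤ β * η := by positivity
    nlinarith
  have hNJ : N + 1 + J ≤ Z / 2 := by
    rw [hZJ]
    nlinarith
  have h1 : I ≤ ε * (3 / 2 * Z + I) := by nlinarith
  have h2 : ε ≤ 1 / 8 := by nlinarith
  have h3 : 7 / 8 * I ≤ 3 / 2 * ε * Z := by nlinarith
  have h4 : β * I ≤ Z / 2 := by
    have h5 : β * (7 / 8 * I) ≤ β * (3 / 2 * ε * Z) := mul_le_mul_of_nonneg_left h3 hβ0.le
    have h6 : 8 * β * ε * Z ≤ 1 * Z := mul_le_mul_of_nonneg_right hεβ hZpos.le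
    linarith
  have h5 : β * (N + J) ≤ Z / 2 := by rw [hZJ]; linarith
  linarith

/-! ### The direction-free conflict weight, its sparsity and the resulting powers -/

variable {V X : Type*} [MetricSpace X]

/-- Half the harmonic mean of the attenuations along two links: up to a factor of two, the smaller
one of them. -/
noncomputable def harm (α : ℝ) (pos : V → X) (u v : V × V) : ℝ :=
  len pos u ^ α * len pos v ^ α / (len pos u ^ α + len pos v ^ α)

/-- Closeness of two nodes in comparison with `h`, a number between zero and one. -/
noncomputable def near (α : ℝ) (pos : V → X) (h : ℝ) (x y : V) : ℝ :=
  h / (dist (pos x) (pos y) ^ α + h)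

/-- The selection rule for power control. -/
noncomputable def globalRule (α : ℝ) (pos : V → X) (G : SimpleGraph V) (K : ℕ) : Rule V where
  ok v := G.Adj v.1 v.2
  len := len pos
  W u v := near α pos (harm α pos u v) u.1 v.1 + near α pos (harm α pos u v) u.1 v.2 +
    (near α pos (harm α pos u v) u.2 v.1 + near α pos (harm α pos u v) u.2 v.2)
  K := K

section Global

variable {α β N : ℝ} {pos : V → X} {G : SimpleGraph V} {K : ℕ}

lemma harm_comm (u v : V × V) : harm α pos u v = harm α pos v u := by
  rw [harm, harm, mul_comm, add_comm]

lemma near_comm (h : ℝ) (x y : V) : near α pos h x y = near α pos h y x := by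
  rw [near, near, dist_comm]

lemma harm_nonneg (u v : V × V) : 0 ≤ harm α pos u v := by
  have h1 : 0 ≤ len pos u ^ α := Real.rpow_nonneg dist_nonneg _
  have h2 : 0 ≤ len pos v ^ α := Real.rpow_nonneg dist_nonneg _
  rw [harm]; positivity

lemma near_nonneg {h : ℝ} (hh : 0 ≤ h) (x y : V) : 0 ≤ near α pos h x y := by
  have h1 : 0 ≤ dist (pos x) (pos y) ^ α := Real.rpow_nonneg dist_nonneg _
  rw [near]; positivity

lemma near_le_one {h : ℝ} (hh : 0 ≤ h) (x y : V) : near α pos h x y ≤ 1 := by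
  have h1 : 0 ≤ dist (pos x) (pos y) ^ α := Real.rpow_nonneg dist_nonneg _
  exact div_le_one_of_le₀ (by linarith) (by linarith)

lemma globalRule_valid (hK : 0 < K) : (globalRule α pos G K).Valid where
  nonneg u v _ _ := by
    have h := harm_nonneg (α := α) (pos := pos) u v
    exact add_nonneg (add_nonneg (near_nonneg h _ _) (near_nonneg h _ _))
      (add_nonneg (near_nonneg h _ _) (near_nonneg h _ _))
  symm u v := by
    simp only [globalRule]
    rw [harm_comm u v, near_comm _ u.1 v.1, near_comm _ u.1 v.2, near_comm _ u.2 v.1,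
      near_comm _ u.2 v.2]
    ring
  pos := hK

/-- All four endpoint distances enter symmetrically. This is why a schedule found for one direction
of the links works for every direction. -/
lemma globalRule_W_swap_left (u v : V × V) :
    (globalRule α pos G K).W u.swap v = (globalRule α pos G K).W u v := by
  have h : harm α pos u.swap v = harm α pos u v := by
    rw [harm, harm, show len pos u.swap = len pos u from dist_comm _ _]
  simp only [globalRule, h, Prod.fst_swap, Prod.snd_swap]
  ring

lemma globalRule_W_swap_right (u v : V × V) :
    (globalRule α pos G K).W u v.swap = (globalRule α pos G K).W u v := by
  have h : harm α pos u v.swap = harm α pos u v := by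
    rw [harm, harm, show len pos v.swap = len pos v from dist_comm _ _]
  simp only [globalRule, h, Prod.fst_swap, Prod.snd_swap]
  ring

lemma harm_le {u v : V × V} (hu : 0 < len pos u ^ α) : harm α pos u v ≤ len pos u ^ α := by
  have h2 : 0 ≤ len pos v ^ α := Real.rpow_nonneg dist_nonneg _
  rw [harm, div_le_iff₀ (by linarith)]
  nlinarith

lemma le_two_mul_harm {u v : V × V} (hu : 0 < len pos u ^ α) (h : len pos u ^ α ≤ len pos v ^ α) :
    len pos u ^ α ≤ 2 * harm α pos u v := by
  rw [harm, ← mul_div_assoc, le_div_iff₀ (by linarith)]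
  nlinarith

/-- Each of the ratios L0 / E1 and Lv / E2 is at least the left side divided by t, hence so is their
geometric mean. No power occurs on either side, as power control requires. -/
lemma ratio_le_sqrt {t D h Lw L0 Lv E1 E2 : ℝ} (ht : 0 < t) (hD : 0 ≤ D) (hLw : 0 < Lw)
    (hh0 : 0 ≤ h) (hh : h ≤ Lw) (hL0 : Lw ≤ L0) (hLv : Lw ≤ Lv) (hE1 : 0 < E1) (hE2 : 0 < E2)
    (hE1' : E1 ≤ t * max L0 D) (hE2' : E2 ≤ t * max Lv D) :
    h / (D + h) ≤ t * √(L0 / E1 * (Lv / E2)) := by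
  have hmono : ∀ L E, Lw ≤ L → 0 < E → E ≤ t * max L D → h / (D + h) / t ≤ L / E := by
    intro L E hL hE hE'
    have hLpos : 0 < L := hLw.trans_le hL
    rcases hh0.eq_or_lt with rfl | hh0
    · simp; positivity
    rw [div_div, div_le_div_iff₀ (by positivity) hE]
    rcases le_total L D with h' | h'
    · rw [max_eq_right h'] at hE'
      have h1 : h * E ≤ L * (t * D) := mul_le_mul (by linarith) hE' hE.le hLpos.le
      have h2 : 0 ≤ L * t * h := by positivity
      nlinarith
    · rw [max_eq_left h'] at hE'
      have h1 : h * E ≤ h * (t * L) := mul_le_mul_of_nonneg_left hE' hh0.le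
      have h2 : 0 ≤ L * t * D := by positivity
      nlinarith
  have hq : 0 ≤ h / (D + h) / t := by positivity
  have h1 : h / (D + h) / t ≤ √(L0 / E1 * (Lv / E2)) := by
    refine Real.le_sqrt_of_sq_le ?_
    rw [sq]
    exact mul_le_mul (hmono L0 E1 hL0 hE1 hE1') (hmono Lv E2 hLv hE2 hE2') hq
      (div_nonneg (by linarith) hE1.le)
  rw [div_le_iff₀ ht] at h1
  linarith

lemma of_near_le {x y : V} {h : ℝ} (hh : 0 < h) (hle : near α pos h x y ≤ 1 / 2) :
    h ≤ dist (pos x) (pos y) ^ α ∧ h / dist (pos x) (pos y) ^ α ≤ 2 * near α pos h x y := by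
  have h0 : 0 ≤ dist (pos x) (pos y) ^ α := Real.rpow_nonneg dist_nonneg _
  have h1 := hle
  rw [near, div_le_iff₀ (by linarith)] at h1
  have h2 : h ≤ dist (pos x) (pos y) ^ α := by linarith
  refine ⟨h2, ?_⟩
  rw [near, mul_div_assoc', div_le_div_iff₀ (by linarith) (by linarith)]
  nlinarith

variable [DecidableEq V]

/-- Feasibility bounds sums of A u v · P u / P v for unknown powers. In the geometric mean of this
term and its transpose the powers cancel, so averaging gives a purely metric bound on half of the
links. -/
lemma global_cover (hα : 0 < α) (hβ : 1 ≤ β) (hN : 0 ≤ N) (hpos : Function.Injective pos)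
    {P : V × V → ℝ} {O : Finset (V × V)} (hO : ∀ v ∈ O, G.Adj v.1 v.2)
    (hfeas : Feasible α β N pos P O) :
    ∃ O' ⊆ O, O.card ≤ 2 * O'.card ∧ (∀ v ∈ O', (globalRule α pos G K).ok v) ∧
      ∀ w, (globalRule α pos G K).ok w →
        ∑ v ∈ O' with (globalRule α pos G K).len w ≤ (globalRule α pos G K).len v,
          (globalRule α pos G K).W w v ≤ 4 * (1 + 2 * 3 ^ α) := by
  have hβ0 : 0 < β := by linarith
  have ht : (0 : ℝ) < 3 ^ α := by positivity
  have hL : ∀ v : V × V, G.Adj v.1 v.2 → 0 < len pos v ^ α := fun v hv =>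
    Real.rpow_pos_of_pos (len_pos_of_adj hpos hv) α
  have hatt : ∀ u ∈ O, ∀ v ∈ O, u ≠ v → 0 < att α pos u v := fun u hu v hv huv =>
    att_pos (hfeas.ne hα hβ0 hu hv huv)
  set A : V × V → V × V → ℝ := fun u v => len pos v ^ α / att α pos u v with hA
  have hA0 : ∀ u v, 0 ≤ A u v := fun u v =>
    div_nonneg (Real.rpow_nonneg dist_nonneg _) (att_nonneg _ _ _ _)
  have hreal : ∀ v ∈ O, ∑ u ∈ O.erase v, A u v * (P u / P v) ≤ 1 := by
    intro v hv
    have h1 := hfeas.real hα hβ0 hN hv fun h => (hO v hv).ne (hpos h)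
    have hPv := (hfeas v hv).1
    have h2 : ∑ u ∈ O.erase v, A u v * (P u / P v) =
        (∑ u ∈ O.erase v, P u / att α pos u v) * (len pos v ^ α / P v) := by
      rw [sum_mul]
      refine sum_congr rfl fun u _ => ?_
      rw [hA]; ring
    have h3 : 0 ≤ ∑ u ∈ O.erase v, P u / att α pos u v := sum_nonneg fun u hu =>
      div_nonneg (hfeas u (mem_of_mem_erase hu)).1.le (att_nonneg _ _ _ _)
    rw [att_self] at h1
    have h4 : ∑ u ∈ O.erase v, P u / att α pos u v ≤ P v / len pos v ^ α := by nlinarith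
    rw [h2]
    calc _ ≤ P v / len pos v ^ α * (len pos v ^ α / P v) :=
          mul_le_mul_of_nonneg_right h4 (div_nonneg (hL v (hO v hv)).le hPv.le)
      _ = 1 := by
          have h5 := (hL v (hO v hv)).ne'
          rw [div_mul_div_comm, mul_comm, div_self (mul_ne_zero h5 hPv.ne')]
  set B : V × V → V × V → ℝ := fun u v => √(A u v * A v u) with hB
  have hB0 : ∀ u v, 0 ≤ B u v := fun u v => Real.sqrt_nonneg _
  have hswap : ∀ f : V × V → V × V → ℝ,
      ∑ v ∈ O, ∑ u ∈ O.erase v, f u v = ∑ v ∈ O, ∑ u ∈ O.erase v, f v u := by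
    intro f
    refine sum_comm' fun x y => ?_
    simp only [mem_erase, ne_eq]
    exact ⟨fun ⟨h1, h2, h3⟩ => ⟨⟨fun h => h2 h.symm, h1⟩, h3⟩,
      fun ⟨⟨h1, h2⟩, h3⟩ => ⟨h2, fun h => h1 h.symm, h3⟩⟩
  set O' := O.filter fun v => ∑ u ∈ O.erase v, B v u ≤ 2 with hO'
  have hO'O : O' ⊆ O := filter_subset _ _
  have hhalf : O.card ≤ 2 * O'.card := by
    refine card_le_two_mul_card_filter (fun u hu => sum_nonneg fun v hv => hB0 u v) ?_
    have h1 : ∀ v ∈ O, ∑ u ∈ O.erase v, B v u ≤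
        ∑ u ∈ O.erase v, (A u v * (P u / P v) + A v u * (P v / P u)) / 2 := by
      intro v hv
      refine sum_le_sum fun u hu => ?_
      have hPv := (hfeas v hv).1
      have hPu := (hfeas u (mem_of_mem_erase hu)).1
      have h2 : 0 ≤ A u v * (P u / P v) := mul_nonneg (hA0 u v) (div_pos hPu hPv).le
      have h3 : 0 ≤ A v u * (P v / P u) := mul_nonneg (hA0 v u) (div_pos hPv hPu).le
      refine Real.sqrt_le_iff.2 ⟨by linarith, ?_⟩
      -- The power ratios are inverse to each other; the arithmetic-geometric mean inequality does
      -- the rest.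
      have h4 : A v u * A u v = A u v * (P u / P v) * (A v u * (P v / P u)) := by
        field_simp
      rw [h4]
      nlinarith [sq_nonneg (A u v * (P u / P v) - A v u * (P v / P u))]
    calc ∑ v ∈ O, ∑ u ∈ O.erase v, B v u
        ≤ ∑ v ∈ O, ∑ u ∈ O.erase v, (A u v * (P u / P v) + A v u * (P v / P u)) / 2 :=
          sum_le_sum h1
      _ = ∑ v ∈ O, ∑ u ∈ O.erase v, A u v * (P u / P v) := by
          have h2 := hswap fun u v => A u v * (P u / P v)
          simp_rw [← sum_div, sum_add_distrib]
          rw [← h2]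
          ring
      _ ≤ ∑ v ∈ O, 1 := sum_le_sum hreal
      _ = O.card := by simp
  refine ⟨O', hO'O, hhalf, fun v hv => hO v (hO'O hv), fun w hw => ?_⟩
  set S := O'.filter fun v => (globalRule α pos G K).len w ≤ (globalRule α pos G K).len v
    with hS
  have hSO : S ⊆ O := (filter_subset _ _).trans hO'O
  have hlen : ∀ v ∈ S, len pos w ^ α ≤ len pos v ^ α := fun v hv =>
    Real.rpow_le_rpow dist_nonneg (mem_filter.1 hv).2 hα.le
  have hsum : ∀ v₀ ∈ S, ∑ v ∈ S.erase v₀, 3 ^ α * B v₀ v ≤ 2 * 3 ^ α := by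
    intro v₀ hv₀
    have h1 : ∑ v ∈ S.erase v₀, B v₀ v ≤ 2 :=
      (sum_le_sum_of_subset_of_nonneg (erase_subset_erase _ hSO) fun v hv _ =>
        hB0 v₀ v).trans (mem_filter.1 (mem_of_mem_filter v₀ hv₀)).2
    rw [← mul_sum]
    nlinarith
  have hrec : ∀ x : V, ∑ v ∈ S, near α pos (harm α pos w v) x v.2 ≤ 1 + 2 * 3 ^ α := by
    intro x
    refine sum_le_of_nearest (D := fun v => dist (pos x) (pos v.2)) (by positivity)
      (fun v hv => near_le_one (harm_nonneg _ _) _ _) fun v₀ hv₀ hmin => ?_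
    refine le_trans (sum_le_sum fun v hv => ?_) (hsum v₀ hv₀)
    obtain ⟨hne, hv⟩ := mem_erase.1 hv
    have hnear := att_le_of_near_receiver (pos := pos) hα (hmin v hv)
    have h1 := ratio_le_sqrt ht (Real.rpow_nonneg dist_nonneg α) (hL w hw) (harm_nonneg w v)
      (harm_le (hL w hw)) (hlen v₀ hv₀) (hlen v hv) (hatt _ (hSO hv₀) _ (hSO hv) hne.symm)
      (hatt _ (hSO hv) _ (hSO hv₀) hne) hnear.1 hnear.2
    refine h1.trans (le_of_eq ?_)
    simp only [hB, hA]
    congr 2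
    ring
  have hsnd : ∀ x : V, ∑ v ∈ S, near α pos (harm α pos w v) x v.1 ≤ 1 + 2 * 3 ^ α := by
    intro x
    refine sum_le_of_nearest (D := fun v => dist (pos v.1) (pos x)) (by positivity)
      (fun v hv => near_le_one (harm_nonneg _ _) _ _) fun v₀ hv₀ hmin => ?_
    refine le_trans (sum_le_sum fun v hv => ?_) (hsum v₀ hv₀)
    obtain ⟨hne, hv⟩ := mem_erase.1 hv
    have hnear := att_le_of_near_sender (pos := pos) hα (hmin v hv)
    have h1 := ratio_le_sqrt ht (Real.rpow_nonneg dist_nonneg α) (hL w hw) (harm_nonneg w v)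
      (harm_le (hL w hw)) (hlen v₀ hv₀) (hlen v hv) (hatt _ (hSO hv) _ (hSO hv₀) hne)
      (hatt _ (hSO hv₀) _ (hSO hv) hne.symm) hnear.1 hnear.2
    rw [near_comm]
    refine h1.trans (le_of_eq ?_)
    simp only [hB, hA]
    congr 2
    ring
  calc ∑ v ∈ S, (globalRule α pos G K).W w v
      = ∑ v ∈ S, near α pos (harm α pos w v) w.1 v.1 + ∑ v ∈ S, near α pos (harm α pos w v) w.1 v.2 +
        (∑ v ∈ S, near α pos (harm α pos w v) w.2 v.1 +
          ∑ v ∈ S, near α pos (harm α pos w v) w.2 v.2) := by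
        simp_rw [← sum_add_distrib]; rfl
    _ ≤ _ := by linarith [hrec w.1, hrec w.2, hsnd w.1, hsnd w.2]

lemma global_feasible [Finite V] (hα : 0 < α) (hβ : 1 ≤ β) (hN : 0 ≤ N)
    (hpos : Function.Injective pos) (hK : 512 * β ^ 2 * 3 ^ α ≤ K) {S : Finset (V × V)}
    (hok : ∀ v ∈ S, G.Adj v.1 v.2)
    (hload : ∀ v ∈ S, K * (globalRule α pos G K).load S v ≤ 4) :
    ∃ P : V × V → ℝ, Feasible α β N pos P S := by
  have ht : (1 : ℝ) ≤ 3 ^ α := Real.one_le_rpow (by norm_num) hα.le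
  have hKpos : (512 : ℝ) ≤ K := by nlinarith [mul_le_mul hβ hβ zero_le_one (by linarith)]
  have hload' : ∀ v ∈ S, (globalRule α pos G K).load S v ≤ 4 / K := fun v hv => by
    rw [le_div_iff₀ (by linarith), mul_comm]; exact hload v hv
  have hL : ∀ v ∈ S, 0 < len pos v ^ α := fun v hv =>
    Real.rpow_pos_of_pos (len_pos_of_adj hpos (hok v hv)) α
  have hharm : ∀ u ∈ S, ∀ v ∈ S, 0 < harm α pos u v := by
    intro u hu v hv
    have := hL u hu
    have := hL v hv
    rw [harm]; positivity
  have hW0 : ∀ u v, 0 ≤ (globalRule α pos G K).W u v := fun u v => by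
    have h := harm_nonneg (α := α) (pos := pos) u v
    exact add_nonneg (add_nonneg (near_nonneg h _ _) (near_nonneg h _ _))
      (add_nonneg (near_nonneg h _ _) (near_nonneg h _ _))
  have hWle : ∀ u v, near α pos (harm α pos u v) u.1 v.2 + near α pos (harm α pos u v) v.1 u.2 ≤
      (globalRule α pos G K).W u v := fun u v => by
    have h := harm_nonneg (α := α) (pos := pos) u v
    have h1 := near_nonneg (α := α) (pos := pos) h u.1 v.1
    have h2 := near_nonneg (α := α) (pos := pos) h u.2 v.2
    rw [near_comm _ v.1 u.2]
    simp only [globalRule]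
    linarith
  have hW2 : ∀ u ∈ S, ∀ v ∈ S, u ≠ v → (globalRule α pos G K).W u v ≤ 1 / 2 := by
    intro u hu v hv huv
    have h1 : (globalRule α pos G K).W u v ≤ (globalRule α pos G K).load S v :=
      single_le_sum (f := fun u => (globalRule α pos G K).W u v) (fun x _ => hW0 x v)
        (mem_erase.2 ⟨huv, hu⟩)
    refine (h1.trans (hload' v hv)).trans ?_
    rw [div_le_iff₀ (by linarith)]
    linarith
  have hnear : ∀ u ∈ S, ∀ v ∈ S, u ≠ v → near α pos (harm α pos u v) u.1 v.2 ≤ 1 / 2 ∧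
      near α pos (harm α pos u v) v.1 u.2 ≤ 1 / 2 := by
    intro u hu v hv huv
    have h1 := (hWle u v).trans (hW2 u hu v hv huv)
    have h2 := near_nonneg (α := α) (pos := pos) (hharm u hu v hv).le u.1 v.2
    have h3 := near_nonneg (α := α) (pos := pos) (hharm u hu v hv).le v.1 u.2
    constructor <;> linarith
  have hne : ∀ u ∈ S, ∀ v ∈ S, pos u.1 ≠ pos v.2 := by
    intro u hu v hv
    by_cases huv : u = v
    · subst huv
      exact fun h => (hok u hu).ne (hpos h)
    · have h1 := (of_near_le (hharm u hu v hv) (hnear u hu v hv huv).1).1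
      exact ne_of_att_ne_zero hα (α := α) ((hharm u hu v hv).trans_le h1).ne'
  obtain ⟨m, ⟨φ⟩⟩ := Finite.exists_equiv_fin (V × V)
  -- `exists_powers` needs a strict order on links, so ties in length are broken by an enumeration.
  let key : V × V → ℝ ×ₗ Fin m := fun e => toLex (len pos e, φ e)
  have hkey : Function.Injective key := fun a b h => by
    have h1 := congrArg (fun z => (ofLex z).2) h
    exact φ.injective h1
  have hkeylen : ∀ u v, key u < key v → len pos u ≤ len pos v := by
    intro u v h
    rcases Prod.Lex.toLex_lt_toLex.1 h with h | h
    · exact h.le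
    · exact h.1.le
  -- The factor 4 is 2 for replacing the shorter attenuation by `harm` and 2 for replacing the ratio
  -- by `near`. With load at most 4/K this gives the smallness parameter 16/K.
  have hconf : ∀ w ∈ S, ∀ v ∈ S, key w < key v →
      len pos w ^ α / att α pos w v + len pos w ^ α / att α pos v w ≤
        4 * (globalRule α pos G K).W w v := by
    intro w hw v hv hlt
    have hwv : w ≠ v := fun h => by simp [h] at hlt
    have h1 := (of_near_le (hharm w hw v hv) (hnear w hw v hv hwv).1).2
    have h2 := (of_near_le (hharm w hw v hv) (hnear w hw v hv hwv).2).2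
    have h3 := le_two_mul_harm (hL w hw)
      (Real.rpow_le_rpow dist_nonneg (hkeylen w v hlt) hα.le)
    have h4 : len pos w ^ α / att α pos w v ≤ 2 * (harm α pos w v / att α pos w v) := by
      rw [← mul_div_assoc]
      exact div_le_div_of_nonneg_right h3 (att_nonneg _ _ _ _)
    have h5 : len pos w ^ α / att α pos v w ≤ 2 * (harm α pos w v / att α pos v w) := by
      rw [← mul_div_assoc]
      exact div_le_div_of_nonneg_right h3 (att_nonneg _ _ _ _)
    have h6 := hWle w v
    simp only [att] at h4 h5 ⊢
    linarith
  have hsum : ∀ v ∈ S, ∑ w ∈ S with key w < key v,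
      (len pos w ^ α / att α pos w v + len pos w ^ α / att α pos v w) ≤ 16 / K := by
    intro v hv
    calc _ ≤ ∑ w ∈ S with key w < key v, 4 * (globalRule α pos G K).W w v := by
          refine sum_le_sum fun w hw => ?_
          obtain ⟨hw, hlt⟩ := mem_filter.1 hw
          exact hconf w hw v hv hlt
      _ ≤ ∑ w ∈ S.erase v, 4 * (globalRule α pos G K).W w v := by
          refine sum_le_sum_of_subset_of_nonneg (fun w hw => ?_) fun w _ _ =>
            mul_nonneg (by norm_num) (hW0 w v)
          obtain ⟨hw, hlt⟩ := mem_filter.1 hw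
          exact mem_erase.2 ⟨fun h => by simp [h] at hlt, hw⟩
      _ = 4 * (globalRule α pos G K).load S v := by rw [← mul_sum]; rfl
      _ ≤ 4 * (4 / K) := by linarith [hload' v hv]
      _ = 16 / K := by ring
  -- The path from the sender of u to the receiver of v goes backwards along w. Smallness at v makes
  -- w no longer than the distance from its sender to the receiver of v, so two of the three steps
  -- are at most that distance.
  have htri : ∀ u ∈ S, ∀ v ∈ S, ∀ w ∈ S, key w < key u → key w < key v →
      att α pos u v ≤ 3 ^ α * max (att α pos u w) (att α pos w v) := by
    intro u _ v hv w hw _ hwv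
    have h1 : len pos w ≤ dist (pos w.1) (pos v.2) := by
      have h2 := single_le_sum (s := S.filter fun w => key w < key v)
        (f := fun w => len pos w ^ α / att α pos w v + len pos w ^ α / att α pos v w) (fun x hx => add_nonneg
          (div_nonneg (hL x (mem_of_mem_filter x hx)).le (att_nonneg _ _ _ _))
          (div_nonneg (hL x (mem_of_mem_filter x hx)).le (att_nonneg _ _ _ _)))
        (mem_filter.2 ⟨hw, hwv⟩)
      have h3 : (16 : ℝ) / K ≤ 1 := by rw [div_le_one (by linarith)]; linarith
      have h4 : 0 ≤ len pos w ^ α / att α pos v w :=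
        div_nonneg (hL w hw).le (att_nonneg _ _ _ _)
      have h5 : len pos w ^ α / att α pos w v ≤ 1 := by linarith [hsum v hv]
      rw [div_le_one (att_pos (hne w hw v hv))] at h5
      exact (Real.rpow_le_rpow_iff dist_nonneg dist_nonneg hα).1 h5
    refine rpow_le_of_le_add hα dist_nonneg dist_nonneg dist_nonneg ?_
    have h2 := dist_triangle4 (pos u.1) (pos w.2) (pos w.1) (pos v.2)
    rw [dist_comm (pos w.2)] at h2
    rw [len] at h1
    linarith
  have hKη : 32 * β ^ 2 * 3 ^ α * (16 / K) ≤ 1 := by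
    rw [mul_div_assoc', div_le_one (by linarith)]
    linarith
  obtain ⟨P, hP⟩ := exists_powers hkey hβ hN ht (by positivity) hKη
    (fun v _ => att_self α pos v) (fun u hu v hv => att_pos (hne u hu v hv)) htri hsum
  exact ⟨P, feasible_of_real (by linarith) hN (fun v hv => (hP v hv).1) hne
    fun v hv => (hP v hv).2⟩

end Global

end SINR

/-! ### Reasoning about programs -/

namespace RealRAM

/-- The arrays of natural numbers which a program may write. -/
def Program.natMods : Program → Finset ℕ
  | .skip => ∅
  | .setNat A _ _ _ => {A}
  | .setReal _ _ _ _ => ∅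
  | .seq p q => p.natMods ∪ q.natMods
  | .ite _ p q => p.natMods ∪ q.natMods
  | .loop _ p => p.natMods

/-- The arrays of real numbers which a program may write. -/
def Program.realMods : Program → Finset ℕ
  | .skip => ∅
  | .setNat _ _ _ _ => ∅
  | .setReal A _ _ _ => {A}
  | .seq p q => p.realMods ∪ q.realMods
  | .ite _ p q => p.realMods ∪ q.realMods
  | .loop _ p => p.realMods

/-- A bound for the number of steps, provided that no loop makes more than `n` iterations. -/
def Program.bound (n : ℕ) : Program → ℕ
  | .skip => 1
  | .setNat _ i j e => i.cost + j.cost + e.cost + 1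
  | .setReal _ i j e => i.cost + j.cost + e.cost + 1
  | .seq p q => p.bound n + q.bound n
  | .ite b p q => b.cost + (p.bound n + q.bound n)
  | .loop b p => n * (b.cost + p.bound n) + b.cost

lemma Program.exists_polynomial (p : Program) :
    ∃ q : Polynomial ℕ, ∀ n, p.bound n = q.eval n := by
  induction p with
  | skip => exact ⟨1, fun n => by simp [bound]⟩
  | setNat A i j e =>
    exact ⟨Polynomial.C (i.cost + j.cost + e.cost + 1), fun n => by rw [Polynomial.eval_C, bound]⟩
  | setReal A i j e =>
    exact ⟨Polynomial.C (i.cost + j.cost + e.cost + 1), fun n => by rw [Polynomial.eval_C, bound]⟩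
  | seq p q ihp ihq =>
    obtain ⟨a, ha⟩ := ihp
    obtain ⟨b, hb⟩ := ihq
    exact ⟨a + b, fun n => by rw [bound, ha, hb, Polynomial.eval_add]⟩
  | ite c p q ihp ihq =>
    obtain ⟨a, ha⟩ := ihp
    obtain ⟨b, hb⟩ := ihq
    exact ⟨Polynomial.C c.cost + (a + b), fun n => by
      rw [bound, ha, hb, Polynomial.eval_add, Polynomial.eval_add, Polynomial.eval_C]⟩
  | loop c p ihp =>
    obtain ⟨a, ha⟩ := ihp
    exact ⟨Polynomial.X * (Polynomial.C c.cost + a) + Polynomial.C c.cost, fun n => by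
      rw [bound, ha, Polynomial.eval_add, Polynomial.eval_mul, Polynomial.eval_add,
        Polynomial.eval_C, Polynomial.eval_X]⟩

/-- `τ` differs from `σ` at most in arrays which `p` may write. -/
def Frame (p : Program) (σ τ : Memory) : Prop :=
  (∀ A, A ∉ p.natMods → τ.nat A = σ.nat A) ∧ ∀ A, A ∉ p.realMods → τ.real A = σ.real A

lemma Frame.refl (p : Program) (σ : Memory) : Frame p σ σ := ⟨fun _ _ => rfl, fun _ _ => rfl⟩

lemma Frame.trans {p : Program} {σ τ υ : Memory} (h : Frame p σ τ) (h' : Frame p τ υ) :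
    Frame p σ υ :=
  ⟨fun A hA => (h'.1 A hA).trans (h.1 A hA), fun A hA => (h'.2 A hA).trans (h.2 A hA)⟩

lemma Frame.mono {p q : Program} {σ τ : Memory} (h : Frame p σ τ) (hn : p.natMods ⊆ q.natMods)
    (hr : p.realMods ⊆ q.realMods) : Frame q σ τ :=
  ⟨fun A hA => h.1 A fun h' => hA (hn h'), fun A hA => h.2 A fun h' => hA (hr h')⟩

lemma writeNat_nat_of_ne {σ : Memory} {A B i j a : ℕ} (h : B ≠ A) :
    (σ.writeNat A i j a).nat B = σ.nat B := by
  funext i' j'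
  simp [Memory.writeNat, h]

lemma writeReal_real_of_ne {σ : Memory} {A B i j : ℕ} {a : ℝ} (h : B ≠ A) :
    (σ.writeReal A i j a).real B = σ.real B := by
  funext i' j'
  simp [Memory.writeReal, h]

lemma Exec.frame {α : ℝ} {p : Program} {σ τ : Memory} {t : ℕ} (h : Exec α p σ τ t) :
    Frame p σ τ := by
  induction h with
  | skip σ => exact Frame.refl _ _
  | setNat A i j e σ =>
    exact ⟨fun B hB => writeNat_nat_of_ne (by simpa [Program.natMods] using hB), fun _ _ => rfl⟩
  | setReal A i j e σ =>
    exact ⟨fun _ _ => rfl, fun B hB => writeReal_real_of_ne (by simpa [Program.realMods] using hB)⟩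
  | seq _ _ ih1 ih2 =>
    exact (ih1.mono Finset.subset_union_left Finset.subset_union_left).trans
      (ih2.mono Finset.subset_union_right Finset.subset_union_right)
  | iteTrue _ _ ih => exact ih.mono Finset.subset_union_left Finset.subset_union_left
  | iteFalse _ _ ih => exact ih.mono Finset.subset_union_right Finset.subset_union_right
  | loopDone _ => exact Frame.refl _ _
  | loopStep _ _ _ ih1 ih2 =>
    exact (ih1.mono (Finset.Subset.refl _) (Finset.Subset.refl _)).trans ih2

/-- Started with memory `σ`, the program `p` halts within `p.bound n` steps with a memory
satisfying `Q`. -/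
def Run (α : ℝ) (n : ℕ) (p : Program) (σ : Memory) (Q : Memory → Prop) : Prop :=
  ∃ τ t, Exec α p σ τ t ∧ t ≤ p.bound n ∧ Q τ

variable {α : ℝ} {n : ℕ} {p q : Program} {σ : Memory} {Q Q' : Memory → Prop}

lemma Run.mono (h : Run α n p σ Q) (hQ : ∀ τ, Frame p σ τ → Q τ → Q' τ) : Run α n p σ Q' := by
  obtain ⟨τ, t, he, ht, hq⟩ := h
  exact ⟨τ, t, he, ht, hQ τ he.frame hq⟩

lemma run_skip (h : Q σ) : Run α n .skip σ Q := ⟨σ, 1, .skip σ, le_rfl, h⟩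

lemma run_setNat {A : ℕ} {i j e : NatExpr}
    (h : Q (σ.writeNat A (i.eval σ) (j.eval σ) (e.eval σ))) : Run α n (.setNat A i j e) σ Q :=
  ⟨_, _, .setNat A i j e σ, le_rfl, h⟩

lemma run_setReal {A : ℕ} {i j : NatExpr} {e : RealExpr}
    (h : Q (σ.writeReal A (i.eval σ) (j.eval σ) (e.eval α σ))) : Run α n (.setReal A i j e) σ Q :=
  ⟨_, _, .setReal A i j e σ, le_rfl, h⟩

lemma run_seq (h : Run α n p σ fun σ' => Run α n q σ' Q) : Run α n (.seq p q) σ Q := by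
  obtain ⟨σ', s, h1, hs, τ, t, h2, ht, hq⟩ := h
  exact ⟨τ, s + t, .seq h1 h2, Nat.add_le_add hs ht, hq⟩

lemma run_ite {b : Cond} (h1 : b.eval α σ → Run α n p σ Q) (h2 : ¬ b.eval α σ → Run α n q σ Q) :
    Run α n (.ite b p q) σ Q := by
  by_cases hb : b.eval α σ
  · obtain ⟨τ, t, he, ht, hq⟩ := h1 hb
    exact ⟨τ, _, .iteTrue hb he, by simp only [Program.bound]; omega, hq⟩
  · obtain ⟨τ, t, he, ht, hq⟩ := h2 hb
    exact ⟨τ, _, .iteFalse hb he, by simp only [Program.bound]; omega, hq⟩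

/-- The number in the first cell of an array. -/
def cell (A : ℕ) : NatExpr := .get A (.lit 0) (.lit 0)

/-- Execution of `p` with the values `0, …, n - 1` in the first cell of array `c`, where `n` is
the number of nodes. -/
def forLoop (c : ℕ) (p : Program) : Program :=
  .seq (.setNat c (.lit 0) (.lit 0) (.lit 0))
    (.loop (.neg (.natLe (cell 0) (cell c)))
      (.seq p (.setNat c (.lit 0) (.lit 0) (.add (cell c) (.lit 1)))))

lemma cell_eval (A : ℕ) (σ : Memory) : (cell A).eval σ = σ.nat A 0 0 := rfl

/-- The invariant must survive overwriting the counter, since the program increments it after the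
body. The frame hypothesis hands the body everything the loop never writes. -/
lemma run_forLoop {c : ℕ} (Inv : ℕ → Memory → Prop) (hc : c ≠ 0) (hp0 : 0 ∉ p.natMods)
    (hpc : c ∉ p.natMods) (hn : σ.nat 0 0 0 = n)
    (hinv : ∀ k σ x, Inv k σ → Inv k (σ.writeNat c 0 0 x)) (h0 : Inv 0 σ)
    (hstep : ∀ k < n, ∀ σ', Frame (forLoop c p) σ σ' → Inv k σ' → σ'.nat c 0 0 = k →
      Run α n p σ' (Inv (k + 1))) :
    Run α n (forLoop c p) σ (Inv n) := by
  have hcmod : c ∈ (forLoop c p).natMods := by simp [forLoop, Program.natMods]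
  have hsub : p.natMods ⊆ (forLoop c p).natMods := by
    intro A hA; simp [forLoop, Program.natMods, hA]
  have hsub' : p.realMods ⊆ (forLoop c p).realMods := by
    intro A hA; simp [forLoop, Program.realMods, hA]
  have h0mod : 0 ∉ (forLoop c p).natMods := by
    simp [forLoop, Program.natMods, hp0, hc.symm]
  have hw : ∀ (υ : Memory) x, Frame (forLoop c p) υ (υ.writeNat c 0 0 x) := fun υ x =>
    ⟨fun A hA => writeNat_nat_of_ne fun h => hA (h ▸ hcmod), fun _ _ => rfl⟩
  set b : Cond := .neg (.natLe (cell 0) (cell c)) with hb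
  set body : Program := .seq p (.setNat c (.lit 0) (.lit 0) (.add (cell c) (.lit 1))) with hbody
  -- Induction on the number m of remaining iterations, which is also what the cost bound counts.
  have hloop : ∀ m k, k + m = n → ∀ σ', Frame (forLoop c p) σ σ' → Inv k σ' → σ'.nat c 0 0 = k →
      ∃ τ t, Exec α (.loop b body) σ' τ t ∧ t ≤ m * (b.cost + body.bound n) + b.cost ∧
        Inv n τ := by
    intro m
    induction m with
    | zero =>
      intro k hk σ' hf hi hck
      have hk : k = n := by omega
      subst hk
      refine ⟨σ', b.cost, .loopDone ?_, by omega, hi⟩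
      simp only [hb, Cond.eval, cell_eval, hck, hf.1 0 h0mod, hn]
      simp
    | succ m ih =>
      intro k hk σ' hf hi hck
      have hbt : b.eval α σ' := by
        simp only [hb, Cond.eval, cell_eval, hck, hf.1 0 h0mod, hn]
        omega
      obtain ⟨σ₁, s, he, hs, hi₁⟩ := hstep k (by omega) σ' hf hi hck
      have hf₁ : Frame (forLoop c p) σ σ₁ := hf.trans (he.frame.mono hsub hsub')
      have hc₁ : σ₁.nat c 0 0 = k := by rw [he.frame.1 c hpc, hck]
      set σ₂ := σ₁.writeNat c 0 0 (k + 1) with hσ₂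
      have he₂ : Exec α (.setNat c (.lit 0) (.lit 0) (.add (cell c) (.lit 1))) σ₁ σ₂ 8 := by
        have h := Exec.setNat (α := α) c (.lit 0) (.lit 0) (.add (cell c) (.lit 1)) σ₁
        simp only [NatExpr.eval, cell_eval, hc₁] at h
        exact h
      obtain ⟨τ, t, het, ht, hq⟩ := ih (k + 1) (by omega) σ₂ (hf₁.trans (hw _ _))
        (hinv _ _ _ hi₁) (by simp [hσ₂, Memory.writeNat])
      refine ⟨τ, _, .loopStep hbt (.seq he he₂) het, ?_, hq⟩
      have h8 : body.bound n = p.bound n + 8 := rfl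
      rw [Nat.succ_mul]
      omega
  obtain ⟨τ, t, he, ht, hq⟩ := hloop n 0 (by omega) (σ.writeNat c 0 0 0) (hw _ _)
    (hinv _ _ _ h0) (by simp [Memory.writeNat])
  exact ⟨τ, 4 + t, .seq (.setNat c (.lit 0) (.lit 0) (.lit 0) σ) he,
    Nat.add_le_add_left ht 4, hq⟩

/-- Indexing the invariant by the set of nodes already visited, instead of a counter, lets pair
loops and finite sums be treated without arithmetic on indices. -/
lemma run_forFin {c : ℕ} (Inv : Finset (Fin n) → Memory → Prop) (hc : c ≠ 0)
    (hp0 : 0 ∉ p.natMods) (hpc : c ∉ p.natMods) (hn : σ.nat 0 0 0 = n)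
    (hinv : ∀ D σ x, Inv D σ → Inv D (σ.writeNat c 0 0 x)) (h0 : Inv ∅ σ)
    (hstep : ∀ D (x : Fin n), x ∉ D → ∀ σ', Frame (forLoop c p) σ σ' → Inv D σ' → σ'.nat c 0 0 = x →
      Run α n p σ' (Inv (insert x D))) :
    Run α n (forLoop c p) σ (Inv Finset.univ) := by
  have h := run_forLoop (α := α) (n := n) (p := p) (σ := σ) (c := c)
    (fun k => Inv (Finset.univ.filter fun x : Fin n => (x : ℕ) < k)) hc hp0 hpc hn
    (fun k σ x h => hinv _ σ x h) (by simpa using h0) ?_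
  · simpa using h
  · intro k hk σ' hf hi hck
    refine (hstep _ ⟨k, hk⟩ (by simp) σ' hf hi hck).mono fun τ _ hτ => ?_
    convert hτ using 1
    ext x
    simp only [Finset.mem_filter, Finset.mem_univ, true_and, Finset.mem_insert, Fin.ext_iff]
    omega

/-- Execution of `p` for all pairs of nodes, which are found in the first cells of the arrays `c`
and `d`. -/
def forPairs (c d : ℕ) (p : Program) : Program := forLoop c (forLoop d p)

lemma run_forPairs {c d : ℕ} (Inv : Finset (Fin n × Fin n) → Memory → Prop) (hc : c ≠ 0)
    (hd : d ≠ 0) (hcd : c ≠ d) (hp0 : 0 ∉ p.natMods) (hpc : c ∉ p.natMods) (hpd : d ∉ p.natMods)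
    (hn : σ.nat 0 0 0 = n)
    (hinvc : ∀ D σ x, Inv D σ → Inv D (σ.writeNat c 0 0 x))
    (hinvd : ∀ D σ x, Inv D σ → Inv D (σ.writeNat d 0 0 x)) (h0 : Inv ∅ σ)
    (hstep : ∀ D (v : Fin n × Fin n), v ∉ D → ∀ σ', Frame (forPairs c d p) σ σ' → Inv D σ' →
      σ'.nat c 0 0 = v.1 → σ'.nat d 0 0 = v.2 → Run α n p σ' (Inv (insert v D))) :
    Run α n (forPairs c d p) σ (Inv Finset.univ) := by
  have hmods : (forLoop d p).natMods = insert d p.natMods := by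
    ext A; simp [forLoop, Program.natMods]
  have h := run_forFin (α := α) (p := forLoop d p) (σ := σ) (c := c)
    (fun D => Inv (D ×ˢ Finset.univ)) hc (by simp [hmods, hp0, hd.symm]) (by simp [hmods, hpc, hcd])
    hn (fun D σ x h => hinvc _ σ x h) (by simpa using h0) ?_
  · rw [forPairs]
    simpa using h
  · intro D x hx σ' hf hi hcx
    have hf0 : σ'.nat 0 0 0 = n := by
      rw [hf.1 0 (by simp [forLoop, Program.natMods, hp0, hc.symm, hd.symm]), hn]
    have h := run_forFin (α := α) (p := p) (σ := σ') (c := d)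
      (fun D' => Inv (D ×ˢ Finset.univ ∪ {x} ×ˢ D')) hd hp0 hpd hf0
      (fun D σ x h => hinvd _ σ x h) (by simpa using hi) ?_
    · refine h.mono fun τ _ hτ => ?_
      convert hτ using 1
      ext ⟨a, b⟩
      simp [or_comm, eq_comm]
    · intro D' y hy σ'' hf' hi' hdy
      refine (hstep _ (x, y) (by simp [hx, hy]) σ'' (hf.trans (hf'.mono ?_ ?_)) hi'
        ?_ hdy).mono fun τ _ hτ => ?_
      · intro A hA; simp only [forLoop, Program.natMods] at hA ⊢; aesop
      · intro A hA; simp only [forLoop, Program.realMods] at hA ⊢; aesop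
      · rw [hf'.1 c (by simp [hmods, hpc, hcd]), hcx]
      · convert hτ using 1
        ext ⟨a, b⟩
        simp only [Finset.mem_union, Finset.mem_product, Finset.mem_univ, and_true,
          Finset.mem_singleton, Finset.mem_insert, Prod.mk.injEq]
        tauto

end RealRAM

/-! ### The program -/

namespace RealRAM

open ConnSched

/-- Equality of natural numbers. -/
def natEq (a b : NatExpr) : Cond := .conj (.natLe a b) (.natLe b a)

lemma natEq_eval {α : ℝ} {σ : Memory} {a b : NatExpr} :
    (natEq a b).eval α σ ↔ a.eval σ = b.eval σ := by
  simp only [natEq, Cond.eval]; omega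

/-- Merge the classes of the nodes `a` and `b` in the labelling which is stored in array `A`. -/
def mergeProg (A : ℕ) (a b : NatExpr) : Program :=
  .seq (.setNat 12 (.lit 0) (.lit 0) (.get A (.lit 0) a)) <|
  .seq (.setNat 13 (.lit 0) (.lit 0) (.get A (.lit 0) b)) <|
  forLoop 24 <| .ite (natEq (.get A (.lit 0) (cell 24)) (cell 13))
    (.setNat A (.lit 0) (cell 24) (cell 12)) .skip

/-- Array `7` holds the labels of the components of the tree links, array `8` those of the
components of these links together with the current greedy set. -/
def copyLabels : Program := forLoop 24 (.setNat 8 (.lit 0) (cell 24) (.get 7 (.lit 0) (cell 24)))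

/-- Array `6` of natural numbers marks the current greedy set, array `3` of reals holds loads. -/
def clearGreedy : Program := forPairs 22 23 <|
  .seq (.setNat 6 (cell 22) (cell 23) (.lit 0)) (.setReal 3 (cell 22) (cell 23) (.lit 0))

/-- The conditions for adding the link in the cells `22` and `23` to the greedy set. -/
def acceptCond (K : ℕ) (ok : Cond) : Cond :=
  .conj ok <| .conj (.neg (natEq (.get 8 (.lit 0) (cell 22)) (.get 8 (.lit 0) (cell 23))))
    (.realLe (.mul (.lit K) (.get 3 (cell 22) (cell 23))) (.lit 1))

/-- Find a shortest acceptable link and write it to the cells `10` and `11`. -/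
def scan (K : ℕ) (ok : Cond) : Program :=
  .seq (.setNat 9 (.lit 0) (.lit 0) (.lit 0)) <| forPairs 22 23 <|
    .ite (.conj (acceptCond K ok) (.neg (.conj (natEq (cell 9) (.lit 1))
        (.realLe (.get 0 (cell 10) (cell 11)) (.get 0 (cell 22) (cell 23))))))
      (.seq (.setNat 9 (.lit 0) (.lit 0) (.lit 1)) <|
        .seq (.setNat 10 (.lit 0) (.lit 0) (cell 22)) (.setNat 11 (.lit 0) (.lit 0) (cell 23)))
      .skip

/-- Add the link in the cells `10` and `11` to the greedy set. -/
def addLink (W : RealExpr) : Program :=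
  .seq (.setReal 4 (.lit 0) (.lit 0) (.get 3 (cell 10) (cell 11))) <|
  .seq (forPairs 22 23 <|
    .setReal 3 (cell 22) (cell 23) (.add (.get 3 (cell 22) (cell 23)) W)) <|
  .seq (.setReal 3 (cell 10) (cell 11) (.get 4 (.lit 0) (.lit 0))) <|
  .seq (.setNat 6 (cell 10) (cell 11) (.lit 1)) (mergeProg 8 (cell 10) (cell 11))

def growGreedy (K : ℕ) (ok : Cond) (W : RealExpr) : Program :=
  forLoop 21 <| .seq (scan K ok) <| .ite (natEq (cell 9) (.lit 1)) (addLink W) .skip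

/-- Add the link in the cells `22` and `23` to the tree. -/
def commitLink : Program :=
  .seq (.setNat 2 (cell 22) (cell 23) (.lit 1)) <|
  .seq (.setNat 2 (cell 23) (cell 22) (.lit 1)) <|
  .seq (.setNat 3 (cell 22) (cell 23) (cell 20)) <|
  .seq (.setNat 3 (cell 23) (cell 22) (cell 20)) <|
  .seq (.setNat 4 (cell 22) (cell 23) (.lit 1)) <|
  .seq (.setNat 5 (.lit 0) (.lit 0) (.add (cell 20) (.lit 1))) (mergeProg 7 (cell 22) (cell 23))

/-- Add the links of small load to the tree. -/
def commit (K : ℕ) : Program := forPairs 22 23 <|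
  .ite (.conj (natEq (.get 6 (cell 22) (cell 23)) (.lit 1))
      (.realLe (.mul (.lit K) (.get 3 (cell 22) (cell 23))) (.lit 4)))
    commitLink .skip

def roundProg (K : ℕ) (ok : Cond) (W : RealExpr) : Program :=
  .seq copyLabels <| .seq clearGreedy <| .seq (growGreedy K ok W) (commit K)

/-- The program for the rule with constant `K`, where `ok` tests the link in the cells `22`
and `23`, and `W` is its weight in relation to the link in the cells `10` and `11`. -/
def mainProg (K : ℕ) (ok : Cond) (W : RealExpr) : Program :=
  .seq (forLoop 24 (.setNat 7 (.lit 0) (cell 24) (cell 24))) (forLoop 20 (roundProg K ok W))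

/-- The memory `σ` holds the same input as `σ₀`. -/
structure SameInput (σ₀ σ : Memory) : Prop where
  size : σ.nat 0 = σ₀.nat 0
  adj : σ.nat 1 = σ₀.nat 1
  dist : σ.real 0 = σ₀.real 0
  power : σ.real 1 = σ₀.real 1
  param : σ.real 2 = σ₀.real 2

/-- The test `ok` and the expression `W` describe the rule `R` for the input `σ₀`. -/
structure Describes {n : ℕ} (α : ℝ) (σ₀ : Memory) (R : Rule (Fin n)) (ok : Cond) (W : RealExpr) :
    Prop where
  size : σ₀.nat 0 0 0 = n
  len : ∀ u v : Fin n, σ₀.real 0 u v = R.len (u, v)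
  ok : ∀ σ, SameInput σ₀ σ → ∀ v : Fin n × Fin n, σ.nat 22 0 0 = v.1 → σ.nat 23 0 0 = v.2 →
    (ok.eval α σ ↔ R.ok v)
  W : ∀ σ, SameInput σ₀ σ → ∀ u v : Fin n × Fin n, σ.nat 10 0 0 = u.1 → σ.nat 11 0 0 = u.2 →
    σ.nat 22 0 0 = v.1 → σ.nat 23 0 0 = v.2 → W.eval α σ = R.W u v

lemma SameInput.refl (σ : Memory) : SameInput σ σ := ⟨rfl, rfl, rfl, rfl, rfl⟩

lemma SameInput.of_frame {σ₀ σ τ : Memory} {p : Program} (h : SameInput σ₀ σ) (hf : Frame p σ τ)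
    (h0 : 0 ∉ p.natMods) (h1 : 1 ∉ p.natMods) (hr0 : 0 ∉ p.realMods) (hr1 : 1 ∉ p.realMods)
    (hr2 : 2 ∉ p.realMods) : SameInput σ₀ τ :=
  ⟨(hf.1 0 h0).trans h.size, (hf.1 1 h1).trans h.adj, (hf.2 0 hr0).trans h.dist,
    (hf.2 1 hr1).trans h.power, (hf.2 2 hr2).trans h.param⟩

/-- The labels in array `A`. -/
def labels (n : ℕ) (σ : Memory) (A : ℕ) : Fin n → ℕ := fun x => σ.nat A 0 x

variable {α : ℝ} {n : ℕ} {σ : Memory}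

lemma run_mergeProg {A : ℕ} (hA : A = 7 ∨ A = 8) {a b : NatExpr} {e : Fin n × Fin n}
    (hn : σ.nat 0 0 0 = n) (ha : a.eval σ = e.1)
    (hb : ∀ x, b.eval (σ.writeNat 12 0 0 x) = e.2) :
    Run α n (mergeProg A a b) σ fun τ => labels n τ A =
      fun x => if labels n σ A x = labels n σ A e.2 then labels n σ A e.1 else labels n σ A x := by
  have hA0 : A ≠ 0 := by omega
  have hA12 : A ≠ 12 := by omega
  have hA13 : A ≠ 13 := by omega
  have hA24 : A ≠ 24 := by omega
  -- Both labels are saved before the loop because it overwrites array `A` in place. The second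
  -- expression is evaluated after cell 12 has been written, hence the form of `hb`.
  refine run_seq (run_setNat (run_seq (run_setNat ?_)))
  simp only [NatExpr.eval, ha, hb]
  set σ₁ := (σ.writeNat 12 0 0 (σ.nat A 0 e.1)).writeNat 13 0 0
    ((σ.writeNat 12 0 0 (σ.nat A 0 e.1)).nat A 0 e.2) with hσ₁
  have hσA : σ₁.nat A = σ.nat A := by
    rw [hσ₁, writeNat_nat_of_ne hA13, writeNat_nat_of_ne hA12]
  have h12 : σ₁.nat 12 0 0 = σ.nat A 0 e.1 := by
    rw [hσ₁, writeNat_nat_of_ne (by norm_num)]; simp [Memory.writeNat]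
  have h13 : σ₁.nat 13 0 0 = σ.nat A 0 e.2 := by
    rw [hσ₁, writeNat_nat_of_ne hA12]; simp [Memory.writeNat]
  have hn₁ : σ₁.nat 0 0 0 = n := by
    rw [hσ₁, writeNat_nat_of_ne (by norm_num), writeNat_nat_of_ne (by norm_num), hn]
  refine (run_forFin (fun D τ => ∀ x : Fin n, τ.nat A 0 x =
    if x ∈ D ∧ labels n σ A x = labels n σ A e.2 then labels n σ A e.1 else labels n σ A x)
    (by norm_num) ?_ ?_ hn₁ ?_ ?_ ?_).mono ?_
  · simp [Program.natMods, hA0.symm]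
  · simp [Program.natMods, hA24.symm]
  · intro D τ x h
    rwa [writeNat_nat_of_ne hA24]
  · intro x
    simp [hσA, labels]
  · intro D x hx τ hf hi hc
    have hm : ∀ B, B ≠ A → B ≠ 24 → τ.nat B = σ₁.nat B := fun B h1 h2 =>
      hf.1 B (by simp [forLoop, Program.natMods, h1, h2])
    have hxA : τ.nat A 0 x = labels n σ A x := by rw [hi x]; simp [hx]
    refine run_ite (fun h => run_setNat fun y => ?_) fun h => run_skip fun y => ?_
    · rw [natEq_eval] at h
      simp only [NatExpr.eval, cell_eval, hc, hxA, hm 13 hA13.symm (by norm_num), h13] at h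
      have hx' : (y : ℕ) = x ↔ y = x := Fin.ext_iff.symm
      simp only [NatExpr.eval, cell_eval, hc, hm 12 hA12.symm (by norm_num), h12, Memory.writeNat,
        true_and, hx', Finset.mem_insert]
      by_cases hy : y = x
      · subst hy
        have h' : labels n σ A y = labels n σ A e.2 := h
        simp only [h', if_true, true_or, and_self]
        rfl
      · simp [hy, hi y]
    · rw [natEq_eval] at h
      simp only [NatExpr.eval, cell_eval, hc, hxA, hm 13 hA13.symm (by norm_num), h13] at h
      rw [hi y]
      simp only [Finset.mem_insert]
      by_cases hy : y = x
      · subst hy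
        have h' : ¬ labels n σ A y = labels n σ A e.2 := h
        simp [h']
      · simp [hy]
  · intro τ _ h
    funext x
    refine (h x).trans ?_
    simp

lemma run_copyLabels (hn : σ.nat 0 0 0 = n) :
    Run α n copyLabels σ fun τ => labels n τ 8 = labels n σ 7 := by
  refine (run_forFin (fun D τ => ∀ x ∈ D, τ.nat 8 0 x = σ.nat 7 0 x) (by norm_num)
    (by simp [Program.natMods]) (by simp [Program.natMods]) hn ?_ (by simp) ?_).mono ?_
  · intro D τ x h
    rwa [writeNat_nat_of_ne (by norm_num)]
  · intro D x _ τ hf hi hc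
    refine run_setNat fun y hy => ?_
    have h7 : τ.nat 7 = σ.nat 7 := hf.1 7 (by simp [forLoop, Program.natMods])
    simp only [NatExpr.eval, cell_eval, hc, h7, Memory.writeNat, true_and, ← Fin.ext_iff]
    by_cases hyx : y = x
    · simp [hyx]
    · simp only [hyx, if_false]
      exact hi y ((Finset.mem_insert.1 hy).resolve_left hyx)
  · exact fun τ _ h => funext fun x => h x (Finset.mem_univ x)

lemma run_initLabels (hn : σ.nat 0 0 0 = n) :
    Run α n (forLoop 24 (.setNat 7 (.lit 0) (cell 24) (cell 24))) σ fun τ =>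
      labels n τ 7 = fun x : Fin n => (x : ℕ) := by
  refine (run_forFin (fun D τ => ∀ x ∈ D, τ.nat 7 0 x = x) (by norm_num)
    (by simp [Program.natMods]) (by simp [Program.natMods]) hn ?_ (by simp) ?_).mono ?_
  · intro D τ x h
    rwa [writeNat_nat_of_ne (by norm_num)]
  · intro D x _ τ hf hi hc
    refine run_setNat fun y hy => ?_
    simp only [NatExpr.eval, cell_eval, hc, Memory.writeNat, true_and, ← Fin.ext_iff]
    by_cases hyx : y = x
    · simp [hyx]
    · simp only [hyx, if_false]
      exact hi y ((Finset.mem_insert.1 hy).resolve_left hyx)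
  · exact fun τ _ h => funext fun x => h x (Finset.mem_univ x)

lemma pair_eq_iff {u v : Fin n × Fin n} : ((u.1 : ℕ) = v.1 ∧ (u.2 : ℕ) = v.2) ↔ u = v := by
  rw [Prod.ext_iff, Fin.ext_iff, Fin.ext_iff]

lemma run_clearGreedy (hn : σ.nat 0 0 0 = n) :
    Run α n clearGreedy σ fun τ => ∀ v : Fin n × Fin n, τ.nat 6 v.1 v.2 = 0 ∧
      τ.real 3 v.1 v.2 = 0 := by
  refine (run_forPairs (fun D τ => ∀ v ∈ D, τ.nat 6 v.1 v.2 = 0 ∧ τ.real 3 v.1 v.2 = 0)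
    (by norm_num) (by norm_num) (by norm_num) (by simp [Program.natMods])
    (by simp [Program.natMods]) (by simp [Program.natMods]) hn ?_ ?_ (by simp) ?_).mono ?_
  · intro D τ x h v hv
    rw [writeNat_nat_of_ne (by norm_num)]
    exact h v hv
  · intro D τ x h v hv
    rw [writeNat_nat_of_ne (by norm_num)]
    exact h v hv
  · intro D v _ τ hf hi h22 h23
    refine run_seq (run_setNat (run_setReal fun u hu => ?_))
    have e22 : ∀ x y z, (τ.writeNat 6 x y z).nat 22 = τ.nat 22 := fun x y z =>
      writeNat_nat_of_ne (by norm_num)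
    have e23 : ∀ x y z, (τ.writeNat 6 x y z).nat 23 = τ.nat 23 := fun x y z =>
      writeNat_nat_of_ne (by norm_num)
    simp only [NatExpr.eval, RealExpr.eval, cell_eval, e22, e23, h22, h23]
    simp only [Memory.writeNat, Memory.writeReal, true_and, pair_eq_iff]
    by_cases huv : u = v
    · simp [huv]
    · simp only [huv, if_false]
      exact hi u ((Finset.mem_insert.1 hu).resolve_left huv)
  · exact fun τ _ h v => h v (Finset.mem_univ v)

end RealRAM

/-! ### Correctness of the greedy selection within a round -/

namespace RealRAM

open ConnSched

variable {α : ℝ} {n : ℕ} {σ σ₀ : Memory} {R : Rule (Fin n)} {ok : Cond} {W : RealExpr}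

/-- The link `v` passes the acceptance test. -/
def PassesTest (R : Rule (Fin n)) (σ : Memory) (v : Fin n × Fin n) : Prop :=
  R.ok v ∧ labels n σ 8 v.1 ≠ labels n σ 8 v.2 ∧ (R.K : ℝ) * σ.real 3 v.1 v.2 ≤ 1

/-- The invariant is that of a minimum search: cell 9 tells whether a candidate exists, and the
candidate is shortest among the passing links visited so far. -/
lemma run_scan (hD : Describes α σ₀ R ok W) (hσ : SameInput σ₀ σ) :
    Run α n (scan R.K ok) σ fun τ =>
      (τ.nat 9 0 0 = 0 ∧ ∀ v, ¬ PassesTest R σ v) ∨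
      (τ.nat 9 0 0 = 1 ∧ ∃ w : Fin n × Fin n, τ.nat 10 0 0 = w.1 ∧ τ.nat 11 0 0 = w.2 ∧
        PassesTest R σ w ∧ ∀ v, PassesTest R σ v → R.len w ≤ R.len v) := by
  refine run_seq (run_setNat ?_)
  simp only [NatExpr.eval]
  set σ₁ := σ.writeNat 9 0 0 0 with hσ₁
  have hsame₁ : SameInput σ₀ σ₁ := ⟨by rw [hσ₁, writeNat_nat_of_ne (by norm_num), hσ.size],
    by rw [hσ₁, writeNat_nat_of_ne (by norm_num), hσ.adj], hσ.dist, hσ.power, hσ.param⟩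
  have h8 : σ₁.nat 8 = σ.nat 8 := writeNat_nat_of_ne (by norm_num)
  refine (run_forPairs (fun D τ =>
      (τ.nat 9 0 0 = 0 ∧ ∀ v ∈ D, ¬ PassesTest R σ v) ∨
      (τ.nat 9 0 0 = 1 ∧ ∃ w : Fin n × Fin n, τ.nat 10 0 0 = w.1 ∧ τ.nat 11 0 0 = w.2 ∧
        PassesTest R σ w ∧ ∀ v ∈ D, PassesTest R σ v → R.len w ≤ R.len v))
    (by norm_num) (by norm_num) (by norm_num) (by simp [Program.natMods])
    (by simp [Program.natMods]) (by simp [Program.natMods]) (by rw [hsame₁.size, hD.size])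
    ?_ ?_ ?_ ?_).mono ?_
  · intro D τ x h
    simpa only [writeNat_nat_of_ne (show (9 : ℕ) ≠ 22 by norm_num),
      writeNat_nat_of_ne (show (10 : ℕ) ≠ 22 by norm_num),
      writeNat_nat_of_ne (show (11 : ℕ) ≠ 22 by norm_num)] using h
  · intro D τ x h
    simpa only [writeNat_nat_of_ne (show (9 : ℕ) ≠ 23 by norm_num),
      writeNat_nat_of_ne (show (10 : ℕ) ≠ 23 by norm_num),
      writeNat_nat_of_ne (show (11 : ℕ) ≠ 23 by norm_num)] using h
  · left
    simp [hσ₁, Memory.writeNat]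
  · intro D v _ τ hf hi h22 h23
    have hsame : SameInput σ₀ τ := hsame₁.of_frame hf (by simp [forPairs, forLoop, Program.natMods])
      (by simp [forPairs, forLoop, Program.natMods]) (by simp [forPairs, forLoop, Program.realMods])
      (by simp [forPairs, forLoop, Program.realMods]) (by simp [forPairs, forLoop, Program.realMods])
    have hl : τ.nat 8 = σ.nat 8 :=
      (hf.1 8 (by simp [forPairs, forLoop, Program.natMods])).trans h8
    have hs : τ.real 3 = σ.real 3 := hf.2 3 (by simp [forPairs, forLoop, Program.realMods])
    have hacc : (acceptCond R.K ok).eval α τ ↔ PassesTest R σ v := by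
      simp only [acceptCond, Cond.eval, natEq_eval, NatExpr.eval, RealExpr.eval, cell_eval, h22, h23,
        hl, hs, hD.ok τ hsame v h22 h23, PassesTest, labels, Nat.cast_one, ne_eq]
    have hlen : ∀ u : Fin n × Fin n, τ.real 0 u.1 u.2 = R.len u := fun u => by
      rw [hsame.dist]; exact hD.len u.1 u.2
    refine run_ite (fun h => run_seq (run_setNat (run_seq (run_setNat (run_setNat ?_)))))
      fun h => run_skip ?_
    · obtain ⟨h1, h2⟩ := h
      rw [hacc] at h1
      right
      refine ⟨by simp [Memory.writeNat, NatExpr.eval], v, ?_, ?_, h1, fun u hu hpu => ?_⟩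
      · simp [Memory.writeNat, NatExpr.eval, cell_eval, h22]
      · simp [Memory.writeNat, NatExpr.eval, cell_eval, h23]
      · rcases Finset.mem_insert.1 hu with rfl | hu
        · exact le_rfl
        · rcases hi with ⟨_, hi⟩ | ⟨h9, w, h10, h11, hw, hi⟩
          · exact absurd hpu (hi u hu)
          · refine le_trans ?_ (hi u hu hpu)
            simp only [Cond.eval, natEq_eval, RealExpr.eval, cell_eval, NatExpr.eval, h9,
              h10, h11, h22, h23, hlen, true_and, not_le] at h2
            exact h2.le
    · rcases hi with ⟨h9, hi⟩ | ⟨h9, w, h10, h11, hw, hi⟩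
      · refine Or.inl ⟨h9, fun u hu => ?_⟩
        rcases Finset.mem_insert.1 hu with rfl | hu
        · intro hp
          refine h ⟨hacc.2 hp, ?_⟩
          simp [Cond.eval, natEq_eval, cell_eval, NatExpr.eval, h9]
        · exact hi u hu
      · refine Or.inr ⟨h9, w, h10, h11, hw, fun u hu hpu => ?_⟩
        rcases Finset.mem_insert.1 hu with rfl | hu
        · by_contra hlt
          refine h ⟨hacc.2 hpu, ?_⟩
          simp only [Cond.eval, natEq_eval, RealExpr.eval, cell_eval, NatExpr.eval, h9,
              h10, h11, h22, h23, hlen, true_and]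
          exact hlt
        · exact hi u hu hpu
  · intro τ _ h
    simpa using h

/-- The loop adds the weight of w to every entry, including that of w. As a load excludes the link
itself, the entry of w is saved beforehand and restored afterwards. -/
lemma run_addLink (hD : Describes α σ₀ R ok W) (hσ : SameInput σ₀ σ) {w : Fin n × Fin n}
    (h10 : σ.nat 10 0 0 = w.1) (h11 : σ.nat 11 0 0 = w.2) :
    Run α n (addLink W) σ fun τ =>
      (∀ v : Fin n × Fin n, τ.real 3 v.1 v.2 =
        if v = w then σ.real 3 v.1 v.2 else σ.real 3 v.1 v.2 + R.W w v) ∧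
      (∀ v : Fin n × Fin n, τ.nat 6 v.1 v.2 = if v = w then 1 else σ.nat 6 v.1 v.2) ∧
      labels n τ 8 = fun x => if labels n σ 8 x = labels n σ 8 w.2 then labels n σ 8 w.1
        else labels n σ 8 x := by
  refine run_seq (run_setReal (run_seq ?_))
  simp only [NatExpr.eval, RealExpr.eval, cell_eval, h10, h11]
  set σ₁ := σ.writeReal 4 0 0 (σ.real 3 w.1 w.2) with hσ₁
  have hsame₁ : SameInput σ₀ σ₁ := ⟨hσ.size, hσ.adj,
    by rw [hσ₁, writeReal_real_of_ne (by norm_num), hσ.dist],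
    by rw [hσ₁, writeReal_real_of_ne (by norm_num), hσ.power],
    by rw [hσ₁, writeReal_real_of_ne (by norm_num), hσ.param]⟩
  have h3 : σ₁.real 3 = σ.real 3 := writeReal_real_of_ne (by norm_num)
  have h4 : σ₁.real 4 0 0 = σ.real 3 w.1 w.2 := by simp [hσ₁, Memory.writeReal]
  refine (run_forPairs (fun D τ => ∀ v : Fin n × Fin n, τ.real 3 v.1 v.2 =
      if v ∈ D then σ.real 3 v.1 v.2 + R.W w v else σ.real 3 v.1 v.2)
    (by norm_num) (by norm_num) (by norm_num) (by simp [Program.natMods])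
    (by simp [Program.natMods]) (by simp [Program.natMods]) (by rw [hsame₁.size, hD.size])
    (fun _ _ _ h => h) (fun _ _ _ h => h) (by simp [h3]) ?_).mono ?_
  · intro D v hv τ hf hi h22 h23
    have hsame : SameInput σ₀ τ := hsame₁.of_frame hf (by simp [forPairs, forLoop, Program.natMods])
      (by simp [forPairs, forLoop, Program.natMods]) (by simp [forPairs, forLoop, Program.realMods])
      (by simp [forPairs, forLoop, Program.realMods]) (by simp [forPairs, forLoop, Program.realMods])
    have h10' : τ.nat 10 0 0 = w.1 := by
      rw [hf.1 10 (by simp [forPairs, forLoop, Program.natMods])]; exact h10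
    have h11' : τ.nat 11 0 0 = w.2 := by
      rw [hf.1 11 (by simp [forPairs, forLoop, Program.natMods])]; exact h11
    refine run_setReal fun u => ?_
    simp only [RealExpr.eval, cell_eval, h22, h23,
      hD.W τ hsame w v h10' h11' h22 h23, hi v, hv, if_false]
    simp only [Memory.writeReal, true_and, pair_eq_iff, Finset.mem_insert]
    by_cases huv : u = v
    · simp [huv]
    · simp [huv, hi u]
  · intro τ hf h
    have hn : ∀ A, A ≠ 22 → A ≠ 23 → τ.nat A = σ.nat A := fun A h1 h2 =>
      hf.1 A (by simp [forPairs, forLoop, Program.natMods, h1, h2])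
    have h4' : τ.real 4 0 0 = σ.real 3 w.1 w.2 := by
      rw [hf.2 4 (by simp [forPairs, forLoop, Program.realMods]), h4]
    have h10' : τ.nat 10 0 0 = w.1 := by rw [hn 10 (by norm_num) (by norm_num), h10]
    have h11' : τ.nat 11 0 0 = w.2 := by rw [hn 11 (by norm_num) (by norm_num), h11]
    refine run_seq (run_setReal (run_seq (run_setNat ?_)))
    simp only [NatExpr.eval, RealExpr.eval, cell_eval, h4']
    simp only [show ∀ A i j a, (τ.writeReal A i j a).nat = τ.nat from fun _ _ _ _ => rfl, h10', h11']
    set υ := (τ.writeReal 3 w.1 w.2 (σ.real 3 w.1 w.2)).writeNat 6 w.1 w.2 1 with hυ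
    have hυn : ∀ A, A ≠ 6 → A ≠ 22 → A ≠ 23 → υ.nat A = σ.nat A := fun A h1 h2 h3 =>
      (writeNat_nat_of_ne h1).trans (hn A h2 h3)
    have hlab : labels n υ 8 = labels n σ 8 := by
      funext x; simp only [labels, hυn 8 (by norm_num) (by norm_num) (by norm_num)]
    refine (run_mergeProg (Or.inr rfl) (e := w)
      (by rw [hυn 0 (by norm_num) (by norm_num) (by norm_num), hσ.size, hD.size])
      (by rw [cell_eval, hυn 10 (by norm_num) (by norm_num) (by norm_num), h10])
      (fun x => by rw [cell_eval, writeNat_nat_of_ne (by norm_num),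
        hυn 11 (by norm_num) (by norm_num) (by norm_num), h11])).mono fun ω hf' hω => ?_
    rw [hlab] at hω
    refine ⟨fun v => ?_, fun v => ?_, hω⟩
    · rw [hf'.2 3 (by simp [mergeProg, forLoop, Program.realMods])]
      have hυ3 : υ.real 3 v.1 v.2 = if v = w then σ.real 3 w.1 w.2 else τ.real 3 v.1 v.2 := by
        simp only [hυ, Memory.writeNat, Memory.writeReal, true_and, pair_eq_iff]
      rw [hυ3, h v]
      by_cases hvw : v = w
      · simp [hvw]
      · simp [hvw]
    · rw [hf'.1 6 (by simp [mergeProg, forLoop, Program.natMods])]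
      simp only [hυ, Memory.writeNat, Memory.writeReal, true_and, pair_eq_iff,
        hn 6 (by norm_num) (by norm_num)]

/-- The memory describes the greedy set `G` over the tree links `F`. -/
structure HoldsGreedy (σ₀ : Memory) (R : Rule (Fin n)) (F G : Finset (Fin n × Fin n))
    (σ : Memory) : Prop where
  same : SameInput σ₀ σ
  label : IsLabel (F ∪ G) (labels n σ 8)
  load : ∀ v : Fin n × Fin n, σ.real 3 v.1 v.2 = R.load G v
  mark : ∀ v : Fin n × Fin n, σ.nat 6 v.1 v.2 = 1 ↔ v ∈ G

lemma load_insert {G : Finset (Fin n × Fin n)} {w : Fin n × Fin n} (hw : w ∉ G)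
    (v : Fin n × Fin n) :
    R.load (insert w G) v = if v = w then R.load G v else R.load G v + R.W w v := by
  by_cases h : v = w
  · subst h
    simp [Rule.load, Finset.erase_insert hw, Finset.erase_eq_of_notMem hw]
  · simp only [h, if_false]
    rw [Rule.load, Finset.erase_insert_of_ne (Ne.symm h),
      Finset.sum_insert fun h' => hw (Finset.mem_of_mem_erase h'), Rule.load, add_comm]

lemma HoldsGreedy.passesTest_iff {F G : Finset (Fin n × Fin n)} (h : HoldsGreedy σ₀ R F G σ)
    (v : Fin n × Fin n) : PassesTest R σ v ↔ R.Acceptable F G v := by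
  rw [PassesTest, Rule.Acceptable, h.load v, ne_eq, h.label]

/-- Every addition merges two components and there are at most n of them, so fewer than n additions
are possible and n iterations reach a set that cannot be extended. -/
lemma run_growGreedy (hD : Describes α σ₀ R ok W) {F : Finset (Fin n × Fin n)}
    (hσ : HoldsGreedy σ₀ R F ∅ σ) :
    Run α n (growGreedy R.K ok W) σ fun τ => ∃ G, R.Greedy F G ∧ (∀ v, ¬ R.Acceptable F G v) ∧
      HoldsGreedy σ₀ R F G τ := by
  refine (run_forLoop (fun k τ => ∃ G, R.Greedy F G ∧ HoldsGreedy σ₀ R F G τ ∧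
      ((∀ v, ¬ R.Acceptable F G v) ∨ k ≤ G.card))
    (by norm_num) (by simp [scan, addLink, mergeProg, forPairs, forLoop, Program.natMods])
    (by simp [scan, addLink, mergeProg, forPairs, forLoop, Program.natMods])
    (by rw [hσ.same.size, hD.size]) ?_ ⟨∅, .empty, hσ, Or.inr (Nat.zero_le _)⟩ ?_).mono ?_
  · rintro k τ x ⟨G, hG, hτ, h⟩
    refine ⟨G, hG, ⟨?_, ?_, hτ.load, ?_⟩, h⟩
    · exact ⟨by rw [writeNat_nat_of_ne (by norm_num), hτ.same.size],
        by rw [writeNat_nat_of_ne (by norm_num), hτ.same.adj], hτ.same.dist, hτ.same.power,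
        hτ.same.param⟩
    · have : labels n (τ.writeNat 21 0 0 x) 8 = labels n τ 8 := by
        funext y; simp only [labels]; rw [writeNat_nat_of_ne (by norm_num)]
      rw [this]; exact hτ.label
    · intro v; rw [writeNat_nat_of_ne (by norm_num)]; exact hτ.mark v
  · rintro k _ τ _ ⟨G, hG, hτ, hk⟩ _
    refine run_seq ((run_scan hD hτ.same).mono fun υ hf hυ => ?_)
    have hnat : ∀ A, A ≠ 9 → A ≠ 10 → A ≠ 11 → A ≠ 22 → A ≠ 23 → υ.nat A = τ.nat A :=
      fun A h1 h2 h3 h4 h5 => hf.1 A (by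
        simp [scan, forPairs, forLoop, Program.natMods, h1, h2, h3, h4, h5])
    have hreal : υ.real = τ.real := funext fun A => hf.2 A (by
      simp [scan, forPairs, forLoop, Program.realMods])
    have hlab : labels n υ 8 = labels n τ 8 := by
      funext x
      simp only [labels, hnat 8 (by norm_num) (by norm_num) (by norm_num) (by norm_num) (by norm_num)]
    have h6 : υ.nat 6 = τ.nat 6 :=
      hnat 6 (by norm_num) (by norm_num) (by norm_num) (by norm_num) (by norm_num)
    have hsame : SameInput σ₀ υ :=
      ⟨by rw [hnat 0 (by norm_num) (by norm_num) (by norm_num) (by norm_num) (by norm_num),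
          hτ.same.size],
        by rw [hnat 1 (by norm_num) (by norm_num) (by norm_num) (by norm_num) (by norm_num),
          hτ.same.adj], by rw [hreal, hτ.same.dist], by rw [hreal, hτ.same.power],
        by rw [hreal, hτ.same.param]⟩
    have hυG : HoldsGreedy σ₀ R F G υ := ⟨hsame, by rw [hlab]; exact hτ.label,
      fun v => by rw [hreal]; exact hτ.load v, fun v => by rw [h6]; exact hτ.mark v⟩
    refine run_ite (fun h => ?_) fun h => run_skip ?_
    · rw [natEq_eval] at h
      simp only [cell_eval, NatExpr.eval] at h
      rcases hυ with ⟨h9, _⟩ | ⟨_, w, h10, h11, hw, hmin⟩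
      · rw [h9] at h; norm_num at h
      rw [hτ.passesTest_iff] at hw
      have hmin' : ∀ v, R.Acceptable F G v → R.len w ≤ R.len v := fun v hv =>
        hmin v ((hτ.passesTest_iff v).2 hv)
      have hwG := hw.notMem
      refine (run_addLink hD hsame h10 h11).mono fun ω hfω ⟨hω3, hω6, hω8⟩ => ?_
      refine ⟨insert w G, hG.step hw hmin', ⟨?_, ?_, fun v => ?_, fun v => ?_⟩, ?_⟩
      · exact hsame.of_frame hfω (by simp [addLink, mergeProg, forPairs, forLoop, Program.natMods])
          (by simp [addLink, mergeProg, forPairs, forLoop, Program.natMods])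
          (by simp [addLink, mergeProg, forPairs, forLoop, Program.realMods])
          (by simp [addLink, mergeProg, forPairs, forLoop, Program.realMods])
          (by simp [addLink, mergeProg, forPairs, forLoop, Program.realMods])
      · rw [hω8, Finset.union_insert]
        exact hυG.label.insert w
      · rw [hω3 v, load_insert hwG, hυG.load v]
      · rw [hω6 v, Finset.mem_insert]
        by_cases hvw : v = w
        · simp [hvw]
        · simp [hvw, hυG.mark v]
      · right
        rw [Finset.card_insert_of_notMem hwG]
        rcases hk with hk | hk
        · exact absurd hw (hk w)
        · omega
    · rw [natEq_eval] at h
      simp only [cell_eval, NatExpr.eval] at h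
      rcases hυ with ⟨_, hnone⟩ | ⟨h9, _⟩
      · exact ⟨G, hG, hυG, Or.inl fun v hv => hnone v ((hτ.passesTest_iff v).2 hv)⟩
      · exact absurd h9 h
  · rintro τ _ ⟨G, hG, hτ, h⟩
    refine ⟨G, hG, h.elim id fun hle v => ?_, hτ⟩
    have : Nonempty (Fin n) := ⟨v.1⟩
    have h1 := hG.indep
    have h2 := one_le_numComp (F ∪ G)
    have h3 : numComp F ≤ numComp ∅ := numComp_le_of_forall (by simp)
    rw [numComp_empty, Fintype.card_fin] at h3
    omega

end RealRAM

/-! ### Correctness of committing links, of a round and of the whole program -/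

namespace RealRAM

open ConnSched

variable {α : ℝ} {n : ℕ} {σ σ₀ : Memory} {R : Rule (Fin n)} {ok : Cond} {W : RealExpr}

/-- The memory `τ` arises from `σ` by adding the links `Y` to the tree links `F` in round `r`. -/
structure Committed (r : ℕ) (F Y : Finset (Fin n × Fin n)) (σ τ : Memory) : Prop where
  label : IsLabel (F ∪ Y) (labels n τ 7)
  tree : ∀ v : Fin n × Fin n,
    τ.nat 2 v.1 v.2 = 1 ↔ σ.nat 2 v.1 v.2 = 1 ∨ v ∈ Y ∨ v.swap ∈ Y
  color : ∀ v : Fin n × Fin n,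
    τ.nat 3 v.1 v.2 = if v ∈ Y ∨ v.swap ∈ Y then r else σ.nat 3 v.1 v.2
  links : ∀ v : Fin n × Fin n, τ.nat 4 v.1 v.2 = 1 ↔ σ.nat 4 v.1 v.2 = 1 ∨ v ∈ Y
  count : τ.nat 5 0 0 = if Y.Nonempty then r + 1 else σ.nat 5 0 0

lemma Committed.congr {r : ℕ} {F Y : Finset (Fin n × Fin n)} {σ τ τ' : Memory}
    (h : Committed r F Y σ τ) (h2 : τ'.nat 2 = τ.nat 2) (h3 : τ'.nat 3 = τ.nat 3)
    (h4 : τ'.nat 4 = τ.nat 4) (h5 : τ'.nat 5 = τ.nat 5) (h7 : τ'.nat 7 = τ.nat 7) :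
    Committed r F Y σ τ' := by
  have hl : labels n τ' 7 = labels n τ 7 := by funext x; simp only [labels, h7]
  exact ⟨hl ▸ h.label, fun v => h2 ▸ h.tree v, fun v => h3 ▸ h.color v, fun v => h4 ▸ h.links v,
    h5 ▸ h.count⟩

lemma run_commitLink {r : ℕ} {F Y : Finset (Fin n × Fin n)} {τ : Memory} {v : Fin n × Fin n}
    (hn : τ.nat 0 0 0 = n) (hr : τ.nat 20 0 0 = r) (h : Committed r F Y σ τ)
    (h22 : τ.nat 22 0 0 = v.1) (h23 : τ.nat 23 0 0 = v.2) :
    Run α n commitLink τ (Committed r F (insert v Y) σ) := by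
  refine run_seq (run_setNat (run_seq (run_setNat (run_seq (run_setNat (run_seq (run_setNat
    (run_seq (run_setNat (run_seq (run_setNat ?_)))))))))))
  have ha : ∀ (υ : Memory) (A i j a : ℕ), (υ.writeNat A i j a).nat =
      fun A' i' j' => if A' = A ∧ i' = i ∧ j' = j then a else υ.nat A' i' j' := fun _ _ _ _ _ => rfl
  simp only [NatExpr.eval, cell_eval, ha, Nat.reduceEqDiff, false_and, if_false,
    h22, h23, hr]
  set υ : Memory := (((((τ.writeNat 2 v.1 v.2 1).writeNat 2 v.2 v.1 1).writeNat 3 v.1 v.2 r).writeNat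
    3 v.2 v.1 r).writeNat 4 v.1 v.2 1).writeNat 5 0 0 (r + 1) with hυ
  have hother : ∀ A, A ≠ 2 → A ≠ 3 → A ≠ 4 → A ≠ 5 → υ.nat A = τ.nat A := by
    intro A h2 h3 h4 h5
    rw [hυ, writeNat_nat_of_ne h5, writeNat_nat_of_ne h4, writeNat_nat_of_ne h3,
      writeNat_nat_of_ne h3, writeNat_nat_of_ne h2, writeNat_nat_of_ne h2]
  have hlab : labels n υ 7 = labels n τ 7 := by
    funext x
    simp only [labels, hother 7 (by norm_num) (by norm_num) (by norm_num) (by norm_num)]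
  have hswap : ∀ u : Fin n × Fin n, ((u.1 : ℕ) = v.2 ∧ (u.2 : ℕ) = v.1) ↔ u.swap = v := by
    intro u
    rw [← pair_eq_iff]
    simp only [Prod.fst_swap, Prod.snd_swap]
    tauto
  refine (run_mergeProg (Or.inl rfl) (e := v)
    (by rw [hother 0 (by norm_num) (by norm_num) (by norm_num) (by norm_num), hn])
    (by rw [cell_eval, hother 22 (by norm_num) (by norm_num) (by norm_num) (by norm_num), h22])
    (fun x => by rw [cell_eval, writeNat_nat_of_ne (by norm_num),
      hother 23 (by norm_num) (by norm_num) (by norm_num) (by norm_num), h23])).mono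
    fun ω hf hω => ?_
  have hωA : ∀ A, A ≠ 7 → A ≠ 12 → A ≠ 13 → A ≠ 24 → ω.nat A = υ.nat A := fun A h1 h2 h3 h4 =>
    hf.1 A (by simp [mergeProg, forLoop, Program.natMods, h1, h2, h3, h4])
  rw [hlab] at hω
  constructor
  · rw [hω, Finset.union_insert]
    exact h.label.insert v
  · intro u
    have h1 : ω.nat 2 u.1 u.2 = if u.swap = v then 1 else if u = v then 1 else τ.nat 2 u.1 u.2 := by
      rw [hωA 2 (by norm_num) (by norm_num) (by norm_num) (by norm_num)]
      simp [hυ, Memory.writeNat, pair_eq_iff, hswap]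
    rw [h1]
    simp only [Finset.mem_insert]
    by_cases hu : u.swap = v
    · simp [hu]
    · by_cases hu' : u = v
      · simp [hu']
      · simp [hu, hu', h.tree u]
  · intro u
    have h1 : ω.nat 3 u.1 u.2 = if u.swap = v then r else if u = v then r else τ.nat 3 u.1 u.2 := by
      rw [hωA 3 (by norm_num) (by norm_num) (by norm_num) (by norm_num)]
      simp [hυ, Memory.writeNat, pair_eq_iff, hswap]
    rw [h1]
    simp only [Finset.mem_insert]
    by_cases hu : u.swap = v
    · simp [hu]
    · by_cases hu' : u = v
      · simp [hu']
      · simp [hu, hu', h.color u]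
  · intro u
    have h1 : ω.nat 4 u.1 u.2 = if u = v then 1 else τ.nat 4 u.1 u.2 := by
      rw [hωA 4 (by norm_num) (by norm_num) (by norm_num) (by norm_num)]
      simp [hυ, Memory.writeNat, pair_eq_iff]
    rw [h1]
    simp only [Finset.mem_insert]
    by_cases hu' : u = v
    · simp [hu']
    · simp [hu', h.links u]
  · rw [hωA 5 (by norm_num) (by norm_num) (by norm_num) (by norm_num)]
    simp [hυ, Memory.writeNat]

/-- Marks and loads stay untouched during this loop, so each test refers to the complete greedy set
and not to the links committed so far. -/
lemma run_commit {r : ℕ} {F G : Finset (Fin n × Fin n)} (hn : σ.nat 0 0 0 = n)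
    (hr : σ.nat 20 0 0 = r) (hl : IsLabel F (labels n σ 7)) (hG : HoldsGreedy σ₀ R F G σ) :
    Run α n (commit R.K) σ (Committed r F (R.light G) σ) := by
  classical
  refine (run_forPairs (fun D => Committed r F (R.light G ∩ D) σ)
    (by norm_num) (by norm_num) (by norm_num)
    (by simp [commitLink, mergeProg, forLoop, Program.natMods])
    (by simp [commitLink, mergeProg, forLoop, Program.natMods])
    (by simp [commitLink, mergeProg, forLoop, Program.natMods]) hn ?_ ?_ ?_ ?_).mono ?_
  · intro D τ x h
    exact h.congr (writeNat_nat_of_ne (by norm_num)) (writeNat_nat_of_ne (by norm_num))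
      (writeNat_nat_of_ne (by norm_num)) (writeNat_nat_of_ne (by norm_num))
      (writeNat_nat_of_ne (by norm_num))
  · intro D τ x h
    exact h.congr (writeNat_nat_of_ne (by norm_num)) (writeNat_nat_of_ne (by norm_num))
      (writeNat_nat_of_ne (by norm_num)) (writeNat_nat_of_ne (by norm_num))
      (writeNat_nat_of_ne (by norm_num))
  · rw [Finset.inter_empty]
    exact ⟨by simpa using hl, by simp, by simp, by simp, by simp⟩
  · intro D v _ τ hf hi h22 h23
    have hnat : ∀ A, A ≠ 2 → A ≠ 3 → A ≠ 4 → A ≠ 5 → A ≠ 7 → A ≠ 12 → A ≠ 13 → A ≠ 24 → A ≠ 22 →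
        A ≠ 23 → τ.nat A = σ.nat A := fun A h1 h2 h3 h4 h5 h6 h7 h8 h9 h10 => hf.1 A (by
      simp [commitLink, mergeProg, forPairs, forLoop, Program.natMods, h1, h2, h3, h4, h5, h6, h7,
        h8, h9, h10])
    have h6 : τ.nat 6 = σ.nat 6 := by apply hnat <;> norm_num
    have h3 : τ.real 3 = σ.real 3 := hf.2 3 (by
      simp [commitLink, mergeProg, forPairs, forLoop, Program.realMods])
    have hcond : (Cond.conj (natEq (.get 6 (cell 22) (cell 23)) (.lit 1))
        (.realLe (.mul (.lit R.K) (.get 3 (cell 22) (cell 23))) (.lit 4))).eval α τ ↔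
          v ∈ R.light G := by
      simp only [Cond.eval, natEq_eval, NatExpr.eval, RealExpr.eval, cell_eval, h22, h23, h6, h3,
        hG.mark v, hG.load v, Rule.light, Finset.mem_filter, Nat.cast_ofNat]
    refine run_ite (fun h => ?_) fun h => run_skip ?_
    · rw [Finset.inter_insert_of_mem (hcond.1 h)]
      refine run_commitLink ?_ ?_ hi h22 h23
      · rw [hnat 0] <;> first | exact hn | norm_num
      · rw [hnat 20] <;> first | exact hr | norm_num
    · rwa [Finset.inter_insert_of_notMem fun h' => h (hcond.2 h')]
  · intro τ _ h
    simpa using h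

/-- The memory describes the results `Xs` of the first `r` rounds. -/
structure HoldsTrace (σ₀ : Memory) (R : Rule (Fin n)) (Xs : ℕ → Finset (Fin n × Fin n)) (r : ℕ)
    (σ : Memory) : Prop where
  same : SameInput σ₀ σ
  trace : R.IsTrace Xs r
  label : IsLabel (Rule.acc Xs r) (labels n σ 7)
  tree : ∀ v : Fin n × Fin n,
    σ.nat 2 v.1 v.2 = 1 ↔ v ∈ Rule.acc Xs r ∨ v.swap ∈ Rule.acc Xs r
  color : ∀ q < r, ∀ v ∈ Xs q, σ.nat 3 v.1 v.2 = q
  color_symm : ∀ u v : Fin n, σ.nat 3 u v = σ.nat 3 v u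
  links : ∀ v : Fin n × Fin n, σ.nat 4 v.1 v.2 = 1 ↔ v ∈ Rule.acc Xs r
  count_le : σ.nat 5 0 0 ≤ r
  count_last : σ.nat 5 0 0 ≠ 0 → (Xs (σ.nat 5 0 0 - 1)).Nonempty
  empty_of_count_le : ∀ q < r, σ.nat 5 0 0 ≤ q → Xs q = ∅

lemma acc_congr {V : Type*} [DecidableEq V] {Xs Ys : ℕ → Finset (V × V)} {r : ℕ}
    (h : ∀ q < r, Xs q = Ys q) : Rule.acc Xs r = Rule.acc Ys r :=
  Finset.biUnion_congr rfl fun q hq => h q (Finset.mem_range.1 hq)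

lemma run_roundProg (hD : Describes α σ₀ R ok W) {Xs : ℕ → Finset (Fin n × Fin n)} {r : ℕ}
    (hσ : HoldsTrace σ₀ R Xs r σ) (hr : σ.nat 20 0 0 = r) :
    Run α n (roundProg R.K ok W) σ fun τ => ∃ Xs, HoldsTrace σ₀ R Xs (r + 1) τ := by
  classical
  have hn : σ.nat 0 0 0 = n := by rw [hσ.same.size, hD.size]
  refine run_seq ((run_copyLabels hn).mono fun σ₁ hf₁ hl₁ => ?_)
  have hn₁ : ∀ A, A ≠ 8 → A ≠ 24 → σ₁.nat A = σ.nat A := fun A h1 h2 => hf₁.1 A (by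
    simp [copyLabels, forLoop, Program.natMods, h1, h2])
  refine run_seq ((run_clearGreedy (by rw [hn₁ 0 (by norm_num) (by norm_num), hn])).mono
    fun σ₂ hf₂ h₂ => ?_)
  have hn₂ : ∀ A, A ≠ 6 → A ≠ 8 → A ≠ 22 → A ≠ 23 → A ≠ 24 → σ₂.nat A = σ.nat A :=
    fun A h1 h2 h3 h4 h5 => (hf₂.1 A (by
      simp [clearGreedy, forPairs, forLoop, Program.natMods, h1, h3, h4])).trans (hn₁ A h2 h5)
  have hr₂ : ∀ A, A ≠ 3 → σ₂.real A = σ.real A := fun A h => (hf₂.2 A (by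
    simp [clearGreedy, forPairs, forLoop, Program.realMods, h])).trans (hf₁.2 A (by
      simp [copyLabels, forLoop, Program.realMods]))
  have hl₂ : labels n σ₂ 8 = labels n σ 7 := by
    rw [← hl₁]
    funext x
    simp only [labels]
    rw [hf₂.1 8 (by simp [clearGreedy, forPairs, forLoop, Program.natMods])]
  have hsame₂ : SameInput σ₀ σ₂ := by
    refine ⟨?_, ?_, ?_, ?_, ?_⟩
    · rw [← hσ.same.size]; apply hn₂ <;> norm_num
    · rw [← hσ.same.adj]; apply hn₂ <;> norm_num
    · rw [hr₂ 0 (by norm_num), hσ.same.dist]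
    · rw [hr₂ 1 (by norm_num), hσ.same.power]
    · rw [hr₂ 2 (by norm_num), hσ.same.param]
  have hG₂ : HoldsGreedy σ₀ R (Rule.acc Xs r) ∅ σ₂ :=
    ⟨hsame₂, by rw [hl₂, Finset.union_empty]; exact hσ.label,
      fun v => by rw [(h₂ v).2]; simp [Rule.load], fun v => by simp [(h₂ v).1]⟩
  refine run_seq ((run_growGreedy hD hG₂).mono fun σ₃ hf₃ ⟨G, hG, hmax, hG₃⟩ => ?_)
  have hn₃ : ∀ A ∈ ({2, 3, 4, 5, 7, 20} : Finset ℕ), σ₃.nat A = σ.nat A := by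
    intro A hA
    have h1 : A ∉ (growGreedy R.K ok W).natMods := by
      simp only [growGreedy, scan, addLink, mergeProg, forPairs, forLoop, Program.natMods]
      fin_cases hA <;> simp
    rw [hf₃.1 A h1]
    fin_cases hA <;> (apply hn₂ <;> norm_num)
  have hl₃ : labels n σ₃ 7 = labels n σ 7 := by
    funext x; simp only [labels, hn₃ 7 (by simp)]
  refine (run_commit (r := r) (by rw [hG₃.same.size, hD.size])
    (by rw [hn₃ 20 (by simp), hr]) (by rw [hl₃]; exact hσ.label) hG₃).mono fun τ hf h => ?_
  set X := R.light G with hX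
  have hXG : X ⊆ G := Finset.filter_subset _ _
  set Ys := Function.update Xs r X with hYs
  have hYr : Ys r = X := Function.update_self _ _ _
  have hYq : ∀ q < r, Ys q = Xs q := fun q hq => Function.update_of_ne hq.ne _ _
  have hacc : ∀ q ≤ r, Rule.acc Ys q = Rule.acc Xs q := fun q hq =>
    acc_congr fun p hp => hYq p (hp.trans_le hq)
  have haccr : Rule.acc Ys (r + 1) = Rule.acc Xs r ∪ X := by
    rw [Rule.acc_succ, hacc r le_rfl, hYr]
  -- New links join different components of the old ones, so no old link, nor its reverse, is
  -- recolored.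
  have hnew : ∀ v ∈ Rule.acc Xs r, v ∉ X ∧ v.swap ∉ X := by
    intro v hv
    have hj : Joined (Rule.acc Xs r) v.1 v.2 := joined_of_mem hv
    exact ⟨fun hx => hG.not_joined v (hXG hx) hj,
      fun hx => hG.not_joined v.swap (hXG hx) hj.symm⟩
  refine ⟨Ys, ?_, ?_, ?_, ?_, ?_, ?_, ?_, ?_, ?_, ?_⟩
  · exact hG₃.same.of_frame hf
      (by simp [commit, commitLink, mergeProg, forPairs, forLoop, Program.natMods])
      (by simp [commit, commitLink, mergeProg, forPairs, forLoop, Program.natMods])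
      (by simp [commit, commitLink, mergeProg, forPairs, forLoop, Program.realMods])
      (by simp [commit, commitLink, mergeProg, forPairs, forLoop, Program.realMods])
      (by simp [commit, commitLink, mergeProg, forPairs, forLoop, Program.realMods])
  · intro q hq
    rcases Nat.lt_succ_iff_lt_or_eq.1 hq with hq | rfl
    · rw [hacc q hq.le, hYq q hq]
      exact hσ.trace q hq
    · rw [hacc q le_rfl, hYr]
      exact ⟨G, hG, hmax, rfl⟩
  · rw [haccr]; exact h.label
  · intro v
    rw [h.tree v, hn₃ 2 (by simp), hσ.tree v, haccr, Finset.mem_union, Finset.mem_union]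
    tauto
  · intro q hq v hv
    rw [h.color v]
    rcases Nat.lt_succ_iff_lt_or_eq.1 hq with hq | rfl
    · rw [hYq q hq] at hv
      have hv' := hnew v (Finset.mem_biUnion.2 ⟨q, Finset.mem_range.2 hq, hv⟩)
      simp only [hv'.1, hv'.2, or_self, if_false]
      rw [hn₃ 3 (by simp)]
      exact hσ.color q hq v hv
    · rw [hYr] at hv
      simp [hv]
  · intro u v
    have h1 := h.color (u, v)
    have h2 := h.color (v, u)
    simp only [Prod.swap_prod_mk, hn₃ 3 (by simp : (3 : ℕ) ∈ _)] at h1 h2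
    rw [h1, h2, hσ.color_symm u v]
    simp only [or_comm]
  · intro v
    rw [h.links v, hn₃ 4 (by simp), hσ.links v, haccr, Finset.mem_union]
  · rw [h.count, hn₃ 5 (by simp)]
    have := hσ.count_le
    split_ifs <;> omega
  · rw [h.count, hn₃ 5 (by simp)]
    split_ifs with hne
    · intro _
      simpa [hYr] using hne
    · intro h0
      have := hσ.count_le
      rw [hYq _ (by omega)]
      exact hσ.count_last h0
  · intro q hq
    rw [h.count, hn₃ 5 (by simp)]
    split_ifs with hne
    · intro h'; omega
    · intro h'
      rcases Nat.lt_succ_iff_lt_or_eq.1 hq with hq | rfl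
      · rw [hYq q hq]; exact hσ.empty_of_count_le q hq h'
      · rw [hYr]; exact Finset.not_nonempty_iff_eq_empty.1 hne

lemma HoldsTrace.writeNat {Xs : ℕ → Finset (Fin n × Fin n)} {r A i j a : ℕ}
    (h : HoldsTrace σ₀ R Xs r σ) (hA : A ∉ ({0, 1, 2, 3, 4, 5, 7} : Finset ℕ)) :
    HoldsTrace σ₀ R Xs r (σ.writeNat A i j a) := by
  have hne : ∀ B ∈ ({0, 1, 2, 3, 4, 5, 7} : Finset ℕ), (σ.writeNat A i j a).nat B = σ.nat B :=
    fun B hB => writeNat_nat_of_ne fun h' => hA (h' ▸ hB)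
  have hl : labels n (σ.writeNat A i j a) 7 = labels n σ 7 := by
    funext x; simp only [labels, hne 7 (by simp)]
  refine ⟨⟨?_, ?_, h.same.dist, h.same.power, h.same.param⟩, h.trace, ?_, ?_, ?_, ?_, ?_, ?_, ?_, ?_⟩
  · rw [hne 0 (by simp)]; exact h.same.size
  · rw [hne 1 (by simp)]; exact h.same.adj
  · rw [hl]; exact h.label
  · rw [hne 2 (by simp)]; exact h.tree
  · rw [hne 3 (by simp)]; exact h.color
  · rw [hne 3 (by simp)]; exact h.color_symm
  · rw [hne 4 (by simp)]; exact h.links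
  · rw [hne 5 (by simp)]; exact h.count_le
  · rw [hne 5 (by simp)]; exact h.count_last
  · rw [hne 5 (by simp)]; exact h.empty_of_count_le

/-- Exactly n rounds are run, whether or not a spanning tree exists. Cell 5 records the last round
that committed something, plus one, so trailing empty rounds cost no colors. -/
lemma run_mainProg (hD : Describes α σ₀ R ok W) (h2 : σ₀.nat 2 = 0) (h3 : σ₀.nat 3 = 0)
    (h4 : σ₀.nat 4 = 0) (h5 : σ₀.nat 5 = 0) :
    Run α n (mainProg R.K ok W) σ₀ fun τ => ∃ Xs, HoldsTrace σ₀ R Xs n τ := by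
  refine run_seq ((run_initLabels hD.size).mono fun σ₁ hf₁ hl₁ => ?_)
  have hn₁ : ∀ A, A ≠ 7 → A ≠ 24 → σ₁.nat A = σ₀.nat A := fun A h1 h2 => hf₁.1 A (by
    simp [forLoop, Program.natMods, h1, h2])
  have hr₁ : ∀ A, σ₁.real A = σ₀.real A := fun A => hf₁.2 A (by
    simp [forLoop, Program.realMods])
  refine run_forLoop (fun k τ => ∃ Xs, HoldsTrace σ₀ R Xs k τ) (by norm_num)
    (by simp [roundProg, copyLabels, clearGreedy, growGreedy, commit, commitLink, scan, addLink,
      mergeProg, forPairs, forLoop, Program.natMods])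
    (by simp [roundProg, copyLabels, clearGreedy, growGreedy, commit, commitLink, scan, addLink,
      mergeProg, forPairs, forLoop, Program.natMods])
    (by rw [hn₁ 0 (by norm_num) (by norm_num), hD.size]) ?_ ?_ ?_
  · rintro k τ x ⟨Xs, h⟩
    exact ⟨Xs, h.writeNat (by simp)⟩
  · refine ⟨fun _ => ∅, ⟨hn₁ 0 (by norm_num) (by norm_num), hn₁ 1 (by norm_num) (by norm_num),
      hr₁ 0, hr₁ 1, hr₁ 2⟩, fun q hq => absurd hq (Nat.not_lt_zero q), ?_, ?_, ?_, ?_, ?_, ?_, ?_, ?_⟩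
    · intro x y
      rw [hl₁]
      simp [Rule.acc, joined_empty, Fin.ext_iff]
    · simp [hn₁ 2, h2, Rule.acc]
    · exact fun q hq => absurd hq (Nat.not_lt_zero q)
    · simp [hn₁ 3, h3]
    · simp [hn₁ 4, h4, Rule.acc]
    · simp [hn₁ 5, h5]
    · simp [hn₁ 5, h5]
    · exact fun q hq => absurd hq (Nat.not_lt_zero q)
  · rintro k _ τ _ ⟨Xs, h⟩ hk
    exact run_roundProg hD h hk

end RealRAM

/-! ### The rules as programs -/

namespace RealRAM

open ConnSched SINR

/-- The SINR threshold. -/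
def thresholdExpr : RealExpr := .get 2 (.lit 0) (.lit 0)

/-- The noise. -/
def noiseExpr : RealExpr := .get 2 (.lit 0) (.lit 1)

/-- The attenuation between two nodes. -/
def attExpr (i j : NatExpr) : RealExpr := .pow (.get 0 i j)

def slackExpr (i j : NatExpr) : RealExpr :=
  .sub (.div (.get 1 i j) (attExpr i j)) (.mul thresholdExpr noiseExpr)

/-- Relative interference of the link `(i, j)` at the link `(k, l)`. -/
def affExpr (i j k l : NatExpr) : RealExpr :=
  .div (.mul thresholdExpr (.get 1 i j))
    (.add (.mul thresholdExpr (.get 1 i j)) (.mul (attExpr i l) (slackExpr k l)))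

def fixedWeight : RealExpr :=
  .add (affExpr (cell 10) (cell 11) (cell 22) (cell 23))
    (affExpr (cell 22) (cell 23) (cell 10) (cell 11))

def availableCond : Cond := natEq (.get 1 (cell 22) (cell 23)) (.lit 1)

def fixedCond : Cond :=
  .conj availableCond (.realLe
    (.mul (.mul thresholdExpr noiseExpr) (attExpr (cell 22) (cell 23))) (.get 1 (cell 22) (cell 23)))

def harmExpr : RealExpr :=
  .div (.mul (attExpr (cell 10) (cell 11)) (attExpr (cell 22) (cell 23)))
    (.add (attExpr (cell 10) (cell 11)) (attExpr (cell 22) (cell 23)))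

def nearExpr (i j : NatExpr) : RealExpr := .div harmExpr (.add (attExpr i j) harmExpr)

def globalWeight : RealExpr :=
  .add (.add (nearExpr (cell 10) (cell 22)) (nearExpr (cell 10) (cell 23)))
    (.add (nearExpr (cell 11) (cell 22)) (nearExpr (cell 11) (cell 23)))

section Input

variable {n : ℕ} {X : Type*} [MetricSpace X] {α β N : ℝ} {pos : Fin n → X}
  {G : SimpleGraph (Fin n)} {P : Fin n × Fin n → ℝ}

lemma input_size : (input β N pos G P).nat 0 0 0 = n := by simp [input]

lemma input_adj (u v : Fin n) : (input β N pos G P).nat 1 u v = 1 ↔ G.Adj u v := by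
  simp [input]

lemma input_dist (u v : Fin n) : (input β N pos G P).real 0 u v = dist (pos u) (pos v) := by
  simp [input]

lemma input_power (u v : Fin n) : (input β N pos G P).real 1 u v = P (u, v) := by
  simp [input]

lemma input_threshold : (input β N pos G P).real 2 0 0 = β := by simp [input]

lemma input_noise : (input β N pos G P).real 2 0 1 = N := by simp [input]

lemma input_nat_eq_zero {A : ℕ} (h : 2 ≤ A) : (input β N pos G P).nat A = 0 := by
  funext i j
  have h0 : A ≠ 0 := by omega
  have h1 : A ≠ 1 := by omega
  simp [input, h0, h1]

variable {σ : Memory}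

lemma attExpr_eval (h : SameInput (input β N pos G P) σ) {i j : NatExpr} {u v : Fin n}
    (hi : i.eval σ = u) (hj : j.eval σ = v) :
    (attExpr i j).eval α σ = dist (pos u) (pos v) ^ α := by
  simp only [attExpr, RealExpr.eval, hi, hj, h.dist, input_dist, abs_of_nonneg dist_nonneg]

lemma thresholdExpr_eval (h : SameInput (input β N pos G P) σ) : thresholdExpr.eval α σ = β := by
  simp only [thresholdExpr, RealExpr.eval, NatExpr.eval, h.param, input_threshold]

lemma noiseExpr_eval (h : SameInput (input β N pos G P) σ) : noiseExpr.eval α σ = N := by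
  simp only [noiseExpr, RealExpr.eval, NatExpr.eval, h.param, input_noise]

lemma affExpr_eval (h : SameInput (input β N pos G P) σ) {i j k l : NatExpr} {u v : Fin n × Fin n}
    (hi : i.eval σ = u.1) (hj : j.eval σ = u.2) (hk : k.eval σ = v.1) (hl : l.eval σ = v.2) :
    (affExpr i j k l).eval α σ = aff α β N pos P u v := by
  simp only [affExpr, slackExpr, RealExpr.eval, thresholdExpr_eval h, noiseExpr_eval h,
    attExpr_eval h hi hl, attExpr_eval h hk hl, hi, hj, hk, hl, h.power, input_power]
  rfl

lemma availableCond_eval (h : SameInput (input β N pos G P) σ) {v : Fin n × Fin n}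
    (h22 : σ.nat 22 0 0 = v.1) (h23 : σ.nat 23 0 0 = v.2) :
    availableCond.eval α σ ↔ G.Adj v.1 v.2 := by
  rw [availableCond, natEq_eval]
  simp only [NatExpr.eval, cell_eval, h22, h23, h.adj, input_adj]

lemma describes_fixedRule :
    Describes α (input β N pos G P) (fixedRule α β N pos G P) fixedCond fixedWeight where
  size := input_size
  len := input_dist
  ok σ h v h22 h23 := by
    rw [fixedCond, Cond.eval, availableCond_eval h h22 h23]
    rw [← cell_eval] at h22 h23
    simp only [Cond.eval, RealExpr.eval, thresholdExpr_eval h, noiseExpr_eval h,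
      attExpr_eval h h22 h23, h22, h23, h.power, input_power]
    rfl
  W σ h u v h10 h11 h22 h23 := by
    rw [← cell_eval] at h10 h11 h22 h23
    rw [fixedWeight, RealExpr.eval, affExpr_eval h h10 h11 h22 h23,
      affExpr_eval h h22 h23 h10 h11]
    rfl

lemma nearExpr_eval (h : SameInput (input β N pos G P) σ) {u v : Fin n × Fin n}
    (h10 : σ.nat 10 0 0 = u.1) (h11 : σ.nat 11 0 0 = u.2) (h22 : σ.nat 22 0 0 = v.1)
    (h23 : σ.nat 23 0 0 = v.2) {i j : NatExpr} {x y : Fin n} (hi : i.eval σ = x)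
    (hj : j.eval σ = y) : (nearExpr i j).eval α σ = near α pos (harm α pos u v) x y := by
  rw [← cell_eval] at h10 h11 h22 h23
  rw [nearExpr, RealExpr.eval, RealExpr.eval, harmExpr, RealExpr.eval, RealExpr.eval, RealExpr.eval,
    attExpr_eval h h10 h11, attExpr_eval h h22 h23, attExpr_eval h hi hj]
  rfl

lemma describes_globalRule (K : ℕ) :
    Describes α (input β N pos G P) (globalRule α pos G K) availableCond globalWeight where
  size := input_size
  len := input_dist
  ok σ h v h22 h23 := availableCond_eval h h22 h23
  W σ h u v h10 h11 h22 h23 := by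
    have key : ∀ {i j : NatExpr} {x y : Fin n}, i.eval σ = x → j.eval σ = y →
        (nearExpr i j).eval α σ = near α pos (harm α pos u v) x y :=
      nearExpr_eval h h10 h11 h22 h23
    rw [← cell_eval] at h10 h11 h22 h23
    rw [globalWeight, RealExpr.eval, RealExpr.eval, RealExpr.eval, key h10 h22, key h10 h23,
      key h11 h22, key h11 h23]
    rfl

end Input

/-! ### The output of the program -/

section Output

variable {n : ℕ} {σ₀ τ : Memory} {R : Rule (Fin n)} {Xs : ℕ → Finset (Fin n × Fin n)}
  {G : SimpleGraph (Fin n)}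

/-- The coloring in the memory. -/
def HoldsTrace.coloring (h : HoldsTrace σ₀ R Xs n τ) : Sym2 (Fin n) → ℕ :=
  Sym2.lift ⟨fun u v => τ.nat 3 u v, h.color_symm⟩

lemma HoldsTrace.coloring_eq (h : HoldsTrace σ₀ R Xs n τ) {q : ℕ} (hq : q < n) {v : Fin n × Fin n}
    (hv : v ∈ Xs q) : h.coloring s(v.1, v.2) = q := h.color q hq v hv

lemma HoldsTrace.mem_of_coloring (h : HoldsTrace σ₀ R Xs n τ) {v : Fin n × Fin n}
    (hv : v ∈ Rule.acc Xs n) : v ∈ Xs (h.coloring s(v.1, v.2)) := by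
  obtain ⟨q, hq, hv⟩ := Finset.mem_biUnion.1 hv
  rwa [h.coloring_eq (Finset.mem_range.1 hq) hv]

/-- The test measured the load in the whole greedy set; passing to the kept links can only decrease
it. -/
lemma HoldsTrace.light (h : HoldsTrace σ₀ R Xs n τ) (hR : R.Valid) {q : ℕ} (hq : q < n)
    {v : Fin n × Fin n} (hv : v ∈ Xs q) : R.ok v ∧ R.K * R.load (Xs q) v ≤ 4 := by
  classical
  obtain ⟨H, hH, -, hX⟩ := h.trace q hq
  have hsub : Xs q ⊆ H := hX ▸ Finset.filter_subset _ _
  refine ⟨hH.ok v (hsub hv), ?_⟩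
  have h1 : R.K * R.load H v ≤ 4 := by
    rw [hX] at hv
    exact (Finset.mem_filter.1 hv).2
  refine le_trans (mul_le_mul_of_nonneg_left ?_ (Nat.cast_nonneg _)) h1
  exact Finset.sum_le_sum_of_subset_of_nonneg (Finset.erase_subset_erase _ hsub) fun u hu _ =>
    hR.nonneg _ _ (hH.ok u (Finset.mem_of_mem_erase hu)) (hH.ok v (hsub hv))

lemma HoldsTrace.adj (h : HoldsTrace σ₀ R Xs n τ) (hR : R.Valid)
    (hok : ∀ v, R.ok v → G.Adj v.1 v.2) {v : Fin n × Fin n} (hv : v ∈ Rule.acc Xs n) :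
    G.Adj v.1 v.2 := by
  obtain ⟨q, hq, hv⟩ := Finset.mem_biUnion.1 hv
  exact hok v (h.light hR (Finset.mem_range.1 hq) hv).1

lemma HoldsTrace.outputsTree (h : HoldsTrace σ₀ R Xs n τ) (hR : R.Valid)
    (hok : ∀ v, R.ok v → G.Adj v.1 v.2) :
    OutputsTree τ (linkGraph (Rule.acc Xs n)) h.coloring (τ.nat 5 0 0) := by
  refine ⟨fun u v => ?_, fun u v _ => rfl, rfl⟩
  rw [linkGraph_adj, h.tree (u, v)]
  refine ⟨fun h' => h'.2, fun h' => ⟨?_, h'⟩⟩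
  rcases h' with h' | h'
  · exact (h.adj hR hok h').ne
  · exact (h.adj hR hok h').ne.symm

lemma HoldsTrace.isOrientation (h : HoldsTrace σ₀ R Xs n τ) (hR : R.Valid)
    (hok : ∀ v, R.ok v → G.Adj v.1 v.2) :
    IsOrientation (linkGraph (Rule.acc Xs n)) (Rule.acc Xs n) :=
  linkGraph_isOrientation h.trace.indep fun _ he => (h.adj hR hok he).ne

lemma HoldsTrace.isColoredSpanningTree [Nonempty (Fin n)] (h : HoldsTrace σ₀ R Xs n τ)
    (hR : R.Valid) (hok : ∀ v, R.ok v → G.Adj v.1 v.2) {C : ℝ} {χ : ℕ} (hcov : R.Coverable C χ) :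
    IsColoredSpanningTree G (linkGraph (Rule.acc Xs n)) h.coloring (τ.nat 5 0 0) := by
  refine ⟨fun u v huv => ?_, linkGraph_isTree (h.trace.connected hR hcov (by simp)) h.trace.indep, ?_⟩
  · rcases (linkGraph_adj.1 huv).2 with h' | h'
    · exact h.adj hR hok h'
    · exact (h.adj hR hok h').symm
  · have key : ∀ v ∈ Rule.acc Xs n, h.coloring s(v.1, v.2) < τ.nat 5 0 0 := by
      intro v hv
      obtain ⟨q, hq, hv⟩ := Finset.mem_biUnion.1 hv
      have hq := Finset.mem_range.1 hq
      rw [h.coloring_eq hq hv]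
      by_contra hcon
      rw [h.empty_of_count_le q hq (not_lt.1 hcon)] at hv
      simp at hv
    intro e
    refine Sym2.ind (fun u v huv => ?_) e
    rcases (linkGraph_adj.1 huv).2 with h' | h'
    · exact key _ h'
    · rw [Sym2.eq_swap]; exact key _ h'

lemma HoldsTrace.slot_eq (h : HoldsTrace σ₀ R Xs n τ) {i : ℕ} (hi : i < n) :
    slot (Rule.acc Xs n) h.coloring i = Xs i := by
  ext v
  rw [slot, Finset.mem_filter]
  constructor
  · rintro ⟨hv, rfl⟩
    exact h.mem_of_coloring hv
  · intro hv
    exact ⟨Finset.mem_biUnion.2 ⟨i, Finset.mem_range.2 hi, hv⟩, h.coloring_eq hi hv⟩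

end Output

end RealRAM

/-! ### Optimal schedules -/

namespace ConnSched

open Finset

variable {V : Type*}

lemma IsColoredSpanningTree.joined [DecidableEq V] {G T : SimpleGraph V} {color : Sym2 V → ℕ} {k : ℕ}
    {D : Finset (V × V)} (h : IsColoredSpanningTree G T color k) (hD : IsOrientation T D) (x y : V) :
    Joined ((range k).biUnion (slot D color)) x y := by
  refine (h.isTree.connected.preconnected x y).mono fun u v huv => linkGraph_adj.2 ⟨huv.ne, ?_⟩
  have hc : color s(u, v) < k := h.color_lt _ huv
  have hc' : color s(v, u) < k := h.color_lt _ huv.symm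
  by_cases hv : (v, u) ∈ D
  · exact Or.inr (mem_biUnion.2 ⟨_, mem_range.2 hc', mem_filter.2 ⟨hv, rfl⟩⟩)
  · exact Or.inl (mem_biUnion.2 ⟨_, mem_range.2 hc, mem_filter.2 ⟨(hD.2 u v huv).2 hv, rfl⟩⟩)

lemma IsColoredSpanningTree.adj_of_mem_slot {G T : SimpleGraph V} {color : Sym2 V → ℕ} {k i : ℕ}
    {D : Finset (V × V)} (h : IsColoredSpanningTree G T color k) (hD : IsOrientation T D)
    {v : V × V} (hv : v ∈ slot D color i) : G.Adj v.1 v.2 :=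
  h.le (hD.1 _ _ (mem_filter.1 hv).1)

end ConnSched

namespace SINR

open Finset ConnSched

lemma Feasible.subset {V X : Type*} [MetricSpace X] [DecidableEq V] {α β N : ℝ} {pos : V → X}
    {P : V × V → ℝ} {S S' : Finset (V × V)} (h : Feasible α β N pos P S) (hS : S' ⊆ S) :
    Feasible α β N pos P S' := by
  refine fun v hv => ⟨(h v (hS hv)).1, (h v (hS hv)).2.trans ?_⟩
  exact ENNReal.div_le_div_left (add_le_add le_rfl
    (sum_le_sum_of_subset (erase_subset_erase _ hS))) _

variable {n : ℕ} {X : Type*} [MetricSpace X] {α β N : ℝ} {pos : Fin n → X}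
  {G : SimpleGraph (Fin n)}

lemma fixed_coverable (hα : 0 < α) (hβ : 1 ≤ β) (hN : 0 ≤ N) (hpos : Function.Injective pos)
    {P : Fin n × Fin n → ℝ} (hP : IsMonotonePower α pos G P) {χ : ℕ}
    (h : FixedSchedulable α β N pos G P χ) :
    (fixedRule α β N pos G P).Coverable (2 * (1 + 3 * 3 ^ α)) χ := by
  obtain ⟨T, color, D, hT, hD, hfeas⟩ := h
  refine ⟨slot D color, hT.joined hD, fun i hi O hO => ?_⟩
  exact fixed_cover hα hβ hN hpos hP (fun v hv => hT.adj_of_mem_slot hD (hO hv))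
    ((hfeas i hi).subset hO)

lemma global_coverable (hα : 0 < α) (hβ : 1 ≤ β) (hN : 0 ≤ N) (hpos : Function.Injective pos)
    {K χ : ℕ} (h : GlobalSchedulable α β N pos G χ) :
    (globalRule α pos G K).Coverable (4 * (1 + 2 * 3 ^ α)) χ := by
  obtain ⟨T, color, D, hT, hD, hfeas⟩ := h
  refine ⟨slot D color, hT.joined hD, fun i hi O hO => ?_⟩
  obtain ⟨P, hP⟩ := hfeas i hi
  exact global_cover hα hβ hN hpos (fun v hv => hT.adj_of_mem_slot hD (hO hv)) (hP.subset hO)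

/-- The load does not grow if the directions of links are changed. -/
lemma globalRule_load_le {K : ℕ} {D E S : Finset (Fin n × Fin n)} {T : SimpleGraph (Fin n)}
    (hD : IsOrientation T D) (hSD : S ⊆ D) (hSE : ∀ v ∈ S, v ∈ E ∨ v.swap ∈ E)
    (hE : ∀ v ∈ E, K * (globalRule α pos G K).load E v ≤ 4) {v : Fin n × Fin n}
    (hv : v ∈ S) : K * (globalRule α pos G K).load S v ≤ 4 := by
  -- Each link is turned into the direction in which `E` holds it. Weights do not notice this, and
  -- the map is injective on `S` because an orientation never contains a link together with its
  -- reverse.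
  let c : Fin n × Fin n → Fin n × Fin n := fun e => if e ∈ E then e else e.swap
  have hc : ∀ e, c e = e ∨ c e = e.swap := fun e => by
    by_cases h : e ∈ E
    · exact Or.inl (if_pos h)
    · exact Or.inr (if_neg h)
  have hcE : ∀ e ∈ S, c e ∈ E := fun e he => by
    by_cases h : e ∈ E
    · simpa only [c, if_pos h] using h
    · simpa only [c, if_neg h] using (hSE e he).resolve_left h
  have hW : ∀ e f, (globalRule α pos G K).W (c e) (c f) = (globalRule α pos G K).W e f := by
    intro e f
    rcases hc e with h | h <;> rcases hc f with h' | h' <;>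
      simp only [h, h', globalRule_W_swap_left, globalRule_W_swap_right]
  have hinj : ∀ e ∈ S, ∀ f ∈ S, c e = c f → e = f := by
    intro e he f hf hef
    have hns : e ≠ f.swap := by
      rintro rfl
      have h1 := hSD hf
      have h2 := hSD he
      exact (hD.2 f.1 f.2 (hD.1 _ _ h1)).1 h1 h2
    rcases hc e with h | h <;> rcases hc f with h' | h' <;> rw [h, h'] at hef
    · exact hef
    · exact absurd hef hns
    · exact absurd (by rw [← hef, Prod.swap_swap]) hns
    · exact Prod.swap_injective hef
  refine le_trans (mul_le_mul_of_nonneg_left ?_ (Nat.cast_nonneg _)) (hE (c v) (hcE v hv))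
  calc (globalRule α pos G K).load S v
      = ∑ u ∈ S.erase v, (globalRule α pos G K).W (c u) (c v) :=
        sum_congr rfl fun u _ => (hW u v).symm
    _ = ∑ u ∈ (S.erase v).image c, (globalRule α pos G K).W u (c v) := by
        rw [sum_image]
        exact fun e he f hf => hinj e (mem_of_mem_erase he) f (mem_of_mem_erase hf)
    _ ≤ (globalRule α pos G K).load E (c v) := by
        refine sum_le_sum_of_subset_of_nonneg (fun u hu => ?_) fun u _ _ => ?_
        · obtain ⟨e, he, rfl⟩ := mem_image.1 hu
          have heS := mem_of_mem_erase he
          exact mem_erase.2 ⟨fun h => ne_of_mem_erase he (hinj e heS v hv h), hcE e heS⟩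
        · have h := harm_nonneg (α := α) (pos := pos) u (c v)
          exact add_nonneg (add_nonneg (near_nonneg h _ _) (near_nonneg h _ _))
            (add_nonneg (near_nonneg h _ _) (near_nonneg h _ _))

end SINR

theorem mainTheorem5 (α β : ℝ) (hα : 0 < α) (hβ : 1 ≤ β) :
    -- fixed monotone power assignments
    (∃ (C : ℝ) (prog : RealRAM.Program) (q : Polynomial ℕ),
      ∀ (n : ℕ) (X : Type*) [MetricSpace X] (pos : Fin n → X), Function.Injective pos →
      ∀ (G : SimpleGraph (Fin n)) (N : ℝ), 0 ≤ N →
      ∀ P : Fin n × Fin n → ℝ, SINR.IsMonotonePower α pos G P →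
      ∃ (τ : RealRAM.Memory) (t : ℕ),
        RealRAM.Exec α prog (RealRAM.input β N pos G P) τ t ∧ t ≤ q.eval n ∧
        ∀ χ : ℕ, IsLeast {k | ConnSched.FixedSchedulable α β N pos G P k} χ →
          ∃ (T : SimpleGraph (Fin n)) (color : Sym2 (Fin n) → ℕ) (D : Finset (Fin n × Fin n))
            (k : ℕ) (κ : ℝ),
            RealRAM.OutputsTree τ T color k ∧ RealRAM.OutputsLinks τ D ∧
            ConnSched.IsColoredSpanningTree G T color k ∧ ConnSched.IsOrientation T D ∧
            0 < κ ∧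
            (∀ i < k, SINR.Feasible α β N pos P (ConnSched.slot D color i) ∧
              SINR.Feasible α β N pos (SINR.dualPower α κ pos P)
                (ConnSched.reversed (ConnSched.slot D color i))) ∧
            2 * (k : ℝ) ≤ C * Real.log n * χ) ∧
    -- global power control
    (∃ (C : ℝ) (prog : RealRAM.Program) (q : Polynomial ℕ),
      ∀ (n : ℕ) (X : Type*) [MetricSpace X] (pos : Fin n → X), Function.Injective pos →
      ∀ (G : SimpleGraph (Fin n)) (N : ℝ), 0 ≤ N →
      ∃ (τ : RealRAM.Memory) (t : ℕ),
        RealRAM.Exec α prog (RealRAM.input β N pos G 0) τ t ∧ t ≤ q.eval n ∧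
        ∀ χ : ℕ, IsLeast {k | ConnSched.GlobalSchedulable α β N pos G k} χ →
          ∃ (T : SimpleGraph (Fin n)) (color : Sym2 (Fin n) → ℕ) (k : ℕ),
            RealRAM.OutputsTree τ T color k ∧
            ConnSched.IsColoredSpanningTree G T color k ∧
            (∀ D : Finset (Fin n × Fin n), ConnSched.IsOrientation T D →
              ∀ i < k, ∃ Q : Fin n × Fin n → ℝ,
                SINR.Feasible α β N pos Q (ConnSched.slot D color i)) ∧
            (k : ℝ) ≤ C * Real.log n * χ) := by
  have hβ0 : 0 < β := by linarith
  constructor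
  · obtain ⟨q, hq⟩ := (RealRAM.mainProg 16 RealRAM.fixedCond RealRAM.fixedWeight).exists_polynomial
    -- The constant of `rounds_le` with K = 16 and the conflict bound of `fixed_cover`, doubled for
    -- the two directions.
    refine ⟨2 * (4 * (1 + 16 * (2 * (1 + 3 * 3 ^ α))) + 2),
      RealRAM.mainProg 16 RealRAM.fixedCond RealRAM.fixedWeight, q, ?_⟩
    intro n X _ pos hpos G N hN P hP
    obtain ⟨τ, t, hexec, ht, Xs, hτ⟩ := RealRAM.run_mainProg
      (RealRAM.describes_fixedRule (α := α) (β := β) (N := N) (pos := pos) (G := G) (P := P))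
      (RealRAM.input_nat_eq_zero le_rfl) (RealRAM.input_nat_eq_zero (by norm_num))
      (RealRAM.input_nat_eq_zero (by norm_num)) (RealRAM.input_nat_eq_zero (by norm_num))
    refine ⟨τ, t, hexec, ht.trans (hq n).le, fun χ hχ => ?_⟩
    -- Only the existence of a schedule excludes the empty instance; halting needed no such
    -- assumption.
    have hne : Nonempty (Fin n) := by
      obtain ⟨T, _, _, hT, _⟩ := hχ.1
      exact hT.isTree.connected.nonempty
    have hR := SINR.fixedRule_valid (N := N) hβ0.le hpos hP
    have hcov := SINR.fixed_coverable hα hβ hN hpos hP hχ.1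
    have hok : ∀ v, (SINR.fixedRule α β N pos G P).ok v → G.Adj v.1 v.2 := fun v hv => hv.1
    have hk : τ.nat 5 0 0 ≤ n := hτ.count_le
    have hterm : ∀ e : Fin n × Fin n, 0 ≤ |2 * β * N * P e| := fun e => abs_nonneg _
    -- A single scaling constant exceeding 2βN · P e for all links serves every slot; the summand 1
    -- makes it positive without noise.
    refine ⟨_, hτ.coloring, ConnSched.Rule.acc Xs n, _, 1 + ∑ e, |2 * β * N * P e|,
      hτ.outputsTree hR hok, fun u v => (hτ.links (u, v)).symm, hτ.isColoredSpanningTree hR hok hcov,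
      hτ.isOrientation hR hok, by positivity, fun i hi => ?_, ?_⟩
    · have hin : i < n := hi.trans_le hk
      rw [hτ.slot_eq hin]
      have hload : ∀ v ∈ Xs i, (SINR.fixedRule α β N pos G P).load (Xs i) v ≤ 1 / 4 := by
        intro v hv
        have h : ((16 : ℕ) : ℝ) * (SINR.fixedRule α β N pos G P).load (Xs i) v ≤ 4 :=
          (hτ.light hR hin hv).2
        push_cast at h
        linarith
      obtain ⟨h1, h2⟩ := SINR.fixed_feasible hα hβ0 hN hpos hP
        (fun v hv => (hτ.light hR hin hv).1) hload
      refine ⟨h1, h2 _ (by positivity) fun v _ => ?_⟩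
      have h3 := Finset.single_le_sum (f := fun e => |2 * β * N * P e|) (fun e _ => hterm e)
        (Finset.mem_univ v)
      have h4 := le_abs_self (2 * β * N * P v)
      linarith
    · have h := hτ.trace.rounds_le hR hcov (by positivity) hk hτ.count_last
      rw [Fintype.card_fin] at h
      have h16 : (((SINR.fixedRule α β N pos G P).K : ℕ) : ℝ) = 16 := by
        norm_num [SINR.fixedRule]
      rw [h16] at h
      linarith
  -- The bound makes 32 β² · 3 ^ α · (16/K) ≤ 1, as `exists_powers` requires. `K` depends only on α
  -- and β, so it may be a literal of the program.
  · obtain ⟨K, hK⟩ := exists_nat_ge (512 * β ^ 2 * 3 ^ α)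
    have hKpos : 0 < K := by
      have : (0 : ℝ) < 512 * β ^ 2 * 3 ^ α := by positivity
      exact_mod_cast this.trans_le hK
    obtain ⟨q, hq⟩ :=
      (RealRAM.mainProg K RealRAM.availableCond RealRAM.globalWeight).exists_polynomial
    refine ⟨4 * (1 + K * (4 * (1 + 2 * 3 ^ α))) + 2,
      RealRAM.mainProg K RealRAM.availableCond RealRAM.globalWeight, q, ?_⟩
    intro n X _ pos hpos G N hN
    obtain ⟨τ, t, hexec, ht, Xs, hτ⟩ := RealRAM.run_mainProg
      (RealRAM.describes_globalRule (α := α) (β := β) (N := N) (pos := pos) (G := G) (P := 0) K)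
      (RealRAM.input_nat_eq_zero le_rfl) (RealRAM.input_nat_eq_zero (by norm_num))
      (RealRAM.input_nat_eq_zero (by norm_num)) (RealRAM.input_nat_eq_zero (by norm_num))
    refine ⟨τ, t, hexec, ht.trans (hq n).le, fun χ hχ => ?_⟩
    have hne : Nonempty (Fin n) := by
      obtain ⟨T, _, _, hT, _⟩ := hχ.1
      exact hT.isTree.connected.nonempty
    have hR := SINR.globalRule_valid (α := α) (pos := pos) (G := G) hKpos
    have hcov := SINR.global_coverable (K := K) hα hβ hN hpos hχ.1
    have hok : ∀ v, (SINR.globalRule α pos G K).ok v → G.Adj v.1 v.2 := fun v hv => hv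
    have hk : τ.nat 5 0 0 ≤ n := hτ.count_le
    have htree := hτ.isColoredSpanningTree hR hok hcov
    refine ⟨_, hτ.coloring, _, hτ.outputsTree hR hok, htree, fun D hD i hi => ?_, ?_⟩
    · have hin : i < n := hi.trans_le hk
      refine SINR.global_feasible hα hβ hN hpos hK (fun v hv => htree.adj_of_mem_slot hD hv)
        fun v hv => SINR.globalRule_load_le (E := Xs i) hD (Finset.filter_subset _ _)
          (fun u hu => ?_) (fun u hu => (hτ.light hR hin hu).2) hv
      obtain ⟨huD, rfl⟩ := Finset.mem_filter.1 hu
      rcases (ConnSched.linkGraph_adj.1 (hD.1 _ _ huD)).2 with h | h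
      · exact Or.inl (hτ.mem_of_coloring h)
      · rw [Sym2.eq_swap]
        exact Or.inr (hτ.mem_of_coloring h)
    · have h := hτ.trace.rounds_le hR hcov (by positivity) hk hτ.count_last
      rw [Fintype.card_fin] at h
      exact h
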